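/- Let $(M^2,[g],[\mathrm P])$ be a simply connected Möbius surface: a simply connected smooth surface with a conformal class $[g]$ of Riemannian metrics and an assignment, to each $g_{ab}\in[g]$, of a smooth symmetric tensor $\mathrm P_{ab}$ with $g^{ab}\mathrm P_{ab}=K$ (the Gauss curvature of $g$), such that under $\widehat g_{ab}=\Omega^2g_{ab}$, with $\Upsilon_a=\nabla_a\log\Omega$, $$\widehat{\mathrm P}_{ab}=\mathrm P_{ab}-\nabla_a\Upsilon_b+\Upsilon_a\Upsilon_b-\tfrac12 g_{ab}\Upsilon_c\Upsilon^c .$$ Let $\mathcal E[1]$ be the smooth densities of conformal weight $1$ ($\widehat\sigma=\Omega\sigma$) and let $\mathcal D_{ab}:\mathcal E[1]\to\mathcal E_{(ab)_\circ}[1]$ be the conformal-to-Einstein operator $$\mathcal D_{ab}\sigma=\text{trace-free part of }(\nabla_a\nabla_b+\mathrm P_{ab})\sigma .$$ For $g\in[g]$ with volume form $\epsilon_{ab}$ (normalised by $\epsilon^{ab}\epsilon_{cb}=\delta_c{}^a$; indices are moved with $g$) put $$Y_c=\epsilon^{ab}(\nabla_a\mathrm P_{bc}-\nabla_b\mathrm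 P_{ac}),\quad U_a=\epsilon_{ac}Y^c,\quad \mu=\tfrac12\nabla_aY^a,\quad \phi=\tfrac12\nabla_aU^a,$$ $$V_d=U^e\nabla_eY_d+\mu U_d-3\phi Y_d,\qquad k=\mathrm P_{ed}U^eY^d-U^e\nabla_e\mu+3\phi\mu .$$ The vanishing conditions below do not depend on the choice of $g\in[g]$. 1. (Flat case.) If $Y_a=0$ everywhere, then $\dim\ker\mathcal D=4$. 2. (Non-flat generic case.) Suppose $Y_a\ne0$ and $U_aV^a\neq0$ at every point. Put $$K_a=\frac{1}{U_cV^c}\left(\mu\,\epsilon_a{}^bV_b+kU_a\right),\qquad E_{ab}=\nabla_aK_b+K_aK_b+\mathrm P_{ab}-\tfrac12(\nabla_cK^c+K_cK^c+K)g_{ab}.$$ If $E_{ab}=0$ everywhere, then $\dim\ker\mathcal D=1$; otherwise $\ker\mathcal D=0$. 3. (Non-flat non-generic ODE case.) Suppose $Y_a\neq0$ at every point and $U_aV^a=0$ everywhere. Put $\rho=Y_aY^a$, let $f$ be the function with $V_a=fY_a$, and let $$\tilde Q=\mathrm P_{ab}Y^aY^b-\frac{Y^aY^b\nabla_a\nabla_b\rho}{6\rho}+\frac{7(Y^a\nabla_a\rho)^2}{36\rho^2},\qquad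 \tilde R=\mathrm P_{ab}U^aU^b-\frac{U^aU^b\nabla_a\nabla_b\rho}{6\rho}+\frac{7(U^a\nabla_a\rho)^2}{36\rho^2}.$$ Suppose that $$Y^a\nabla_a\left(\tfrac{2f}{3}\rho^{-2/3}\right)=0,\qquad Y^a\nabla_a\left((\tilde R-\tilde Q)\rho^{-4/3}\right)=0 .$$ If $k+f\mu=0$ everywhere (so that, locally, the equation $\mathcal D\sigma=0$ reduces to the second order linear ODE $\xi_{\eta\eta}+\frac{2f}{3}\rho^{-2/3}\xi_\eta+(\tilde R-\tilde Q)\rho^{-4/3}\xi=0$, where $\nabla_a\eta=\rho^{-1/3}U_a$ and $\sigma=\rho^{-1/6}\xi$), then $\dim\ker\mathcal D=2$; otherwise $\ker\mathcal D=0$. -/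

import Mathlib

open scoped Manifold ContDiff Topology

noncomputable section

namespace Moebius

/-- The model space `ℝ²` of surfaces. -/
abbrev E2 : Type := EuclideanSpace ℝ (Fin 2)

/-! ### Tensor calculus in a coordinate chart

Functions, `1`-forms and covariant `2`-tensors on an open subset of `ℝ²` are given by their
components. `G` always stands for the components of a Riemannian metric, `P` for those of a Rho
tensor. Indices are lowered and raised with `G`. -/

/-- Components of a function. -/
abbrev Comp0 : Type := E2 → ℝ
/-- Components of a `1`-form. -/
abbrev Comp1 : Type := Fin 2 → E2 → ℝ
/-- Components of a covariant `2`-tensor. -/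
abbrev Comp2 : Type := Fin 2 → Fin 2 → E2 → ℝ

/-- The standard coordinate vector `∂/∂xⁱ`. -/
def basisVec (i : Fin 2) : E2 := EuclideanSpace.single i 1

/-- The partial derivative `∂ᵢ u`. -/
def pd (i : Fin 2) (u : Comp0) : Comp0 := fun x => fderiv ℝ u x (basisVec i)

/-- `det (g_ab)`. -/
def detG (G : Comp2) : Comp0 := fun x => G 0 0 x * G 1 1 x - G 0 1 x * G 1 0 x

/-- The inverse metric `g^{ab}`. -/
def ginv (G : Comp2) : Comp2 := fun a b x => (Matrix.of fun i j => G i j x)⁻¹ a b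

/-- The Christoffel symbols `Γ^c_{ab}` of the Levi-Civita connection. -/
def christoffel (G : Comp2) (c a b : Fin 2) : Comp0 := fun x =>
  (1 / 2) * ∑ d, ginv G c d x * (pd a (G d b) x + pd b (G d a) x - pd d (G a b) x)

/-- `∇_a α_b`. -/
def nabla1 (G : Comp2) (α : Comp1) : Comp2 := fun a b x =>
  pd a (α b) x - ∑ c, christoffel G c a b x * α c x

/-- `∇_a T_{bc}`. -/
def nabla2 (G : Comp2) (T : Comp2) (a b c : Fin 2) : Comp0 := fun x =>
  pd a (T b c) x - ∑ d, christoffel G d a b x * T d c x - ∑ d, christoffel G d a c x * T b d x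

/-- The gradient `∇_a u`. -/
def grad (u : Comp0) : Comp1 := fun a => pd a u

/-- The Hessian `∇_a ∇_b u`. -/
def hess (G : Comp2) (u : Comp0) : Comp2 := nabla1 G (grad u)

/-- The curvature `R(∂_a, ∂_b) ∂_c = R^d_{cab} ∂_d`; here `riem G d c a b` is `R^d_{cab}`. -/
def riem (G : Comp2) (d c a b : Fin 2) : Comp0 := fun x =>
  pd a (christoffel G d b c) x - pd b (christoffel G d a c) x
    + ∑ m, christoffel G d a m x * christoffel G m b c x
    - ∑ m, christoffel G d b m x * christoffel G m a c x

/-- The scalar curvature `R = g^{bc} R^a_{cab}` (equal to `2` on the round unit sphere). -/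
def scalarCurv (G : Comp2) : Comp0 := fun x => ∑ a, ∑ b, ∑ c, ginv G b c x * riem G a c a b x

/-- The Gauss curvature `K = R / 2`. -/
def gaussCurv (G : Comp2) : Comp0 := fun x => scalarCurv G x / 2

/-- The metric trace `g^{ab} T_{ab}`. -/
def trace (G T : Comp2) : Comp0 := fun x => ∑ a, ∑ b, ginv G a b x * T a b x

/-- The trace-free part `T_{ab} - ½ g^{cd} T_{cd} g_{ab}`. -/
def traceFree (G T : Comp2) : Comp2 := fun a b x => T a b x - (1 / 2) * trace G T x * G a b x

/-- `α^a = g^{ab} α_b`. -/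
def raise (G : Comp2) (α : Comp1) : Comp1 := fun a x => ∑ b, ginv G a b x * α b x

/-- The inner product `α_a θ^a` of two `1`-forms. -/
def pair (G : Comp2) (α θ : Comp1) : Comp0 := fun x => ∑ a, α a x * raise G θ a x

/-- The directional derivative `α^a ∇_a u`. -/
def dirDeriv (G : Comp2) (α : Comp1) (u : Comp0) : Comp0 := pair G (grad u) α

/-- `T_{ab} α^a θ^b`. -/
def eval2 (G T : Comp2) (α θ : Comp1) : Comp0 := fun x =>
  ∑ a, ∑ b, T a b x * raise G α a x * raise G θ b x

/-- The divergence `∇_a α^a`. -/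
def divergence (G : Comp2) (α : Comp1) : Comp0 := trace G (nabla1 G α)

/-- The volume form `ε_{ab}`, for the orientation in which the coordinates are positive. Reversing
the orientation changes the signs of `ε`, `Y`, `V`, `μ`, `k` and leaves `U`, `φ`, `ρ`, `f`, `K_a`,
`E_{ab}`, `Q̃`, `R̃` unchanged, so none of the conditions imposed on a surface below depends on it. -/
def vol (G : Comp2) : Comp2 := fun a b x => Real.sqrt (detG G x) * !![0, 1; -1, 0] a b

/-- `ε^{ab}`, both indices raised; it satisfies `ε^{ab} ε_{cb} = δ_c^a`. -/
def volUp (G : Comp2) : Comp2 := fun a b x =>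
  ∑ c, ∑ d, ginv G a c x * ginv G b d x * vol G c d x

/-- The Cotton-York tensor `Y_{abc} = ∇_a P_{bc} - ∇_b P_{ac}`. -/
def cotton (G P : Comp2) (a b c : Fin 2) : Comp0 := fun x =>
  nabla2 G P a b c x - nabla2 G P b a c x

/-- `Y_c = ε^{ab} Y_{abc}`. -/
def Yform (G P : Comp2) : Comp1 := fun c x => ∑ a, ∑ b, volUp G a b x * cotton G P a b c x

/-- `U_a = ε_{ac} Y^c`. -/
def Uform (G P : Comp2) : Comp1 := fun a x => ∑ c, vol G a c x * raise G (Yform G P) c x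

/-- `μ = ½ ∇_a Y^a`. -/
def muScalar (G P : Comp2) : Comp0 := fun x => divergence G (Yform G P) x / 2

/-- `φ = ½ ∇_a U^a`. -/
def phiScalar (G P : Comp2) : Comp0 := fun x => divergence G (Uform G P) x / 2

/-- `V_d = U^e ∇_e Y_d + μ U_d - 3 φ Y_d`. -/
def Vform (G P : Comp2) : Comp1 := fun d x =>
  (∑ e, raise G (Uform G P) e x * nabla1 G (Yform G P) e d x)
    + muScalar G P x * Uform G P d x - 3 * phiScalar G P x * Yform G P d x

/-- `U_a V^a`. -/
def UV (G P : Comp2) : Comp0 := pair G (Uform G P) (Vform G P)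

/-- `k = P_{ed} U^e Y^d - U^e ∇_e μ + 3 φ μ`. -/
def kScalar (G P : Comp2) : Comp0 := fun x =>
  eval2 G P (Uform G P) (Yform G P) x - dirDeriv G (Uform G P) (muScalar G P) x
    + 3 * phiScalar G P x * muScalar G P x

/-- `K_a = (μ ε_a^b V_b + k U_a) / (U_c V^c)`, meaningful where `U_c V^c ≠ 0`. -/
def Kform (G P : Comp2) : Comp1 := fun a x =>
  (muScalar G P x * (∑ c, vol G a c x * raise G (Vform G P) c x) + kScalar G P x * Uform G P a x)
    / UV G P x

/-- `E_{ab} = ∇_a K_b + K_a K_b + P_{ab} - ½ (∇_c K^c + K_c K^c + K) g_{ab}`, meaningful where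
`U_c V^c ≠ 0`. -/
def Etensor (G P : Comp2) : Comp2 := fun a b x =>
  nabla1 G (Kform G P) a b x + Kform G P a x * Kform G P b x + P a b x
    - (1 / 2) * (divergence G (Kform G P) x + pair G (Kform G P) (Kform G P) x + gaussCurv G x)
      * G a b x

/-- `ρ = Y_a Y^a`. -/
def rhoScalar (G P : Comp2) : Comp0 := pair G (Yform G P) (Yform G P)

/-- `f = V_a Y^a / ρ`. Where `Y ≠ 0` and `U_a V^a = 0`, this is the unique function with
`V_a = f Y_a`. -/
def fScalar (G P : Comp2) : Comp0 := fun x =>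
  pair G (Vform G P) (Yform G P) x / rhoScalar G P x

/-- `P_{ab} α^a α^b - α^a α^b ∇_a ∇_b ρ / (6 ρ) + 7 (α^a ∇_a ρ)² / (36 ρ²)`. -/
def tildeScalar (G P : Comp2) (α : Comp1) : Comp0 := fun x =>
  eval2 G P α α x - eval2 G (hess G (rhoScalar G P)) α α x / (6 * rhoScalar G P x)
    + 7 * dirDeriv G α (rhoScalar G P) x ^ 2 / (36 * rhoScalar G P x ^ 2)

/-- `Q̃`. -/
def Qtilde (G P : Comp2) : Comp0 := tildeScalar G P (Yform G P)

/-- `R̃`. -/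
def Rtilde (G P : Comp2) : Comp0 := tildeScalar G P (Uform G P)

/-- The coefficient `(2 f / 3) ρ^{-2/3}`. -/
def odeCoeff1 (G P : Comp2) : Comp0 := fun x =>
  2 * fScalar G P x / 3 * rhoScalar G P x ^ (-(2 / 3) : ℝ)

/-- The coefficient `(R̃ - Q̃) ρ^{-4/3}`. -/
def odeCoeff0 (G P : Comp2) : Comp0 := fun x =>
  (Rtilde G P x - Qtilde G P x) * rhoScalar G P x ^ (-(4 / 3) : ℝ)

/-- The conformal-to-Einstein operator: the trace-free part of `(∇_a ∇_b + P_{ab}) u`. -/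
def confEinstein (G P : Comp2) (u : Comp0) : Comp2 :=
  traceFree G fun a b x => hess G u a b x + P a b x * u x

/-! ### Linearity of the operator -/

lemma pd_add {u v : Comp0} {x : E2} (hu : DifferentiableAt ℝ u x) (hv : DifferentiableAt ℝ v x)
    (i : Fin 2) : pd i (u + v) x = pd i u x + pd i v x := by
  simp [pd, fderiv_add hu hv]

lemma pd_smul {u : Comp0} {x : E2} (hu : DifferentiableAt ℝ u x) (c : ℝ)
    (i : Fin 2) : pd i (c • u) x = c * pd i u x := by
  simp [pd, fderiv_const_smul hu]

lemma pd_congr {u v : Comp0} {x : E2} (h : u =ᶠ[𝓝 x] v) (i : Fin 2) : pd i u x = pd i v x := by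
  simp [pd, h.fderiv_eq]

lemma eventually_differentiableAt {u : Comp0} {x : E2} (hu : ContDiffAt ℝ 2 u x) :
    ∀ᶠ y in 𝓝 x, DifferentiableAt ℝ u y := by
  filter_upwards [hu.eventually (by simp)] with y hy
  exact hy.differentiableAt (by simp)

lemma differentiableAt_pd {u : Comp0} {x : E2} (hu : ContDiffAt ℝ 2 u x) (i : Fin 2) :
    DifferentiableAt ℝ (pd i u) x := by
  have h : ContDiffAt ℝ 1 (fderiv ℝ u) x := hu.fderiv_right (by norm_num)
  exact (h.differentiableAt (by simp)).clm_apply (differentiableAt_const _)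

lemma hess_add (G : Comp2) {u v : Comp0} {x : E2} (hu : ContDiffAt ℝ 2 u x)
    (hv : ContDiffAt ℝ 2 v x) (a b : Fin 2) :
    hess G (u + v) a b x = hess G u a b x + hess G v a b x := by
  have e1 : ∀ i, pd i (u + v) =ᶠ[𝓝 x] pd i u + pd i v := fun i => by
    filter_upwards [eventually_differentiableAt hu, eventually_differentiableAt hv] with y h1 h2
    exact pd_add h1 h2 i
  simp only [hess, nabla1, grad, pd_congr (e1 b) a,
    pd_add (differentiableAt_pd hu b) (differentiableAt_pd hv b) a,
    pd_add (hu.differentiableAt (by simp)) (hv.differentiableAt (by simp)), mul_add,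
    Finset.sum_add_distrib]
  ring

lemma hess_smul (G : Comp2) {u : Comp0} {x : E2} (hu : ContDiffAt ℝ 2 u x) (c : ℝ)
    (a b : Fin 2) : hess G (c • u) a b x = c * hess G u a b x := by
  have e1 : ∀ i, pd i (c • u) =ᶠ[𝓝 x] c • pd i u := fun i => by
    filter_upwards [eventually_differentiableAt hu] with y h1
    exact pd_smul h1 c i
  simp only [hess, nabla1, grad, pd_congr (e1 b) a,
    pd_smul (differentiableAt_pd hu b) c a,
    pd_smul (hu.differentiableAt (by simp)) c, mul_sub, Finset.mul_sum]
  congr 1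
  refine Finset.sum_congr rfl fun i _ => by ring

lemma confEinstein_add (G P : Comp2) {u v : Comp0} {x : E2} (hu : ContDiffAt ℝ 2 u x)
    (hv : ContDiffAt ℝ 2 v x) (a b : Fin 2) :
    confEinstein G P (u + v) a b x = confEinstein G P u a b x + confEinstein G P v a b x := by
  simp only [confEinstein, traceFree, trace, hess_add G hu hv, Pi.add_apply, mul_add,
    Finset.sum_add_distrib]
  ring

lemma confEinstein_smul (G P : Comp2) {u : Comp0} {x : E2} (hu : ContDiffAt ℝ 2 u x) (c : ℝ)
    (a b : Fin 2) : confEinstein G P (c • u) a b x = c * confEinstein G P u a b x := by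
  have h : ∀ i j, hess G (c • u) i j x + P i j x * (c • u) x
      = c * (hess G u i j x + P i j x * u x) := fun i j => by
    rw [hess_smul G hu]
    simp only [Pi.smul_apply, smul_eq_mul]
    ring
  simp only [confEinstein, traceFree, trace, h, mul_sub, Finset.mul_sum, Finset.sum_mul]
  congr 1
  exact Finset.sum_congr rfl fun i _ => Finset.sum_congr rfl fun j _ => by ring

/-! ### Möbius surfaces -/

section Surface

variable (M : Type*) [TopologicalSpace M] [ChartedSpace E2 M] [IsManifold (𝓡 2) ∞ M]

/-- Smooth Riemannian metrics on `M`. -/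
abbrev Metric : Type _ :=
  Bundle.ContMDiffRiemannianMetric (𝓡 2) ∞ E2 (fun p : M => TangentSpace (𝓡 2) p)

/-- Smooth symmetric covariant `2`-tensor fields on `M`. -/
structure SymTensor where
  /-- The bilinear form on each tangent space. -/
  form (p : M) : TangentSpace (𝓡 2) p →L[ℝ] TangentSpace (𝓡 2) p →L[ℝ] ℝ
  symm (p : M) (v w : TangentSpace (𝓡 2) p) : form p v w = form p w v
  contMDiff : ContMDiff (𝓡 2) ((𝓡 2).prod 𝓘(ℝ, E2 →L[ℝ] E2 →L[ℝ] ℝ)) ∞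
    (fun p : M => Bundle.TotalSpace.mk' (E2 →L[ℝ] E2 →L[ℝ] ℝ)
      (E := fun p : M => TangentSpace (𝓡 2) p →L[ℝ] TangentSpace (𝓡 2) p →L[ℝ] ℝ) p (form p))

variable {M}

/-- The components, in the chart `e`, of a field of bilinear forms. -/
def comps (T : ∀ p : M, TangentSpace (𝓡 2) p →L[ℝ] TangentSpace (𝓡 2) p →L[ℝ] ℝ)
    (e : OpenPartialHomeomorph M E2) : Comp2 := fun i j x =>
  T (e.symm x) (mfderiv 𝓘(ℝ, E2) (𝓡 2) e.symm x (basisVec i))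
    (mfderiv 𝓘(ℝ, E2) (𝓡 2) e.symm x (basisVec j))

/-- `h = Ω² g` with `Ω` smooth and positive. -/
def IsRescaling (Ω : C^∞⟮𝓡 2, M; ℝ⟯) (g h : Metric M) : Prop :=
  (∀ p, 0 < Ω p) ∧ ∀ (p : M) (v w : TangentSpace (𝓡 2) p), h.inner p v w = Ω p ^ 2 * g.inner p v w

variable (M)

/-- A Möbius surface: a conformal class of Riemannian metrics together with a Rho tensor for each
metric of the class, whose trace is the Gauss curvature and which transforms by
`P̂_{ab} = P_{ab} - ∇_a Υ_b + Υ_a Υ_b - ½ g_{ab} Υ_c Υ^c`, `Υ = d log Ω`, under `ĝ = Ω² g`. -/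
structure MoebiusSurface where
  /-- The conformal class `[g]`. -/
  metrics : Set (Metric M)
  nonempty : metrics.Nonempty
  mem_iff : ∀ g ∈ metrics, ∀ h : Metric M,
    h ∈ metrics ↔ ∃ Ω : C^∞⟮𝓡 2, M; ℝ⟯, IsRescaling Ω g h
  /-- The Rho tensor of each representative metric. -/
  rho : metrics → SymTensor M
  trace_rho : ∀ (g : metrics), ∀ e ∈ atlas E2 M, ∀ x ∈ e.target,
    trace (comps g.1.inner e) (comps (rho g).form e) x = gaussCurv (comps g.1.inner e) x
  rho_rescaling : ∀ (g h : metrics) (Ω : C^∞⟮𝓡 2, M; ℝ⟯), IsRescaling Ω g.1 h.1 →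
    ∀ e ∈ atlas E2 M, ∀ x ∈ e.target, ∀ a b : Fin 2,
      let G := comps g.1.inner e
      let Υ : Comp1 := grad fun y => Real.log (Ω (e.symm y))
      comps (rho h).form e a b x = comps (rho g).form e a b x
        - nabla1 G Υ a b x + Υ a x * Υ b x - (1 / 2) * G a b x * pair G Υ Υ x

variable {M}

namespace MoebiusSurface

variable (S : MoebiusSurface M)

/-- Coordinate components of the representative metric `g`. -/
def G (g : S.metrics) (e : OpenPartialHomeomorph M E2) : Comp2 := comps g.1.inner e

/-- Coordinate components of the Rho tensor of the representative metric `g`. -/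
def P (g : S.metrics) (e : OpenPartialHomeomorph M E2) : Comp2 := comps (S.rho g).form e

/-- `C` holds at every point of the surface, in every chart and for every representative metric,
where `C G P x` is a condition on the components of the metric and of its Rho tensor. -/
def Everywhere (C : Comp2 → Comp2 → E2 → Prop) : Prop :=
  ∀ g : S.metrics, ∀ e ∈ atlas E2 M, ∀ x ∈ e.target, C (S.G g e) (S.P g e) x

/-- The surface is flat: `Y_a = 0`. -/
def IsFlat : Prop := S.Everywhere fun G P x => ∀ a, Yform G P a x = 0

/-- The surface is nowhere flat: `Y_a ≠ 0` at every point. -/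
def IsNonFlat : Prop := S.Everywhere fun G P x => ∃ a, Yform G P a x ≠ 0

/-- `U_a V^a ≠ 0` at every point. -/
def IsGeneric : Prop := S.Everywhere fun G P x => UV G P x ≠ 0

/-- `U_a V^a = 0` at every point. -/
def IsNonGeneric : Prop := S.Everywhere fun G P x => UV G P x = 0

/-- The obstruction tensor `E_{ab}` of generic surfaces vanishes. -/
def ObstructionVanishes : Prop := S.Everywhere fun G P x => ∀ a b, Etensor G P a b x = 0

/-- The obstruction `k + f μ` of non-flat non-generic surfaces vanishes. -/
def ScalarObstructionVanishes : Prop := S.Everywhere fun G P x =>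
  kScalar G P x + fScalar G P x * muScalar G P x = 0

/-- `Y^a ∇_a ((2 f / 3) ρ^{-2/3}) = 0`. -/
def OdeCondition1 : Prop := S.Everywhere fun G P x =>
  dirDeriv G (Yform G P) (odeCoeff1 G P) x = 0

/-- `Y^a ∇_a ((R̃ - Q̃) ρ^{-4/3}) = 0`. -/
def OdeCondition2 : Prop := S.Everywhere fun G P x =>
  dirDeriv G (Yform G P) (odeCoeff0 G P) x = 0

/-- Smooth densities of conformal weight `1`: a smooth function `σ_g` for every `g` in the conformal
class, with `σ_{Ω² g} = Ω σ_g`. -/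
def densities : Submodule ℝ (S.metrics → C^∞⟮𝓡 2, M; ℝ⟯) where
  carrier := {σ | ∀ (g h : S.metrics) (Ω : C^∞⟮𝓡 2, M; ℝ⟯), IsRescaling Ω g.1 h.1 →
    ∀ p, σ h p = Ω p * σ g p}
  zero_mem' := by
    intro g h Ω _ p
    simp
  add_mem' := by
    intro σ τ hσ hτ g h Ω hΩ p
    simp [hσ g h Ω hΩ p, hτ g h Ω hΩ p, mul_add]
  smul_mem' := by
    intro c σ hσ g h Ω hΩ p
    simp [hσ g h Ω hΩ p, mul_left_comm]

/-- The expression of a function on the surface in a chart. -/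
def inChart (u : C^∞⟮𝓡 2, M; ℝ⟯) (e : OpenPartialHomeomorph M E2) : Comp0 := fun y => u (e.symm y)

lemma contDiffAt_inChart (u : C^∞⟮𝓡 2, M; ℝ⟯) {e : OpenPartialHomeomorph M E2}
    (he : e ∈ atlas E2 M) {x : E2} (hx : x ∈ e.target) : ContDiffAt ℝ 2 (inChart u e) x := by
  have h1 : ContMDiffAt (𝓡 2) (𝓡 2) ∞ e.symm x :=
    contMDiffAt_symm_of_mem_maximalAtlas (IsManifold.subset_maximalAtlas he) hx
  have h2 : ContMDiffAt (𝓡 2) 𝓘(ℝ, ℝ) ∞ (fun y => u (e.symm y)) x :=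
    ContMDiffAt.comp x (u.contMDiff (e.symm x)) h1
  exact (contMDiffAt_iff_contDiffAt.1 h2).of_le (WithTop.coe_le_coe.2 le_top)

/-- The conformal-to-Einstein operator `D_{ab}` on densities of weight `1`: for each representative
metric and each chart, the components of the trace-free part of `(∇_a ∇_b + P_{ab}) σ`. -/
def operator : S.densities →ₗ[ℝ]
    ((_ : S.metrics) → (e : atlas E2 M) → e.1.target → Matrix (Fin 2) (Fin 2) ℝ) where
  toFun σ g e x := Matrix.of fun a b =>
    confEinstein (S.G g e.1) (S.P g e.1) (inChart (σ.1 g) e.1) a b x.1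
  map_add' := by
    intro σ τ
    funext g e x
    ext a b
    exact confEinstein_add _ _ (contDiffAt_inChart (σ.1 g) e.2 x.2)
      (contDiffAt_inChart (τ.1 g) e.2 x.2) a b
  map_smul' := by
    intro c σ
    funext g e x
    ext a b
    exact confEinstein_smul _ _ (contDiffAt_inChart (σ.1 g) e.2 x.2) c a b

end MoebiusSurface


end Surface

end Moebius

end

/-! A density of weight one is determined by its value in one fixed scale $g$, so the kernel is the
space of functions $\sigma$ on $M$ solving a second order overdetermined equation (`kernelEquiv`).
Writing $\psi$ for the unknown trace, the equation prolongs to a closed linear system for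
$(\sigma,\nabla_a\sigma,\psi)$: $\nabla_a\nabla_b\sigma=-\mathrm P_{ab}\sigma+g_{ab}\psi$ and
$\nabla_a\psi=\tfrac12U_a\sigma-\mathrm P_a{}^b\nabla_b\sigma$ (`tractor`, `solvesAt_jet`). Its
curvature has a single nonzero row, with entries proportional to $\mu$ and $Y^a$.

If $Y=0$ the rank four system is flat. Otherwise the curvature gives the constraint
$Y^a\nabla_a\sigma+\mu\sigma=0$ (`constraint`). Differentiating it along $U$ and using that $U\perp
Y$ gives $V^a\nabla_a\sigma=k\sigma$ (`pair_V_grad`).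

If $U_aV^a\ne0$, then $Y$ and $V$ are independent and these two conditions say
$\nabla_a\sigma=K_a\sigma$. Substituting back, the equation becomes $E_{ab}\sigma=0$
(`confEinstein_eq_E_mul`); the antisymmetric part of $E=0$ says that $K$ is closed, so the rank one
system is flat.

If $U_aV^a=0$, then $V=fY$ and the two conditions together give $(k+f\mu)\sigma=0$. When $k+f\mu=0$,
the substitution $\sigma=\rho^{-1/6}\xi$ turns the constraint into $Y^a\nabla_a\xi=0$. The form
$\rho^{-1/3}U_a$ is closed, locally $d\eta$, and what remains of the equation is a second order
linear ODE in $\eta$. Written as a rank two system (`odeSystem`), it is flat because its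
coefficients are constant along $Y$ (`odeSystem_flat`).

Two general facts complete the count. By Frobenius' theorem a flat system of rank $d$ has local
bases of $d$ solutions (`exists_basis_solvesAt`); their coefficient vectors form a covering space,
which is trivial over a simply connected surface, so the global dimension is $d$
(`finrank_solutions`). When an obstruction is nonzero at a point, $\sigma$ vanishes near that point,
hence everywhere by unique continuation for the prolonged system (`eq_zero_of_eventually_eq_zero`).
-/

open scoped Manifold ContDiff Topology

noncomputable section

namespace Moebius

set_option linter.unusedSectionVars false

/-! ### The Picard operator along rays and its derivative. -/

section Frobenius

open MeasureTheory Set Filter Metric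

variable {E : Type*} [NormedAddCommGroup E] [NormedSpace ℝ E] [FiniteDimensional ℝ E]
  {B : Type*} [NormedRing B] [NormedAlgebra ℝ B] [CompleteSpace B]


/-- Differentiation under the integral sign for `C¹` integrands. -/
lemma hasFDerivAt_integral_of_contDiff {F : E → ℝ → B}
    (hF : ContDiff ℝ 1 (Function.uncurry F)) (x : E) :
    HasFDerivAt (fun y => ∫ t in (0 : ℝ)..1, F y t)
      (∫ t in (0 : ℝ)..1, fderiv ℝ (fun y => F y t) x) x := by
  have hc : Continuous (fun p : E × ℝ => fderiv ℝ (fun y => F y p.2) p.1) := by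
    have : ContDiff ℝ 0 (fun p : E × ℝ => fderiv ℝ (fun y => F y p.2) p.1) :=
      ContDiff.fderiv (f := fun (p : E × ℝ) y => F y p.2) (g := fun p => p.1) (m := 1)
        (hF.comp (contDiff_snd.prodMk (contDiff_snd.comp contDiff_fst))) contDiff_fst (by simp)
    exact this.continuous
  obtain ⟨C, hC⟩ := ((isCompact_closedBall x 1).prod (isCompact_Icc (a := (0 : ℝ)) (b := 1)))
    |>.exists_bound_of_continuousOn hc.continuousOn
  have hFx : ∀ y, Continuous (F y) := fun y => hF.continuous.comp (Continuous.prodMk_right y)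
  refine intervalIntegral.hasFDerivAt_integral_of_dominated_of_fderiv_le (bound := fun _ => C)
    (closedBall_mem_nhds x one_pos) (Eventually.of_forall fun y => (hFx y).aestronglyMeasurable)
    ((hFx x).intervalIntegrable _ _)
    (F' := fun y t => fderiv ℝ (fun y => F y t) y)
    (Continuous.aestronglyMeasurable (hc.comp (Continuous.prodMk_right x)))
    (Eventually.of_forall fun t ht y hy => ?_) intervalIntegrable_const
    (Eventually.of_forall fun t ht y hy => ?_)
  · rw [uIoc_of_le zero_le_one] at ht
    exact hC (y, t) ⟨hy, ht.1.le, ht.2⟩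
  · have : ContDiff ℝ 1 (fun y => F y t) := hF.comp (contDiff_prodMk_left t)
    exact (this.differentiable (by simp) y).hasFDerivAt

lemma contDiff_integral_of_contDiff {F : E → ℝ → B}
    (hF : ContDiff ℝ 1 (Function.uncurry F)) :
    ContDiff ℝ 1 (fun y => ∫ t in (0 : ℝ)..1, F y t) := by
  have hc : Continuous (fun p : E × ℝ => fderiv ℝ (fun y => F y p.2) p.1) := by
    have : ContDiff ℝ 0 (fun p : E × ℝ => fderiv ℝ (fun y => F y p.2) p.1) :=
      ContDiff.fderiv (f := fun (p : E × ℝ) y => F y p.2) (g := fun p => p.1) (m := 1)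
        (hF.comp (contDiff_snd.prodMk (contDiff_snd.comp contDiff_fst))) contDiff_fst (by simp)
    exact this.continuous
  rw [contDiff_one_iff_fderiv]
  refine ⟨fun x => (hasFDerivAt_integral_of_contDiff hF x).differentiableAt, ?_⟩
  have h : fderiv ℝ (fun y => ∫ t in (0 : ℝ)..1, F y t)
      = fun x => ∫ t in (0 : ℝ)..1, fderiv ℝ (fun y => F y t) x :=
    funext fun x => (hasFDerivAt_integral_of_contDiff hF x).fderiv
  rw [h]
  exact intervalIntegral.continuous_parametric_intervalIntegral_of_continuous'
    (f := fun x t => fderiv ℝ (fun y => F y t) x) hc 0 1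

/-- The Picard operator along rays from the origin for the system `dΦ = A Φ`. -/
def picard (A : E → E →L[ℝ] B) (Φ : E → B) : E → B := fun x =>
  1 + ∫ t in (0 : ℝ)..1, A (t • x) x * Φ (t • x)

variable {A : E → E →L[ℝ] B} {Φ : E → B}

lemma contDiff_picard_integrand (hA : ContDiff ℝ 1 A) (hΦ : ContDiff ℝ 1 Φ) :
    ContDiff ℝ 1 (Function.uncurry fun (x : E) (t : ℝ) => A (t • x) x * Φ (t • x)) := by
  have h1 : ContDiff ℝ 1 (fun p : E × ℝ => p.2 • p.1) := contDiff_snd.smul contDiff_fst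
  exact ((hA.comp h1).clm_apply contDiff_fst).mul (hΦ.comp h1)

lemma contDiff_picard (hA : ContDiff ℝ 1 A) (hΦ : ContDiff ℝ 1 Φ) :
    ContDiff ℝ 1 (picard A Φ) :=
  contDiff_const.add (contDiff_integral_of_contDiff (contDiff_picard_integrand hA hΦ))

/-- This and `apply_mul_eq_integral` write $d(\mathrm{picard}\,\Phi)(v)$ and $A(v)\Phi$ as integrals
over the same ray. Their difference then involves only the antisymmetrised derivative of $A$, to
which flatness applies. -/
lemma fderiv_picard (hA : ContDiff ℝ 1 A) (hΦ : ContDiff ℝ 1 Φ) (x v : E) :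
    fderiv ℝ (picard A Φ) x v = ∫ t in (0 : ℝ)..1,
      (t • (fderiv ℝ A (t • x) v x * Φ (t • x)) + A (t • x) v * Φ (t • x)
        + t • (A (t • x) x * fderiv ℝ Φ (t • x) v)) := by
  have hF := contDiff_picard_integrand hA hΦ
  have h := (hasFDerivAt_integral_of_contDiff hF x).const_add 1
  have hc : Continuous (fun p : E × ℝ =>
      fderiv ℝ (fun y => A (p.2 • y) y * Φ (p.2 • y)) p.1) := by
    have : ContDiff ℝ 0 (fun p : E × ℝ =>
        fderiv ℝ (fun y => A (p.2 • y) y * Φ (p.2 • y)) p.1) :=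
      ContDiff.fderiv (f := fun (p : E × ℝ) y => A (p.2 • y) y * Φ (p.2 • y))
        (g := fun p => p.1) (m := 1)
        (hF.comp (contDiff_snd.prodMk (contDiff_snd.comp contDiff_fst))) contDiff_fst (by simp)
    exact this.continuous
  have h2 : fderiv ℝ (picard A Φ) x = ∫ t in (0 : ℝ)..1,
      fderiv ℝ (fun y => A (t • y) y * Φ (t • y)) x := h.fderiv
  rw [h2, ContinuousLinearMap.intervalIntegral_apply]
  · refine intervalIntegral.integral_congr fun t _ => ?_
    have hs : HasFDerivAt (fun y : E => t • y) (t • ContinuousLinearMap.id ℝ E) x :=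
      (hasFDerivAt_id x).const_smul t
    have dA : HasFDerivAt (fun y => A (t • y))
        ((fderiv ℝ A (t • x)).comp (t • ContinuousLinearMap.id ℝ E)) x :=
      ((hA.differentiable (by simp) (t • x)).hasFDerivAt).comp x hs
    have dΦ : HasFDerivAt (fun y => Φ (t • y))
        ((fderiv ℝ Φ (t • x)).comp (t • ContinuousLinearMap.id ℝ E)) x :=
      ((hΦ.differentiable (by simp) (t • x)).hasFDerivAt).comp x hs
    have h3 : HasFDerivAt (fun y => A (t • y) y * Φ (t • y)) _ x :=
      (dA.clm_apply (hasFDerivAt_id x)).mul' dΦ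
    rw [h3.fderiv]
    simp
    abel
  · exact (hc.comp (Continuous.prodMk_right x)).intervalIntegrable _ _

/-- The fundamental theorem of calculus along a ray, applied to `t A(tx)(v) Φ(tx)`. -/
lemma apply_mul_eq_integral (hA : ContDiff ℝ 1 A) (hΦ : ContDiff ℝ 1 Φ) (x v : E) :
    A x v * Φ x = ∫ t in (0 : ℝ)..1,
      (t • (fderiv ℝ A (t • x) x v * Φ (t • x)) + A (t • x) v * Φ (t • x)
        + t • (A (t • x) v * fderiv ℝ Φ (t • x) x)) := by
  have key : ∀ t ∈ uIcc (0 : ℝ) 1, HasDerivAt (fun t : ℝ => t • (A (t • x) v * Φ (t • x)))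
      (t • (fderiv ℝ A (t • x) x v * Φ (t • x)) + A (t • x) v * Φ (t • x)
        + t • (A (t • x) v * fderiv ℝ Φ (t • x) x)) t := by
    intro t _
    have hs : HasDerivAt (fun s : ℝ => s • x) x t := by
      simpa using (hasDerivAt_id t).smul_const x
    have dA : HasDerivAt (fun s : ℝ => A (s • x)) (fderiv ℝ A (t • x) x) t :=
      ((hA.differentiable (by simp) (t • x)).hasFDerivAt).comp_hasDerivAt t hs
    have dΦ : HasDerivAt (fun s : ℝ => Φ (s • x)) (fderiv ℝ Φ (t • x) x) t :=
      ((hΦ.differentiable (by simp) (t • x)).hasFDerivAt).comp_hasDerivAt t hs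
    have dAv : HasDerivAt (fun s : ℝ => A (s • x) v) (fderiv ℝ A (t • x) x v) t := by
      simpa using dA.clm_apply (hasDerivAt_const t v)
    have h : HasDerivAt (fun t : ℝ => t • (A (t • x) v * Φ (t • x))) _ t :=
      (hasDerivAt_id t).smul (dAv.mul dΦ)
    convert h using 1
    simp [smul_add]
    abel
  have hcA : Continuous A := hA.continuous
  have hcΦ : Continuous Φ := hΦ.continuous
  have hdA : Continuous (fderiv ℝ A) := hA.continuous_fderiv (by simp)
  have hdΦ : Continuous (fderiv ℝ Φ) := hΦ.continuous_fderiv (by simp)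
  rw [intervalIntegral.integral_eq_sub_of_hasDerivAt key
    (Continuous.intervalIntegrable (by fun_prop) _ _)]
  simp

end Frobenius

/-! ### Convergence of the Picard iterates for a flat connection. -/

section Frobenius

open MeasureTheory Set Filter Metric

variable {E : Type*} [NormedAddCommGroup E] [NormedSpace ℝ E] [FiniteDimensional ℝ E]
  {B : Type*} [NormedRing B] [NormedAlgebra ℝ B] [CompleteSpace B]
  {A : E → E →L[ℝ] B} {Φ : E → B}

/-- The Picard iterates for `dΦ = A Φ`, `Φ(0) = 1`. -/
def picardIter (A : E → E →L[ℝ] B) (n : ℕ) : E → B := (picard A)^[n] fun _ => 1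

lemma picardIter_succ (A : E → E →L[ℝ] B) (n : ℕ) :
    picardIter A (n + 1) = picard A (picardIter A n) :=
  Function.iterate_succ_apply' _ _ _

lemma contDiff_picardIter (hA : ContDiff ℝ 1 A) (n : ℕ) : ContDiff ℝ 1 (picardIter A n) := by
  induction n with
  | zero => exact contDiff_const
  | succ n ih => rw [picardIter_succ]; exact contDiff_picard hA ih

lemma smul_mem_ball_of_mem_uIoc {r : ℝ} {x : E} (hx : x ∈ ball (0 : E) r) {t : ℝ}
    (ht : t ∈ uIoc (0 : ℝ) 1) : t • x ∈ ball (0 : E) r := by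
  rw [uIoc_of_le zero_le_one] at ht
  rw [mem_ball_zero_iff] at hx ⊢
  rw [norm_smul, Real.norm_eq_abs, abs_of_pos ht.1]
  nlinarith [norm_nonneg x, ht.2]

variable {C r : ℝ} (hA : ContDiff ℝ 1 A) (hC : ∀ x ∈ ball (0 : E) r, ‖A x‖ ≤ C)
  (hCr : 8 * (C * r) ≤ 1) (hC0 : 0 ≤ C) (hr : 0 < r)
  (hflat : ∀ x ∈ ball (0 : E) r, ∀ v w, fderiv ℝ A x v w + A x w * A x v
    = fderiv ℝ A x w v + A x v * A x w)

include hA hC hCr hC0 hr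

/-- On the ball $\|A(tx)x\|\le Cr$, which `hCr` makes less than $1/4$, so each Picard step contracts
differences by that factor. The ball is star-shaped about the origin, so the induction stays inside
it. -/
lemma norm_picardIter_sub_le (n : ℕ) {x : E} (hx : x ∈ ball (0 : E) r) :
    ‖picardIter A (n + 1) x - picardIter A n x‖ ≤ ‖(1 : B)‖ * (1 / 4) ^ n := by
  have key : ∀ y ∈ ball (0 : E) r, ∀ x ∈ ball (0 : E) r, ∀ (b : B) K, ‖b‖ ≤ K →
      ‖A y x * b‖ ≤ 1 / 4 * K := by
    intro y hy x hx b K hb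
    have h1 : ‖A y x‖ ≤ C * r := (A y).le_of_opNorm_le (hC y hy) x |>.trans
      (mul_le_mul_of_nonneg_left (mem_ball_zero_iff.1 hx).le hC0)
    have hK : 0 ≤ K := (norm_nonneg _).trans hb
    calc ‖A y x * b‖ ≤ ‖A y x‖ * ‖b‖ := norm_mul_le _ _
      _ ≤ (C * r) * K := by gcongr
      _ ≤ 1 / 4 * K := by gcongr; linarith
  have hcont : ∀ m (x : E), Continuous fun t : ℝ => A (t • x) x * picardIter A m (t • x) :=
    fun m x => by
      have := hA.continuous
      have := (contDiff_picardIter hA m).continuous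
      fun_prop
  have hsucc : ∀ m x, picardIter A (m + 1) x
      = 1 + ∫ t in (0 : ℝ)..1, A (t • x) x * picardIter A m (t • x) := fun m x => by
    rw [picardIter_succ]; rfl
  induction n generalizing x with
  | zero =>
    have : picardIter A (0 + 1) x - picardIter A 0 x = ∫ t in (0 : ℝ)..1, A (t • x) x * 1 := by
      rw [hsucc]
      simp [picardIter]
    rw [this]
    refine (intervalIntegral.norm_integral_le_of_norm_le_const (C := 1 / 4 * ‖(1 : B)‖)
      fun t ht => key _ (smul_mem_ball_of_mem_uIoc hx ht) _ hx _ _ le_rfl).trans ?_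
    simp only [sub_zero, abs_one, mul_one, pow_zero]
    linarith [norm_nonneg (1 : B)]
  | succ n ih =>
    have : picardIter A (n + 1 + 1) x - picardIter A (n + 1) x = ∫ t in (0 : ℝ)..1,
        A (t • x) x * (picardIter A (n + 1) (t • x) - picardIter A n (t • x)) := by
      rw [hsucc (n + 1), hsucc n, add_sub_add_left_eq_sub,
        ← intervalIntegral.integral_sub ((hcont _ _).intervalIntegrable _ _)
          ((hcont _ _).intervalIntegrable _ _)]
      simp only [mul_sub]
    rw [this]
    refine (intervalIntegral.norm_integral_le_of_norm_le_const
      (C := 1 / 4 * (‖(1 : B)‖ * (1 / 4) ^ n)) fun t ht => ?_).trans (by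
        simp only [sub_zero, abs_one, mul_one, pow_succ]; apply le_of_eq; ring)
    have hm := smul_mem_ball_of_mem_uIoc hx ht
    exact key _ hm _ hx _ _ (ih hm)

include hflat

/-- For a flat connection the Picard iterates are asymptotically parallel. -/
lemma norm_fderiv_picardIter_sub_le (n : ℕ) {x : E} (hx : x ∈ ball (0 : E) r) (v : E) :
    ‖fderiv ℝ (picardIter A n) x v - A x v * picardIter A n x‖
      ≤ 4 * C * ‖(1 : B)‖ * (1 / 2) ^ n * ‖v‖ := by
  induction n generalizing x v with
  | zero =>
    have h : fderiv ℝ (picardIter A 0) x = 0 := by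
      simp [picardIter]
    have h1 : ‖A x v‖ ≤ C * ‖v‖ := (A x).le_of_opNorm_le (hC x hx) v
    rw [h]
    simp only [picardIter, Function.iterate_zero, id, zero_apply, zero_sub,
      norm_neg]
    calc ‖A x v * 1‖ ≤ ‖A x v‖ * ‖(1 : B)‖ := norm_mul_le _ _
      _ ≤ C * ‖v‖ * ‖(1 : B)‖ := by gcongr
      _ ≤ _ := by
        have : 0 ≤ C * ‖v‖ * ‖(1 : B)‖ := by positivity
        simp only [pow_zero]
        linarith
  | succ n ih =>
    have hΦ := contDiff_picardIter hA n
    set Φ := picardIter A n with hΦdef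
    have hcA : Continuous A := hA.continuous
    have hcΦ : Continuous Φ := hΦ.continuous
    have hdA : Continuous (fderiv ℝ A) := hA.continuous_fderiv (by simp)
    have hdΦ : Continuous (fderiv ℝ Φ) := hΦ.continuous_fderiv (by simp)
    have hsub := norm_picardIter_sub_le hA hC hCr hC0 hr n hx
    rw [picardIter_succ] at hsub ⊢
    -- Flatness replaces $dA(v)x-dA(x)v$ by the commutator $A(v)A(x)-A(x)A(v)$. The defect of the
    -- next iterate is thereby an integral of the defect $d\Phi-A\Phi$ of the current one.
    have e : fderiv ℝ (picard A Φ) x v - A x v * Φ x = ∫ t in (0 : ℝ)..1,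
        t • (A (t • x) x * (fderiv ℝ Φ (t • x) v - A (t • x) v * Φ (t • x))
          - A (t • x) v * (fderiv ℝ Φ (t • x) x - A (t • x) x * Φ (t • x))) := by
      rw [fderiv_picard hA hΦ, apply_mul_eq_integral hA hΦ x v,
        ← intervalIntegral.integral_sub (Continuous.intervalIntegrable (by fun_prop) _ _)
          (Continuous.intervalIntegrable (by fun_prop) _ _)]
      refine intervalIntegral.integral_congr_ae (Eventually.of_forall fun t ht => ?_)
      have hf := hflat _ (smul_mem_ball_of_mem_uIoc hx ht) v x
      have hf' : fderiv ℝ A (t • x) v x = fderiv ℝ A (t • x) x v + A (t • x) v * A (t • x) x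
          - A (t • x) x * A (t • x) v := by rw [← hf]; abel
      simp only [hf', smul_sub, mul_sub, sub_mul, add_mul, smul_add, mul_assoc]
      abel
    -- Each of the two terms is at most $Cr$ times the inductive bound, and $8Cr\le1$ absorbs their
    -- total. Replacing $\Phi$ by its Picard image in $A(v)\Phi$ costs the same amount again, and
    -- $2C\,2^{-n}=4C\,2^{-(n+1)}$ closes the induction.
    have hint : ‖fderiv ℝ (picard A Φ) x v - A x v * Φ x‖
        ≤ C * ‖(1 : B)‖ * (1 / 2) ^ n * ‖v‖ := by
      rw [e]
      refine (intervalIntegral.norm_integral_le_of_norm_le_const fun t ht => ?_).trans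
        (by simp only [sub_zero, abs_one, mul_one]; exact le_rfl)
      have hm := smul_mem_ball_of_mem_uIoc hx ht
      rw [uIoc_of_le zero_le_one] at ht
      have hx' := (mem_ball_zero_iff.1 hx).le
      have h1 : ‖A (t • x) x‖ ≤ C * r := ((A (t • x)).le_of_opNorm_le (hC _ hm) x).trans
        (mul_le_mul_of_nonneg_left hx' hC0)
      have h2 : ‖A (t • x) v‖ ≤ C * ‖v‖ := (A (t • x)).le_of_opNorm_le (hC _ hm) v
      have h3 := ih hm v
      have h4 : ‖fderiv ℝ Φ (t • x) x - A (t • x) x * Φ (t • x)‖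
          ≤ 4 * C * ‖(1 : B)‖ * (1 / 2) ^ n * r :=
        (ih hm x).trans (by gcongr)
      rw [norm_smul, Real.norm_eq_abs, abs_of_pos ht.1]
      calc _ ≤ 1 * (C * r * (4 * C * ‖(1 : B)‖ * (1 / 2) ^ n * ‖v‖)
              + C * ‖v‖ * (4 * C * ‖(1 : B)‖ * (1 / 2) ^ n * r)) := by
            gcongr
            · exact ht.2
            · refine (norm_sub_le _ _).trans ?_
              gcongr
              · exact (norm_mul_le _ _).trans (by gcongr)
              · exact (norm_mul_le _ _).trans (by gcongr)
        _ = (8 * (C * r)) * (C * ‖(1 : B)‖ * (1 / 2) ^ n * ‖v‖) := by ring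
        _ ≤ 1 * (C * ‖(1 : B)‖ * (1 / 2) ^ n * ‖v‖) := by gcongr
        _ = _ := one_mul _
    have h2 : ‖A x v‖ ≤ C * ‖v‖ := (A x).le_of_opNorm_le (hC _ hx) v
    have e2 : fderiv ℝ (picard A Φ) x v - A x v * picard A Φ x
        = (fderiv ℝ (picard A Φ) x v - A x v * Φ x) - A x v * (picard A Φ x - Φ x) := by
      rw [mul_sub]; abel
    have hp : ((1 : ℝ) / 4) ^ n ≤ (1 / 2) ^ n := by gcongr; norm_num
    rw [e2]
    calc _ ≤ C * ‖(1 : B)‖ * (1 / 2) ^ n * ‖v‖ + C * ‖v‖ * (‖(1 : B)‖ * (1 / 2) ^ n) := by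
          refine (norm_sub_le _ _).trans ?_
          gcongr
          exact (norm_mul_le _ _).trans (by gcongr; exact hsub.trans (by gcongr))
      _ = _ := by rw [pow_succ]; ring

/-- Local solvability of a flat linear system, normalised at the origin. -/
lemma exists_hasFDerivAt_of_flat_ball : ∃ Φ : E → B, Φ 0 = 1 ∧ ∀ x ∈ ball (0 : E) r,
    HasFDerivAt Φ (((ContinuousLinearMap.mul ℝ B).flip (Φ x)).comp (A x)) x := by
  have hlim : ∀ x ∈ ball (0 : E) r, ∃ y, Tendsto (fun n => picardIter A n x) atTop (𝓝 y) :=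
    fun x hx => cauchySeq_tendsto_of_complete <|
      cauchySeq_of_le_geometric (1 / 4) ‖(1 : B)‖ (by norm_num) fun n => by
        rw [dist_comm, dist_eq_norm]
        exact norm_picardIter_sub_le hA hC hCr hC0 hr n hx
  choose! Φ hΦ using hlim
  have hdist : ∀ n, ∀ x ∈ ball (0 : E) r,
      ‖picardIter A n x - Φ x‖ ≤ ‖(1 : B)‖ * (1 / 4) ^ n / (1 - 1 / 4) := fun n x hx => by
    rw [← dist_eq_norm]
    exact dist_le_of_le_geometric_of_tendsto (1 / 4) ‖(1 : B)‖ (by norm_num) (fun n => by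
        rw [dist_comm, dist_eq_norm]
        exact norm_picardIter_sub_le hA hC hCr hC0 hr n hx) (hΦ x hx) n
  refine ⟨Φ, ?_, fun x hx => ?_⟩
  · refine tendsto_nhds_unique (hΦ 0 (mem_ball_self hr)) ?_
    refine tendsto_const_nhds.congr fun n => ?_
    cases n with
    | zero => rfl
    | succ n => simp [picardIter_succ, picard]
  -- The derivatives converge uniformly to $A\Phi$: the error is the defect of the iterate plus $A$
  -- applied to its distance from the limit. Hence the limit is differentiable with derivative
  -- $A\Phi$.
  · have hbound : ∀ n, ∀ x ∈ ball (0 : E) r, ‖((ContinuousLinearMap.mul ℝ B).flip (Φ x)).comp (A x)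
        - fderiv ℝ (picardIter A n) x‖
        ≤ 4 * C * ‖(1 : B)‖ * (1 / 2) ^ n + C * (‖(1 : B)‖ * (1 / 4) ^ n / (1 - 1 / 4)) := by
      intro n x hx
      have hp : 0 ≤ ‖(1 : B)‖ * (1 / 4) ^ n / (1 - 1 / 4) := (norm_nonneg _).trans (hdist n x hx)
      refine ContinuousLinearMap.opNorm_le_bound _ (by positivity) fun v => ?_
      have h1 := norm_fderiv_picardIter_sub_le hA hC hCr hC0 hr hflat n hx v
      have h2 : ‖A x v‖ ≤ C * ‖v‖ := (A x).le_of_opNorm_le (hC _ hx) v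
      have e : (((ContinuousLinearMap.mul ℝ B).flip (Φ x)).comp (A x)
          - fderiv ℝ (picardIter A n) x) v
          = -(fderiv ℝ (picardIter A n) x v - A x v * picardIter A n x)
            - A x v * (picardIter A n x - Φ x) := by
        simp [mul_sub]
      rw [e]
      calc _ ≤ 4 * C * ‖(1 : B)‖ * (1 / 2) ^ n * ‖v‖
            + C * ‖v‖ * (‖(1 : B)‖ * (1 / 4) ^ n / (1 - 1 / 4)) := by
            refine (norm_sub_le _ _).trans ?_
            rw [norm_neg]
            gcongr
            exact (norm_mul_le _ _).trans (by gcongr; exact hdist n x hx)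
        _ = _ := by ring
    refine hasFDerivAt_of_tendstoUniformlyOn (𝕜 := ℝ) (f := picardIter A)
      (f' := fun n => fderiv ℝ (picardIter A n)) (l := atTop)
      (g' := fun x => ((ContinuousLinearMap.mul ℝ B).flip (Φ x)).comp (A x)) isOpen_ball ?_
      (fun n x _ => ((contDiff_picardIter hA n).differentiable (by simp) x).hasFDerivAt) hΦ hx
    have h0 : Tendsto (fun n : ℕ => 4 * C * ‖(1 : B)‖ * (1 / 2) ^ n
        + C * (‖(1 : B)‖ * (1 / 4) ^ n / (1 - 1 / 4))) atTop (𝓝 0) := by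
      have t1 := tendsto_pow_atTop_nhds_zero_of_lt_one (r := (1 / 2 : ℝ)) (by norm_num) (by norm_num)
      have t2 := tendsto_pow_atTop_nhds_zero_of_lt_one (r := (1 / 4 : ℝ)) (by norm_num) (by norm_num)
      have := (t1.const_mul (4 * C * ‖(1 : B)‖)).add
        (((t2.const_mul ‖(1 : B)‖).div_const (1 - 1 / 4)).const_mul C)
      simpa using this
    rw [Metric.tendstoUniformlyOn_iff]
    intro ε hε
    filter_upwards [h0.eventually (gt_mem_nhds hε)] with n hn y hy
    rw [dist_eq_norm]
    exact (hbound n y hy).trans_lt hn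

end Frobenius

/-! ### Frobenius' theorem on open sets, and uniqueness. -/

section Frobenius

open MeasureTheory Set Filter Metric

variable {E : Type*} [NormedAddCommGroup E] [NormedSpace ℝ E] [FiniteDimensional ℝ E]
  {B : Type*} [NormedRing B] [NormedAlgebra ℝ B] [CompleteSpace B]

lemma contDiffOn_smul_const {G : Type*} [NormedAddCommGroup G] [NormedSpace ℝ G]
    {n : WithTop ℕ∞} {f : E → ℝ} {U : Set E} (hf : ContDiffOn ℝ n f U) (c : G) :
    ContDiffOn ℝ n (fun x => f x • c) U :=
  hf.smul contDiffOn_const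

lemma exists_ball_norm_le {G : Type*} [NormedAddCommGroup G] [NormedSpace ℝ G]
    {f : E → G} {x : E} (hf : ContDiffAt ℝ 0 f x) :
    ∃ δ > 0, ∀ y ∈ ball x δ, ‖f y‖ ≤ ‖f x‖ + 1 := by
  obtain ⟨δ, hδ, h⟩ := Metric.eventually_nhds_iff_ball.1
    (Tendsto.eventually_lt_const (lt_add_one ‖f x‖) hf.continuousAt.norm)
  exact ⟨δ, hδ, fun y hy => (h y hy).le⟩

/-- The Picard estimates are stated for globally defined coefficients; a cut-off extends local ones.
Beyond the outer radius the product is locally zero, so smoothness there is automatic. -/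
lemma contDiff_bump_smul_comp_add {G : Type*} [NormedAddCommGroup G] [NormedSpace ℝ G]
    {f : E → G} {U : Set E} (hU : IsOpen U) {n : ℕ∞} (hf : ContDiffOn ℝ n f U) {x₀ : E}
    (χ : ContDiffBump (0 : E)) (hχ : ∀ y, ‖y‖ ≤ χ.rOut → x₀ + y ∈ U) :
    ContDiff ℝ n fun y => χ y • f (x₀ + y) := by
  rw [contDiff_iff_contDiffAt]
  intro y
  by_cases hy : ‖y‖ ≤ χ.rOut
  · have h1 : ContDiffAt ℝ n (fun y => f (x₀ + y)) y :=
      ContDiffAt.comp y (hf.contDiffAt (hU.mem_nhds (hχ y hy)))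
        (contDiffAt_const.add contDiffAt_id)
    exact χ.contDiff.contDiffAt.smul h1
  · have : (fun y => χ y • f (x₀ + y)) =ᶠ[𝓝 y] fun _ => 0 := by
      have ho : IsOpen {z : E | χ.rOut < ‖z‖} := isOpen_lt continuous_const continuous_norm
      filter_upwards [ho.mem_nhds (not_le.1 hy)] with z hz
      rw [χ.zero_of_le_dist (by simpa using (le_of_lt hz)), zero_smul]
    exact contDiffAt_const.congr_of_eventuallyEq this

/-- Frobenius' theorem for linear systems: a flat system `dΦ = A Φ` has local solutions. -/
theorem exists_hasFDerivAt_of_flat {A : E → E →L[ℝ] B} {U : Set E} (hU : IsOpen U)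
    (hA : ContDiffOn ℝ 1 A U)
    (hflat : ∀ x ∈ U, ∀ v w, fderiv ℝ A x v w + A x w * A x v = fderiv ℝ A x w v + A x v * A x w)
    {x₀ : E} (hx₀ : x₀ ∈ U) : ∃ r > 0, ball x₀ r ⊆ U ∧ ∃ Φ : E → B, Φ x₀ = 1 ∧
      ∀ x ∈ ball x₀ r, HasFDerivAt Φ (((ContinuousLinearMap.mul ℝ B).flip (Φ x)).comp (A x)) x := by
  obtain ⟨R, hR, hRU⟩ := Metric.isOpen_iff.1 hU x₀ hx₀
  -- The cut-off equals one on the ball of radius $R/4$, where the modified connection is therefore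
  -- still flat, and is supported in radius $R/2$, safely inside $U$.
  let χ : ContDiffBump (0 : E) := ⟨R / 4, R / 2, by positivity, by linarith⟩
  have hmem : ∀ y : E, ‖y‖ < R → x₀ + y ∈ U := fun y hy => hRU (by simpa using hy)
  let A' : E → E →L[ℝ] B := fun y => χ y • A (x₀ + y)
  have hA' : ContDiff ℝ 1 A' := contDiff_bump_smul_comp_add (n := 1) hU hA χ fun y hy =>
    hmem y (by change ‖y‖ ≤ R / 2 at hy; linarith)
  have heq : ∀ y ∈ ball (0 : E) (R / 4), A' y = A (x₀ + y) := fun y hy => by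
    have : χ y = 1 := χ.one_of_mem_closedBall (ball_subset_closedBall hy)
    simp [A', this]
  have hfd : ∀ y ∈ ball (0 : E) (R / 4), fderiv ℝ A' y = fderiv ℝ A (x₀ + y) := fun y hy => by
    have h1 : A' =ᶠ[𝓝 y] fun y => A (x₀ + y) := by
      filter_upwards [isOpen_ball.mem_nhds hy] with z hz using heq z hz
    rw [h1.fderiv_eq, fderiv_comp_add_left]
  obtain ⟨δ, hδ, hδb⟩ := Metric.continuousAt_iff.1 (hA'.continuous.continuousAt (x := (0 : E))) 1 one_pos
  set C := ‖A' 0‖ + 1 with hCdef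
  have hC0 : 0 < C := by positivity
  -- The three bounds ensure in turn $\|A'\|\le C$, agreement with the original connection, and
  -- $8Cr\le1$.
  set r := min (min δ (R / 4)) (1 / (8 * C)) with hrdef
  have hr : 0 < r := by positivity
  have hrR : r ≤ R / 4 := (min_le_left _ _).trans (min_le_right _ _)
  have hCr : 8 * (C * r) ≤ 1 := by
    have : r ≤ 1 / (8 * C) := min_le_right _ _
    rw [le_div_iff₀ (by positivity)] at this
    linarith
  obtain ⟨Φ, h1, h2⟩ := exists_hasFDerivAt_of_flat_ball (A := A') (C := C) (r := r) hA'
    (fun x hx => by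
      have h := hδb (x := x) (lt_of_lt_of_le hx ((min_le_left _ _).trans (min_le_left _ _)))
      rw [dist_eq_norm] at h
      have := norm_le_norm_add_norm_sub' (A' x) (A' 0)
      linarith) hCr hC0.le hr
    (fun x hx v w => by
      have hx' := ball_subset_ball hrR hx
      rw [hfd x hx', heq x hx']
      refine hflat _ (hmem x ?_) v w
      have := mem_ball_zero_iff.1 hx'
      linarith)
  refine ⟨r, hr, (ball_subset_ball (by linarith)).trans hRU, fun x => Φ (x - x₀), by simpa using h1,
    fun x hx => ?_⟩
  have hx' : x - x₀ ∈ ball (0 : E) r := by simpa [dist_eq_norm] using hx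
  have h3 := h2 (x - x₀) hx'
  rw [heq _ (ball_subset_ball hrR hx'), add_sub_cancel] at h3
  exact h3.comp x ((hasFDerivAt_id x).sub_const x₀)

/-- A solution of `dW = A W` on a convex set which vanishes at one point vanishes. -/
theorem eq_zero_of_hasFDerivAt_apply {F : Type*} [NormedAddCommGroup F] [NormedSpace ℝ F]
    {A : E → E →L[ℝ] F →L[ℝ] F} {V : Set E} (hV : Convex ℝ V) {C : ℝ} (hC : ∀ x ∈ V, ‖A x‖ ≤ C)
    {W : E → F} (hW : ∀ x ∈ V, HasFDerivAt W ((A x).flip (W x)) x) {q : E} (hq : q ∈ V)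
    (h0 : W q = 0) : ∀ x ∈ V, W x = 0 := by
  intro x hx
  have hm : ∀ t ∈ Icc (0 : ℝ) 1, q + t • (x - q) ∈ V := fun t ht =>
    hV.add_smul_sub_mem hq hx ht
  have hd : ∀ t ∈ Icc (0 : ℝ) 1, HasDerivAt (fun t : ℝ => W (q + t • (x - q)))
      (A (q + t • (x - q)) (x - q) (W (q + t • (x - q)))) t := fun t ht => by
    have hs : HasDerivAt (fun s : ℝ => q + s • (x - q)) (x - q) t := by
      simpa using ((hasDerivAt_id t).smul_const (x - q)).const_add q
    simpa [Function.comp_def] using (hW _ (hm t ht)).comp_hasDerivAt t hs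
  -- Grönwall along the segment from `q` to `x`: there $\|f'\|\le C\|x-q\|\,\|f\|$ and $f(0)=0$.
  have := eq_zero_of_abs_deriv_le_mul_abs_self_of_eq_zero_right
    (f := fun t : ℝ => W (q + t • (x - q)))
    (f' := fun t => A (q + t • (x - q)) (x - q) (W (q + t • (x - q))))
    (K := C * ‖x - q‖) (a := 0) (b := 1)
    (fun t ht => (hd t ht).continuousAt.continuousWithinAt)
    (fun t ht => (hd t ⟨ht.1, ht.2.le⟩).hasDerivWithinAt) (by simpa using h0)
    (fun t ht => by
      refine ((A (q + t • (x - q)) (x - q)).le_opNorm _).trans ?_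
      gcongr
      exact (A _).le_of_opNorm_le (hC _ (hm t ⟨ht.1, ht.2.le⟩)) _)
    1 (by simp)
  simpa using this

end Frobenius

/-! ### Linear first order systems on open subsets of the plane. -/

section Systems

open Set Filter Metric

variable {d : ℕ}

/-- `W` satisfies the linear system `∂ᵢ Wⱼ = ∑ₖ aᵢⱼₖ Wₖ` at `x`. -/
def SolvesAt (a : Fin 2 → Fin d → Fin d → Comp0) (W : Fin d → Comp0) (x : E2) : Prop :=
  ∀ j, DifferentiableAt ℝ (W j) x ∧ ∀ i, pd i (W j) x = ∑ k, a i j k x * W k x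

/-- The operator-valued `1`-form of a linear system. -/
def connForm (a : Fin 2 → Fin d → Fin d → Comp0) (x : E2) :
    E2 →L[ℝ] (Fin d → ℝ) →L[ℝ] (Fin d → ℝ) :=
  ∑ i, ∑ j, ∑ k, a i j k x • (EuclideanSpace.proj i : E2 →L[ℝ] ℝ).smulRight
    ((ContinuousLinearMap.proj k : (Fin d → ℝ) →L[ℝ] ℝ).smulRight (Pi.single j (1 : ℝ)))

lemma connForm_apply (a : Fin 2 → Fin d → Fin d → Comp0) (x v : E2) (w : Fin d → ℝ) (j : Fin d) :
    connForm a x v w j = ∑ i, v i * ∑ k, a i j k x * w k := by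
  simp only [connForm, Finset.mul_sum, sum_apply, Finset.sum_apply, smul_apply,
    ContinuousLinearMap.smulRight_apply, Pi.smul_apply, Pi.single_apply]
  refine Finset.sum_congr rfl fun i _ => ?_
  rw [Finset.sum_comm]
  refine Finset.sum_congr rfl fun k _ => ?_
  simp [mul_left_comm]

lemma fderiv_apply_eq_sum_pd (u : Comp0) (x v : E2) : fderiv ℝ u x v = ∑ i, v i * pd i u x := by
  have hv : v = ∑ i, v i • basisVec i := by
    ext j
    fin_cases j <;> simp [basisVec]
  conv_lhs => rw [hv]
  simp [pd]

lemma contDiffOn_connForm {n : WithTop ℕ∞} {a : Fin 2 → Fin d → Fin d → Comp0} {U : Set E2}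
    (ha : ∀ i j k, ContDiffOn ℝ n (a i j k) U) : ContDiffOn ℝ n (connForm a) U :=
  ContDiffOn.sum fun i _ => ContDiffOn.sum fun j _ => ContDiffOn.sum fun k _ =>
    contDiffOn_smul_const (ha i j k) _

/-- A differential is determined by its values on the two coordinate vectors. This is the bridge
between the component systems of the geometry and the invariant form $dW=AW$ used by Frobenius'
theorem. -/
lemma solvesAt_iff {a : Fin 2 → Fin d → Fin d → Comp0} {W : Fin d → Comp0} {x : E2} :
    SolvesAt a W x ↔ HasFDerivAt (fun y j => W j y) ((connForm a x).flip fun j => W j x) x := by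
  rw [hasFDerivAt_pi']
  refine forall_congr' fun j => ?_
  constructor
  · rintro ⟨h1, h2⟩
    convert! h1.hasFDerivAt using 1
    ext v
    rw [fderiv_apply_eq_sum_pd]
    simp [connForm_apply, h2]
  · intro h
    refine ⟨h.differentiableAt, fun i => ?_⟩
    rw [pd, h.fderiv]
    have := connForm_apply a x (basisVec i) (fun j => W j x) j
    simp only [ContinuousLinearMap.comp_apply, ContinuousLinearMap.flip_apply,
      ContinuousLinearMap.proj_apply, this]
    fin_cases i <;> simp [basisVec]

/-- Near every point, solutions of a linear system on a convex set are determined by their value at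
one point. -/
lemma exists_ball_eq_zero_of_solvesAt {a : Fin 2 → Fin d → Fin d → Comp0} {U : Set E2}
    (hU : IsOpen U) (ha : ∀ i j k, ContinuousOn (a i j k) U) {x₀ : E2} (hx₀ : x₀ ∈ U) :
    ∃ r > 0, ball x₀ r ⊆ U ∧ ∀ V ⊆ ball x₀ r, Convex ℝ V → ∀ W : Fin d → Comp0,
      (∀ x ∈ V, SolvesAt a W x) → ∀ q ∈ V, (∀ j, W j q = 0) → ∀ x ∈ V, ∀ j, W j x = 0 := by
  have hc : ContDiffOn ℝ 0 (connForm a) U := contDiffOn_connForm fun i j k =>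
    contDiffOn_zero.2 (ha i j k)
  obtain ⟨δ, hδ, hδb⟩ := exists_ball_norm_le (hc.contDiffAt (hU.mem_nhds hx₀))
  obtain ⟨R, hR, hRU⟩ := Metric.isOpen_iff.1 hU x₀ hx₀
  refine ⟨min δ R, by positivity, (ball_subset_ball (min_le_right _ _)).trans hRU,
    fun V hV hconv W hW q hq h0 x hx j => ?_⟩
  have := eq_zero_of_hasFDerivAt_apply (A := connForm a) hconv (C := ‖connForm a x₀‖ + 1)
    (fun y hy => hδb y (ball_subset_ball (min_le_left _ _) (hV hy))) (W := fun y j => W j y) (fun y hy => solvesAt_iff.1 (hW y hy)) hq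
      (funext h0) x hx
  exact congrFun this j

/-- Solutions of a linear system with smooth coefficients are smooth. -/
lemma contDiffOn_of_solvesAt {a : Fin 2 → Fin d → Fin d → Comp0} {U : Set E2}
    (hU : IsOpen U) (ha : ∀ i j k, ContDiffOn ℝ ∞ (a i j k) U) {W : Fin d → Comp0}
    (hW : ∀ x ∈ U, SolvesAt a W x) (j : Fin d) : ContDiffOn ℝ ∞ (W j) U := by
  -- Bootstrapping: $dW=AW$ is as regular as $W$, so $W$ gains one derivative at each step.
  have h : ∀ n : ℕ, ∀ j, ContDiffOn ℝ n (W j) U := by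
    intro n
    induction n with
    | zero =>
      exact fun j => contDiffOn_zero.2 fun x hx => ((hW x hx j).1.continuousAt).continuousWithinAt
    | succ n ih =>
      have h1 : ContDiffOn ℝ n (fun x => (connForm a x).flip fun j => W j x) U := by
        have h2 : ContDiffOn ℝ n (connForm a) U :=
          contDiffOn_connForm fun i j k => (ha i j k).of_le (by exact_mod_cast le_top)
        have h3 : ContDiffOn ℝ n (fun x j => W j x) U := contDiffOn_pi.2 ih
        exact ((ContinuousLinearMap.flipₗᵢ ℝ E2 (Fin d → ℝ) (Fin d → ℝ)).toContinuousLinearEquiv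
          |>.contDiff.comp_contDiffOn h2).clm_apply h3
      have h4 : ContDiffOn ℝ (n + 1) (fun x j => W j x) U := by
        rw [contDiffOn_succ_iff_fderiv_of_isOpen hU]
        refine ⟨fun x hx => (solvesAt_iff.1 (hW x hx)).differentiableAt.differentiableWithinAt,
          by simp, h1.congr fun x hx => (solvesAt_iff.1 (hW x hx)).fderiv⟩
      exact fun j => by exact_mod_cast contDiffOn_pi.1 h4 j
  exact contDiffOn_infty.2 fun n => h n j

/-- A flat linear system of rank `d` has, near every point, `d` solutions which form a basis of the
germs of solutions at every nearby point. -/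
theorem exists_basis_solvesAt {a : Fin 2 → Fin d → Fin d → Comp0} {U : Set E2}
    (hU : IsOpen U) (ha : ∀ i j k, ContDiffOn ℝ ∞ (a i j k) U)
    (hflat : ∀ x ∈ U, ∀ j k, pd 0 (a 1 j k) x + ∑ m, a 1 j m x * a 0 m k x
      = pd 1 (a 0 j k) x + ∑ m, a 0 j m x * a 1 m k x) {x₀ : E2} (hx₀ : x₀ ∈ U) :
    ∃ N, IsOpen N ∧ x₀ ∈ N ∧ N ⊆ U ∧ ∃ J : Fin d → Fin d → Comp0,
      (∀ m, ∀ x ∈ N, SolvesAt a (J m) x) ∧ ∀ q ∈ N, ∀ W : Fin d → Comp0,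
        (∀ᶠ y in 𝓝 q, SolvesAt a W y) →
          ∃! c : Fin d → ℝ, ∀ᶠ y in 𝓝 q, ∀ j, W j y = ∑ m, c m * J m j y := by
  have hda : ∀ x ∈ U, ∀ i j k, DifferentiableAt ℝ (a i j k) x := fun x hx i j k =>
    ((ha i j k).contDiffAt (hU.mem_nhds hx)).differentiableAt (by simp)
  have hA : ContDiffOn ℝ 1 (connForm a) U :=
    contDiffOn_connForm fun i j k => (ha i j k).of_le (by exact_mod_cast le_top)
  have hfd : ∀ x ∈ U, ∀ (v w : E2) (c : Fin d → ℝ) (j : Fin d), fderiv ℝ (connForm a) x v w c j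
      = ∑ i, w i * ∑ k, (∑ l, v l * pd l (a i j k) x) * c k := by
    intro x hx v w c j
    have h1 : HasFDerivAt (fun y => connForm a y w c j)
        ((((fderiv ℝ (connForm a) x).flip w).flip c |> fun T => (ContinuousLinearMap.proj j :
          (Fin d → ℝ) →L[ℝ] ℝ).comp T)) x := by
      have h2 := ((hA.contDiffAt (hU.mem_nhds hx)).differentiableAt (by simp)).hasFDerivAt
      have h3 : HasFDerivAt (fun y => connForm a y w c) _ x :=
        (h2.clm_apply (hasFDerivAt_const w x)).clm_apply (hasFDerivAt_const c x)
      convert! ((ContinuousLinearMap.proj j : (Fin d → ℝ) →L[ℝ] ℝ).hasFDerivAt.comp x h3) using 1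
      ext u
      simp
    have h4 : fderiv ℝ (fun y => connForm a y w c j) x v = fderiv ℝ (connForm a) x v w c j := by
      rw [h1.fderiv]; simp
    rw [← h4]
    have h5 : (fun y => connForm a y w c j) = fun y => ∑ i, w i * ∑ k, a i j k y * c k := by
      funext y; rw [connForm_apply]
    have h6 : HasFDerivAt (fun y => ∑ i, w i * ∑ k, a i j k y * c k)
        (∑ i, w i • ∑ k, c k • fderiv ℝ (a i j k) x) x := by
      refine HasFDerivAt.fun_sum fun i _ => (HasFDerivAt.fun_sum fun k _ => ?_).const_mul (w i)
      exact (hda x hx i j k).hasFDerivAt.mul_const (c k)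
    rw [h5, h6.fderiv]
    simp [fderiv_apply_eq_sum_pd, mul_comm]
  obtain ⟨r₁, hr₁, hr₁U, Φ, hΦ1, hΦ⟩ := exists_hasFDerivAt_of_flat hU hA (fun x hx v w => by
    ext c j
    have h := fun k => hflat x hx j k
    have e : ∀ (v w : E2), (fderiv ℝ (connForm a) x v w + connForm a x w * connForm a x v) c j
        = ∑ i, w i * ∑ l, v l * ∑ k, pd l (a i j k) x * c k
          + ∑ i, w i * ∑ l, v l * ∑ k, a i j k x * ∑ m, a l k m x * c m := by
      intro v w
      have s1 : ∀ i, ∑ k, (∑ l, v l * pd l (a i j k) x) * c k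
          = ∑ l, v l * ∑ k, pd l (a i j k) x * c k := fun i => by
        simp only [Finset.mul_sum, Finset.sum_mul]
        rw [Finset.sum_comm]
        simp only [mul_assoc]
      have s2 : ∀ i, ∑ k, a i j k x * ∑ l, v l * ∑ m, a l k m x * c m
          = ∑ l, v l * ∑ k, a i j k x * ∑ m, a l k m x * c m := fun i => by
        simp only [Finset.mul_sum]
        rw [Finset.sum_comm]
        simp only [mul_left_comm]
      rw [add_apply, Pi.add_apply, hfd x hx]
      simp only [mul_apply_eq_comp, connForm_apply, s1, s2]
    have e2 : ∀ i l, ∑ k, a i j k x * ∑ m, a l k m x * c m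
        = ∑ k, (∑ m, a i j m x * a l m k x) * c k := by
      intro i l
      simp only [Finset.mul_sum, Finset.sum_mul]
      rw [Finset.sum_comm]
      simp only [mul_assoc]
    have e3 : ∑ k, pd 0 (a 1 j k) x * c k + ∑ k, a 1 j k x * ∑ m, a 0 k m x * c m
        = ∑ k, pd 1 (a 0 j k) x * c k + ∑ k, a 0 j k x * ∑ m, a 1 k m x * c m := by
      rw [e2, e2, ← Finset.sum_add_distrib, ← Finset.sum_add_distrib]
      exact Finset.sum_congr rfl fun k _ => by rw [← add_mul, ← add_mul, h k]
    rw [e, e]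
    simp only [Fin.sum_univ_two]
    -- Curvature is alternating, so in the plane its $\partial_0,\partial_1$ component controls all
    -- pairs `v`, `w`.
    linear_combination (v 0 * w 1 - v 1 * w 0) * e3) hx₀
  -- The fundamental solution is the identity at `x₀` and the units are open, so near `x₀` its
  -- columns are independent initial values at every point.
  have hunit : ∀ᶠ x in 𝓝 x₀, IsUnit (Φ x) := by
    have h1 : ContinuousAt Φ x₀ := (hΦ x₀ (mem_ball_self hr₁)).continuousAt
    exact h1.eventually (Units.isOpen.mem_nhds (by rw [hΦ1]; exact isUnit_one))
  obtain ⟨r₂, hr₂, hr₂u⟩ := Metric.eventually_nhds_iff_ball.1 hunit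
  obtain ⟨r₃, hr₃, hr₃U, huniq⟩ := exists_ball_eq_zero_of_solvesAt hU
    (fun i j k => (ha i j k).continuousOn) hx₀
  have hsol : ∀ c : Fin d → ℝ, ∀ x ∈ ball x₀ r₁, SolvesAt a (fun j y => Φ y c j) x := by
    intro c x hx
    rw [solvesAt_iff]
    have h1 := (hΦ x hx).clm_apply (hasFDerivAt_const c x)
    convert! h1 using 1
    ext v
    simp
  have hlin : ∀ (c : Fin d → ℝ) y j, Φ y c j = ∑ m, c m * Φ y (Pi.single m 1) j := by
    intro c y j
    have : c = ∑ m, c m • (Pi.single m 1 : Fin d → ℝ) := by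
      ext k; simp [Finset.sum_apply, Pi.single_apply]
    conv_lhs => rw [this]
    simp
  set r := min r₁ (min r₂ r₃) with hr
  have hs1 : ball x₀ r ⊆ ball x₀ r₁ := ball_subset_ball (min_le_left _ _)
  have hs2 : ball x₀ r ⊆ ball x₀ r₂ :=
    ball_subset_ball ((min_le_right _ _).trans (min_le_left _ _))
  have hs3 : ball x₀ r ⊆ ball x₀ r₃ :=
    ball_subset_ball ((min_le_right _ _).trans (min_le_right _ _))
  refine ⟨ball x₀ r, isOpen_ball, mem_ball_self (by positivity), hs1.trans hr₁U,
    fun m j y => Φ y (Pi.single m 1) j, fun m x hx => hsol _ x (hs1 hx), fun q hq W hW => ?_⟩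
  simp only [← hlin]
  obtain ⟨T, hT⟩ := hr₂u q (hs2 hq)
  -- The coefficients must be $\Phi(q)^{-1}W(q)$. With this choice the difference of the two
  -- solutions vanishes at `q`, hence near `q` by uniqueness on convex sets.
  refine ⟨(↑T⁻¹ : (Fin d → ℝ) →L[ℝ] (Fin d → ℝ)) fun j => W j q, ?_, fun c hc => ?_⟩
  · have hW' := hW.and (isOpen_ball.mem_nhds hq)
    obtain ⟨ε, hε, hεW⟩ := Metric.eventually_nhds_iff_ball.1 hW'
    filter_upwards [ball_mem_nhds q hε] with y hy j
    set c := (↑T⁻¹ : (Fin d → ℝ) →L[ℝ] (Fin d → ℝ)) fun j => W j q with hc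
    have := huniq (ball q ε) (fun y hy => hs3 (hεW y hy).2) (convex_ball _ _)
      (fun j y => W j y - Φ y c j) (fun x hx => by
        have h1 := (hεW x hx).1
        have h2 := hsol c x (hs1 (hεW x hx).2)
        rw [solvesAt_iff] at h1 h2 ⊢
        convert! h1.sub h2 using 1
        ext v j
        simp [connForm_apply, mul_sub, Finset.sum_sub_distrib]) q (mem_ball_self hε)
        (fun j => by
          have : Φ q c = fun j => W j q := by
            rw [← hT, hc]
            have := congrArg (fun S => S fun j => W j q) T.mul_inv
            exact this
          simp [this]) y hy j
    linarith
  · have h1 : Φ q c = fun j => W j q := funext fun j => ((hc.self_of_nhds) j).symm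
    rw [← h1, ← hT]
    have := congrArg (fun S => S c) T.inv_mul
    exact this.symm

end Systems

/-! ### From local bases of solutions to global solutions on a simply connected space. -/

section Gluing

open Set Filter

/-- A fiber bundle with discrete fiber over a simply connected base has a (locally constant) section
through every point. -/
theorem exists_locallyConstant_section {ι X F : Type*} [TopologicalSpace X]
    [SimplyConnectedSpace X] [LocallyPathConnectedSpace X] [TopologicalSpace F] [DiscreteTopology F]
    (Z : FiberBundleCore ι X F) (x₀ : X) (v₀ : F) :
    ∃ s : X → F, s x₀ = v₀ ∧ ∀ i, ∀ x ∈ Z.baseSet i, ∀ᶠ y in 𝓝 x,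
      Z.coordChange (Z.indexAt y) i y (s y) = Z.coordChange (Z.indexAt x) i x (s x) := by
  -- A bundle with discrete fibre is a covering, and over a simply connected base the identity lifts
  -- through it; the lift is the section.
  have hcov : IsCoveringMap (Bundle.TotalSpace.proj : Z.TotalSpace → X) :=
    FiberBundle.isCoveringMap (F := F) (E := Z.Fiber)
  obtain ⟨L, ⟨hL0, hL⟩, -⟩ := hcov.existsUnique_continuousMap_lifts (ContinuousMap.id X) x₀
    (⟨x₀, v₀⟩ : Z.TotalSpace) rfl
  have hproj : ∀ x, (L x).proj = x := fun x => congrFun hL x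
  refine ⟨fun x => (L x).2, ?_, fun i x hx => ?_⟩
  · change (L x₀).2 = v₀
    rw [hL0]
  · have hx' : L x ∈ (Z.localTriv i).source := by
      rw [Z.mem_localTriv_source, hproj]
      exact hx
    have hc : ContinuousAt (fun y => (Z.localTriv i (L y)).2) x :=
      continuousAt_snd.comp (((Z.localTriv i).continuousAt hx').comp L.continuous.continuousAt)
    have he : ∀ y, (Z.localTriv i (L y)).2 = Z.coordChange (Z.indexAt y) i y (L y).2 := fun y => by
      rw [Z.localTriv_apply]
      simp only [hproj]
    -- Continuity into a discrete fibre is local constancy of the coordinates.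
    simp only [ContinuousAt, nhds_discrete, tendsto_pure, he] at hc
    exact hc

/-- Coefficient vectors with the discrete topology. -/
def Coef (d : ℕ) : Type := Fin d → ℝ

instance (d : ℕ) : TopologicalSpace (Coef d) := ⊥
instance (d : ℕ) : DiscreteTopology (Coef d) := ⟨rfl⟩

/-- The linear combination `∑ cₖ bₖ`. -/
def linComb {X : Type*} {d : ℕ} (c : Fin d → ℝ) (b : Fin d → X → ℝ) : X → ℝ :=
  fun y => ∑ k, c k * b k y

/-- A linear condition on germs of functions. -/
structure GermCondition (X : Type*) [TopologicalSpace X] where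
  /-- The condition. -/
  holds : (X → ℝ) → X → Prop
  congr : ∀ {u v : X → ℝ} {p : X}, u =ᶠ[𝓝 p] v → holds u p → holds v p
  add : ∀ {u v : X → ℝ} {p : X}, holds u p → holds v p → holds (fun y => u y + v y) p
  smul : ∀ {u : X → ℝ} {p : X} (c : ℝ), holds u p → holds (fun y => c * u y) p
  zero : ∀ p, holds (fun _ => 0) p

namespace GermCondition

variable {X : Type*} [TopologicalSpace X] (S : GermCondition X)

/-- The global solutions. -/
def solutions : Submodule ℝ (X → ℝ) where
  carrier := {w | ∀ p, S.holds w p}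
  zero_mem' := S.zero
  add_mem' := fun hu hv p => S.add (hu p) (hv p)
  smul_mem' := fun c _ hu p => S.smul c (hu p)

/-- `b` is a basis of the germs of solutions at every point of `N`. -/
def IsLocalBasis {d : ℕ} (N : Set X) (b : Fin d → X → ℝ) : Prop :=
  (∀ k, ∀ q ∈ N, S.holds (b k) q) ∧ ∀ q ∈ N, ∀ w : X → ℝ, (∀ᶠ y in 𝓝 q, S.holds w y) →
    ∃! c : Fin d → ℝ, w =ᶠ[𝓝 q] linComb c b

variable {S}

lemma holds_linComb {d : ℕ} {b : Fin d → X → ℝ} {p : X} (h : ∀ k, S.holds (b k) p)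
    (c : Fin d → ℝ) : S.holds (linComb c b) p := by
  classical
  have : ∀ s : Finset (Fin d), S.holds (fun y => ∑ k ∈ s, c k * b k y) p := by
    intro s
    induction s using Finset.induction_on with
    | empty => simpa using S.zero p
    | insert k s hk ih =>
      simp only [Finset.sum_insert hk]
      exact S.add (S.smul _ (h k)) ih
  exact this Finset.univ

lemma IsLocalBasis.eq_of_eventuallyEq {d : ℕ} {N : Set X} {b : Fin d → X → ℝ}
    (hb : S.IsLocalBasis N b) (hN : IsOpen N) {q : X} (hq : q ∈ N) {c c' : Fin d → ℝ}
    (h : linComb c b =ᶠ[𝓝 q] linComb c' b) : c = c' :=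
  (hb.2 q hq (linComb c' b) (by
    filter_upwards [hN.mem_nhds hq] with y hy
    exact holds_linComb (fun k => hb.1 k y hy) c')).unique h.symm (EventuallyEq.refl _ _)

/-- Unique continuation. -/
lemma eq_zero_of_eventuallyEq_zero {d : ℕ} [PreconnectedSpace X]
    (hS : ∀ p : X, ∃ N, IsOpen N ∧ p ∈ N ∧ ∃ b : Fin d → X → ℝ, S.IsLocalBasis N b)
    {w : X → ℝ} (hw : ∀ p, S.holds w p) {p : X} (h0 : w =ᶠ[𝓝 p] fun _ => 0) : ∀ q, w q = 0 := by
  set Z : Set X := {q | w =ᶠ[𝓝 q] fun _ => 0} with hZ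
  have hopen : IsOpen Z := isOpen_iff_mem_nhds.2 fun q hq => eventually_eventually_nhds.2 hq
  have hclosed : IsClosed Z := by
    refine isClosed_of_closure_subset fun q hq => ?_
    obtain ⟨N, hN, hqN, b, hb⟩ := hS q
    obtain ⟨c, hc, -⟩ := hb.2 q hqN w (Eventually.of_forall hw)
    have h1 : ∀ᶠ y in 𝓝 q, w =ᶠ[𝓝 y] linComb c b ∧ y ∈ N :=
      (eventually_eventually_nhds.2 hc).and (hN.mem_nhds hqN)
    obtain ⟨y, hyZ, h2, hyN⟩ := ((mem_closure_iff_frequently.1 hq).and_eventually h1).exists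
    -- The expansion of `w` in the local basis at `q` is valid near the point `y`, where `w` has
    -- zero germ. One coefficient vector serves both points, so it is zero.
    have h3 : c = 0 := hb.eq_of_eventuallyEq hN hyN
      ((h2.symm.trans hyZ).trans (by simp [linComb, EventuallyEq]))
    refine hc.trans ?_
    simp [h3, linComb, EventuallyEq]
  have huniv : Z = univ := IsClopen.eq_univ ⟨hclosed, hopen⟩ ⟨p, h0⟩
  intro q
  have : q ∈ Z := huniv ▸ mem_univ q
  exact this.self_of_nhds

/-- On a simply connected space, germs of solutions of a locally constant condition extend. -/
theorem exists_solution {d : ℕ} [SimplyConnectedSpace X] [LocallyPathConnectedSpace X]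
    {N : X → Set X} (hN : ∀ p, IsOpen (N p)) (hpN : ∀ p, p ∈ N p) {b : X → Fin d → X → ℝ}
    (hb : ∀ p, S.IsLocalBasis (N p) (b p)) (p₀ : X) (c₀ : Fin d → ℝ) :
    ∃ w : X → ℝ, (∀ p, S.holds w p) ∧ w =ᶠ[𝓝 p₀] linComb c₀ (b p₀) := by
  classical
  have hex : ∀ i j x (c : Fin d → ℝ), x ∈ N i ∩ N j →
      ∃ c' : Fin d → ℝ, linComb c (b i) =ᶠ[𝓝 x] linComb c' (b j) := fun i j x c hx =>
    ((hb j).2 x hx.2 _ (by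
      filter_upwards [(hN i).mem_nhds hx.1] with y hy
      exact holds_linComb (fun k => (hb i).1 k y hy) c)).exists
  choose! C hC using hex
  have hCuniq : ∀ i j x c c', x ∈ N i ∩ N j → linComb c (b i) =ᶠ[𝓝 x] linComb c' (b j) →
      C i j x c = c' := fun i j x c c' hx h =>
    (hb j).eq_of_eventuallyEq (hN j) hx.2 ((hC i j x c hx).symm.trans h)
  let C' : X → X → X → Coef d → Coef d := C
  -- An identity of germs at `x` is an identity of germs at nearby points, so the change of basis is
  -- locally constant in `x`. This is what continuity means for discrete fibres.
  have hcont : ∀ i j x (v : Coef d), x ∈ N i ∩ N j →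
      ContinuousAt (fun p : X × Coef d => C' i j p.1 p.2) (x, v) := fun i j x v hx => by
    rw [continuousAt_prod_of_discrete_right]
    refine (continuousAt_const (y := C' i j x v)).congr ?_
    filter_upwards [((hN i).inter (hN j)).mem_nhds hx,
      eventually_eventually_nhds.2 (hC i j x v hx)] with y hy h
    exact (hCuniq i j y v _ hy h).symm
  let Z : FiberBundleCore X X (Coef d) :=
    { baseSet := N
      isOpen_baseSet := hN
      indexAt := id
      mem_baseSet_at := hpN
      coordChange := C'
      coordChange_self := fun i x hx v => hCuniq i i x v v ⟨hx, hx⟩ (EventuallyEq.refl _ _)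
      continuousOn_coordChange := fun i j p hp =>
        (hcont i j p.1 p.2 hp.1).continuousWithinAt
      coordChange_comp := fun i j k x hx v => by
        refine (hCuniq i k x v _ ⟨hx.1.1, hx.2⟩ ?_).symm
        exact (hC i j x v hx.1).trans (hC j k x _ ⟨hx.1.2, hx.2⟩) }
  obtain ⟨s, hs0, hs⟩ := exists_locallyConstant_section Z p₀ c₀
  -- The value at `y` is computed in the basis attached to `y` itself. Local constancy of the
  -- section lets the fixed basis at `p` be used throughout a neighbourhood.
  have key : ∀ p, (fun y => linComb (s y) (b y) y) =ᶠ[𝓝 p] linComb (s p) (b p) := by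
    intro p
    filter_upwards [hs p p (hpN p), (hN p).mem_nhds (hpN p)] with y hy hyp
    have h1 : C y p y (s y) = C p p p (s p) := hy
    have h2 : C p p p (s p) = s p :=
      hCuniq p p p _ _ ⟨hpN p, hpN p⟩ (EventuallyEq.refl _ _)
    have h3 := (hC y p y (s y) ⟨hpN y, hyp⟩).self_of_nhds
    rw [h1, h2] at h3
    exact h3
  refine ⟨fun y => linComb (s y) (b y) y, fun p => ?_, ?_⟩
  · exact S.congr (key p).symm (holds_linComb (fun k => (hb p).1 k p (hpN p)) _)
  · rw [← hs0]
    exact key p₀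

/-- On a simply connected space, a condition whose germs of solutions are locally constant of rank
`d` has a `d`-dimensional space of solutions. -/
theorem finrank_solutions {d : ℕ} [SimplyConnectedSpace X] [LocallyPathConnectedSpace X]
    (hS : ∀ p : X, ∃ N, IsOpen N ∧ p ∈ N ∧ ∃ b : Fin d → X → ℝ, S.IsLocalBasis N b) :
    Module.finrank ℝ S.solutions = d := by
  choose N hN hpN b hb using hS
  obtain ⟨p₀⟩ : Nonempty X := inferInstance
  have hcoef : ∀ w : S.solutions, ∃ c : Fin d → ℝ, w.1 =ᶠ[𝓝 p₀] linComb c (b p₀) := fun w =>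
    ((hb p₀).2 p₀ (hpN p₀) w.1 (Eventually.of_forall w.2)).exists
  choose T hT using hcoef
  have huniq : ∀ (w : S.solutions) c, w.1 =ᶠ[𝓝 p₀] linComb c (b p₀) → T w = c := fun w c h =>
    (hb p₀).eq_of_eventuallyEq (hN p₀) (hpN p₀) ((hT w).symm.trans h)
  -- Reading off coefficients of the germ at `p₀` is injective by unique continuation and surjective
  -- by `exists_solution`.
  let L : S.solutions →ₗ[ℝ] (Fin d → ℝ) :=
    { toFun := T
      map_add' := fun u v => huniq _ _ (by
        filter_upwards [hT u, hT v] with y h1 h2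
        simp [h1, h2, linComb, add_mul, Finset.sum_add_distrib])
      map_smul' := fun a u => huniq _ _ (by
        filter_upwards [hT u] with y h1
        simp [h1, linComb, mul_assoc, Finset.mul_sum]) }
  have hinj : Function.Injective L := by
    rw [injective_iff_map_eq_zero]
    intro w hw
    have h1 : w.1 =ᶠ[𝓝 p₀] fun _ => 0 := by
      have := hT w
      rw [show T w = 0 from hw] at this
      refine this.trans ?_
      simp [linComb, EventuallyEq]
    have h2 := eq_zero_of_eventuallyEq_zero (fun p => ⟨N p, hN p, hpN p, b p, hb p⟩) w.2 h1
    exact Subtype.ext (funext h2)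
  have hsurj : Function.Surjective L := fun c => by
    obtain ⟨w, hw, hc⟩ := exists_solution hN hpN hb p₀ c
    exact ⟨⟨w, hw⟩, huniq _ _ hc⟩
  rw [(LinearEquiv.ofBijective L ⟨hinj, hsurj⟩).finrank_eq, Module.finrank_fin_fun]

end GermCondition

end Gluing

/-! ### Components of tensors in charts and their change under transition maps. -/

section Charts

open Set Filter

variable {M : Type*} [TopologicalSpace M] [ChartedSpace E2 M] [IsManifold (𝓡 2) ∞ M]

lemma contMDiff_const_section {E : Type*} [NormedAddCommGroup E] [NormedSpace ℝ E] (v : E) :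
    ContMDiff 𝓘(ℝ, E) 𝓘(ℝ, E).tangent ∞ (fun x : E => (⟨x, v⟩ : TangentBundle 𝓘(ℝ, E) E)) := by
  have : ContMDiff 𝓘(ℝ, E) 𝓘(ℝ, E).tangent ∞
      (fun x : E => (⟨x, (fun _ => v : ∀ x : E, TangentSpace 𝓘(ℝ, E) x) x⟩ :
        TangentBundle 𝓘(ℝ, E) E)) :=
    contMDiff_vectorSpace_iff_contDiff.2 contDiff_const
  exact this

lemma contMDiffOn_coordVector {e : OpenPartialHomeomorph M E2} (he : e ∈ atlas E2 M) (i : Fin 2) :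
    ContMDiffOn 𝓘(ℝ, E2) (𝓡 2).tangent ∞ (fun x => (⟨e.symm x,
      mfderiv 𝓘(ℝ, E2) (𝓡 2) e.symm x (basisVec i)⟩ : TangentBundle (𝓡 2) M)) e.target := by
  have h1 : ContMDiffOn 𝓘(ℝ, E2) (𝓡 2) ∞ e.symm e.target :=
    contMDiffOn_symm_of_mem_maximalAtlas (IsManifold.subset_maximalAtlas he)
  have h2 := h1.contMDiffOn_tangentMapWithin (m := ∞) (by simp) e.open_target.uniqueMDiffOn
  have h3 : ContMDiff 𝓘(ℝ, E2) 𝓘(ℝ, E2).tangent ∞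
      (fun x : E2 => (⟨x, basisVec i⟩ : TangentBundle 𝓘(ℝ, E2) E2)) :=
    contMDiff_const_section (basisVec i)
  refine (h2.comp h3.contMDiffOn (s := e.target) fun x hx => hx).congr fun x hx => ?_
  simp only [tangentMapWithin, Function.comp]
  rw [mfderivWithin_of_isOpen e.open_target hx]

/-- The components are a smooth section of the bundle of bilinear forms evaluated on the coordinate
fields, which are smooth as images of constant fields under the tangent map of the inverse chart. -/
lemma contDiffOn_comps {T : ∀ p : M, TangentSpace (𝓡 2) p →L[ℝ] TangentSpace (𝓡 2) p →L[ℝ] ℝ}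
    (hT : ContMDiff (𝓡 2) ((𝓡 2).prod 𝓘(ℝ, E2 →L[ℝ] E2 →L[ℝ] ℝ)) ∞
      (fun p : M => Bundle.TotalSpace.mk' (E2 →L[ℝ] E2 →L[ℝ] ℝ)
        (E := fun p : M => TangentSpace (𝓡 2) p →L[ℝ] TangentSpace (𝓡 2) p →L[ℝ] ℝ) p (T p)))
    {e : OpenPartialHomeomorph M E2} (he : e ∈ atlas E2 M) (i j : Fin 2) :
    ContDiffOn ℝ ∞ (comps T e i j) e.target := by
  have h1 : ContMDiffOn 𝓘(ℝ, E2) (𝓡 2) ∞ e.symm e.target :=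
    contMDiffOn_symm_of_mem_maximalAtlas (IsManifold.subset_maximalAtlas he)
  have h2 : ContMDiffOn 𝓘(ℝ, E2) ((𝓡 2).prod 𝓘(ℝ)) ∞
      (fun x ↦ Bundle.TotalSpace.mk' ℝ (E := Bundle.Trivial M ℝ) (e.symm x)
        (T (e.symm x) (mfderiv 𝓘(ℝ, E2) (𝓡 2) e.symm x (basisVec i))
          (mfderiv 𝓘(ℝ, E2) (𝓡 2) e.symm x (basisVec j)))) e.target := by
    apply ContMDiffOn.clm_bundle_apply₂ (F₁ := E2) (F₂ := E2)
    · exact hT.comp_contMDiffOn h1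
    · exact contMDiffOn_coordVector he i
    · exact contMDiffOn_coordVector he j
  intro x hx
  have h3 := h2 x hx
  simp only [Bundle.contMDiffWithinAt_totalSpace] at h3
  exact h3.2.contDiffWithinAt

lemma mfderiv_symm_injective {e : OpenPartialHomeomorph M E2} (he : e ∈ atlas E2 M) {x : E2}
    (hx : x ∈ e.target) : Function.Injective (mfderiv 𝓘(ℝ, E2) (𝓡 2) e.symm x) := by
  have h1 : ContMDiffAt 𝓘(ℝ, E2) (𝓡 2) ∞ e.symm x :=
    contMDiffAt_symm_of_mem_maximalAtlas (IsManifold.subset_maximalAtlas he) hx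
  have h2 : ContMDiffAt (𝓡 2) 𝓘(ℝ, E2) ∞ e (e.symm x) :=
    contMDiffAt_of_mem_maximalAtlas (IsManifold.subset_maximalAtlas he) (e.map_target hx)
  have h3 : mfderiv 𝓘(ℝ, E2) 𝓘(ℝ, E2) (e ∘ e.symm) x = _ :=
    mfderiv_comp x (h2.mdifferentiableAt (by simp)) (h1.mdifferentiableAt (by simp))
  have h4 : (e ∘ e.symm) =ᶠ[𝓝 x] id := by
    filter_upwards [e.open_target.mem_nhds hx] with y hy using e.right_inv hy
  rw [h4.mfderiv_eq, mfderiv_id] at h3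
  intro v w hvw
  have h5 : ∀ v, mfderiv (𝓡 2) 𝓘(ℝ, E2) e (e.symm x) (mfderiv 𝓘(ℝ, E2) (𝓡 2) e.symm x v) = v :=
    fun v => (congrArg (fun L => L v) h3).symm
  rw [← h5 v, hvw, h5 w]

/-- The coordinate change between two charts. -/
def transition (e e' : OpenPartialHomeomorph M E2) : E2 → E2 := fun y => e (e'.symm y)

lemma contDiffAt_transition {e e' : OpenPartialHomeomorph M E2} (he : e ∈ atlas E2 M)
    (he' : e' ∈ atlas E2 M) {x : E2} (hx : x ∈ e'.target) (hx' : e'.symm x ∈ e.source) :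
    ContDiffAt ℝ ∞ (transition e e') x := by
  have h1 : ContMDiffAt 𝓘(ℝ, E2) (𝓡 2) ∞ e'.symm x :=
    contMDiffAt_symm_of_mem_maximalAtlas (IsManifold.subset_maximalAtlas he') hx
  have h2 : ContMDiffAt (𝓡 2) 𝓘(ℝ, E2) ∞ e (e'.symm x) :=
    contMDiffAt_of_mem_maximalAtlas (IsManifold.subset_maximalAtlas he) hx'
  exact contMDiffAt_iff_contDiffAt.1 (h2.comp x h1)

lemma eventually_mem_target {e e' : OpenPartialHomeomorph M E2} {x : E2} (hx : x ∈ e'.target)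
    (hx' : e'.symm x ∈ e.source) : ∀ᶠ y in 𝓝 x, y ∈ e'.target ∧ e'.symm y ∈ e.source :=
  Filter.Eventually.and (e'.open_target.mem_nhds hx)
    ((e'.continuousAt_symm hx).eventually (e.open_source.mem_nhds hx'))

lemma mfderiv_symm_transition {e e' : OpenPartialHomeomorph M E2} (he : e ∈ atlas E2 M)
    (he' : e' ∈ atlas E2 M) {x : E2} (hx : x ∈ e'.target) (hx' : e'.symm x ∈ e.source) (v : E2) :
    mfderiv 𝓘(ℝ, E2) (𝓡 2) e'.symm x v = mfderiv 𝓘(ℝ, E2) (𝓡 2) e.symm (transition e e' x)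
      (fderiv ℝ (transition e e') x v) := by
  have h1 : ContMDiffAt 𝓘(ℝ, E2) (𝓡 2) ∞ e.symm (transition e e' x) :=
    contMDiffAt_symm_of_mem_maximalAtlas (IsManifold.subset_maximalAtlas he) (e.map_source hx')
  have h2 : MDifferentiableAt 𝓘(ℝ, E2) 𝓘(ℝ, E2) (transition e e') x :=
    ((contDiffAt_transition he he' hx hx').differentiableAt (by simp)).mdifferentiableAt
  have h3 : mfderiv 𝓘(ℝ, E2) (𝓡 2) (e.symm ∘ transition e e') x = _ :=
    mfderiv_comp x (h1.mdifferentiableAt (by simp)) h2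
  have h4 : (e.symm ∘ transition e e') =ᶠ[𝓝 x] e'.symm := by
    filter_upwards [eventually_mem_target hx hx'] with y hy using e.left_inv hy.2
  rw [h4.mfderiv_eq, mfderiv_eq_fderiv] at h3
  exact congrArg (fun L => L v) h3

lemma pd_comp_apply {φ : E2 → E2} {x : E2} (hφ : DifferentiableAt ℝ φ x) (i a : Fin 2) :
    pd i (fun y => φ y a) x = fderiv ℝ φ x (basisVec i) a := by
  have := (EuclideanSpace.proj a : E2 →L[ℝ] ℝ).hasFDerivAt.comp x hφ.hasFDerivAt
  have h : HasFDerivAt (fun y => φ y a) _ x := this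
  rw [pd, h.fderiv]
  simp

lemma bilinear_apply_eq_sum (L : E2 →L[ℝ] E2 →L[ℝ] ℝ) (D : E2 →L[ℝ] E2) (v w : E2) :
    L (D v) (D w) = ∑ a, ∑ b, v a * w b * L (D (basisVec a)) (D (basisVec b)) := by
  have hv : ∀ v : E2, v = ∑ i, v i • basisVec i := fun v => by
    ext j
    fin_cases j <;> simp [basisVec]
  conv_lhs => rw [hv v, hv w]
  simp only [Fin.sum_univ_two, map_add, map_smul, add_apply, smul_apply, smul_eq_mul]
  ring

lemma comps_transition
    (T : ∀ p : M, TangentSpace (𝓡 2) p →L[ℝ] TangentSpace (𝓡 2) p →L[ℝ] ℝ)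
    {e e' : OpenPartialHomeomorph M E2} (he : e ∈ atlas E2 M)
    (he' : e' ∈ atlas E2 M) {x : E2} (hx : x ∈ e'.target) (hx' : e'.symm x ∈ e.source)
    (i j : Fin 2) :
    comps T e' i j x = ∑ a, ∑ b, pd i (fun y => transition e e' y a) x
      * pd j (fun y => transition e e' y b) x * comps T e a b (transition e e' x) := by
  have hφ := (contDiffAt_transition he he' hx hx').differentiableAt (by simp)
  have hpt : e.symm (transition e e' x) = e'.symm x := e.left_inv hx'
  have hT : (T (e'.symm x) : E2 →L[ℝ] E2 →L[ℝ] ℝ) = T (e.symm (transition e e' x)) := by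
    have : ∀ p q : M, p = q → (T p : E2 →L[ℝ] E2 →L[ℝ] ℝ) = (T q : E2 →L[ℝ] E2 →L[ℝ] ℝ) := by
      rintro p _ rfl
      rfl
    exact this _ _ hpt.symm
  simp only [pd_comp_apply hφ]
  have key := bilinear_apply_eq_sum (T (e.symm (transition e e' x)) : E2 →L[ℝ] E2 →L[ℝ] ℝ)
    (mfderiv 𝓘(ℝ, E2) (𝓡 2) e.symm (transition e e' x))
    (fderiv ℝ (transition e e') x (basisVec i)) (fderiv ℝ (transition e e') x (basisVec j))
  refine Eq.trans ?_ key
  have hi := mfderiv_symm_transition he he' hx hx' (basisVec i)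
  have hj := mfderiv_symm_transition he he' hx hx' (basisVec j)
  have h : ∀ (L L' : E2 →L[ℝ] E2 →L[ℝ] ℝ) (v v' w w' : E2), L = L' → v = v' → w = w' →
      L v w = L' v' w' := by
    rintro L _ v _ w _ rfl rfl rfl
    rfl
  exact h _ _ _ _ _ _ hT hi hj

/-- Components of a metric and of its Rho tensor on an open set. -/
structure IsMoebiusChart (G P : Comp2) (U : Set E2) : Prop where
  isOpen : IsOpen U
  contDiffOn_G : ∀ i j, ContDiffOn ℝ ∞ (G i j) U
  contDiffOn_P : ∀ i j, ContDiffOn ℝ ∞ (P i j) U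
  symm_G : ∀ x ∈ U, ∀ i j, G i j x = G j i x
  symm_P : ∀ x ∈ U, ∀ i j, P i j x = P j i x
  pos_G : ∀ x ∈ U, 0 < G 0 0 x
  det_pos : ∀ x ∈ U, 0 < detG G x
  trace_P : ∀ x ∈ U, trace G P x = gaussCurv G x

lemma MoebiusSurface.isMoebiusChart (S : MoebiusSurface M) (g : S.metrics)
    {e : OpenPartialHomeomorph M E2} (he : e ∈ atlas E2 M) :
    IsMoebiusChart (S.G g e) (S.P g e) e.target := by
  have hpos : ∀ x ∈ e.target, ∀ v : E2, v ≠ 0 →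
      0 < ∑ a, ∑ b, v a * v b * S.G g e a b x := by
    intro x hx v hv
    have h1 : mfderiv 𝓘(ℝ, E2) (𝓡 2) e.symm x v ≠ 0 := fun h =>
      hv (mfderiv_symm_injective he hx (h.trans (map_zero _).symm))
    have h2 := g.1.pos (e.symm x) _ h1
    exact lt_of_lt_of_eq h2 (bilinear_apply_eq_sum (g.1.inner (e.symm x) : E2 →L[ℝ] E2 →L[ℝ] ℝ)
      (mfderiv 𝓘(ℝ, E2) (𝓡 2) e.symm x) v v)
  have hsymm : ∀ x ∈ e.target, ∀ i j, S.G g e i j x = S.G g e j i x :=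
    fun x _ i j => g.1.symm _ _ _
  have hpos0 : ∀ x ∈ e.target, 0 < S.G g e 0 0 x := fun x hx => by
    have h0 : basisVec 0 ≠ 0 := fun h => by
      have := congrArg (fun v : E2 => v 0) h
      simp [basisVec] at this
    simpa [basisVec] using hpos x hx (basisVec 0) h0
  refine ⟨e.open_target, contDiffOn_comps g.1.contMDiff he,
    contDiffOn_comps (S.rho g).contMDiff he, hsymm, fun x _ i j => (S.rho g).symm _ _ _,
    hpos0, fun x hx => ?_, fun x hx => S.trace_rho g e he x hx⟩
  have h0 := hpos0 x hx
  -- On this vector the quadratic form equals $g_{00}\det g$, so its positivity gives that of the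
  -- determinant.
  have h1 := hpos x hx (WithLp.toLp 2 ![-S.G g e 0 1 x, S.G g e 0 0 x]) fun h => by
    have := congrArg (fun v : E2 => v 1) h
    simp at this
    exact h0.ne' this
  have hs := hsymm x hx 1 0
  simp only [Fin.sum_univ_two, Matrix.cons_val_zero, Matrix.cons_val_one, hs] at h1
  rw [detG, hs]
  nlinarith

end Charts

/-! ### Rules for partial derivatives. -/

section Calculus

open Set Filter

variable {u v : Comp0} {x : E2} {U : Set E2}

lemma pd_fun_add (hu : DifferentiableAt ℝ u x) (hv : DifferentiableAt ℝ v x) (i : Fin 2) :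
    pd i (fun y => u y + v y) x = pd i u x + pd i v x := pd_add hu hv i

lemma pd_fun_sub (hu : DifferentiableAt ℝ u x) (hv : DifferentiableAt ℝ v x) (i : Fin 2) :
    pd i (fun y => u y - v y) x = pd i u x - pd i v x := by
  simp [pd, fderiv_fun_sub hu hv]

lemma pd_fun_neg (i : Fin 2) : pd i (fun y => - u y) x = - pd i u x := by
  simp [pd, fderiv_fun_neg]

lemma pd_const (c : ℝ) (i : Fin 2) : pd i (fun _ => c) x = 0 := by
  simp [pd]

lemma pd_fun_mul (hu : DifferentiableAt ℝ u x) (hv : DifferentiableAt ℝ v x) (i : Fin 2) :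
    pd i (fun y => u y * v y) x = pd i u x * v x + u x * pd i v x := by
  simp only [pd, fderiv_fun_mul hu hv, add_apply, smul_apply, smul_eq_mul]
  ring

lemma pd_fun_sum {ι : Type*} {s : Finset ι} {f : ι → Comp0}
    (hf : ∀ k ∈ s, DifferentiableAt ℝ (f k) x) (i : Fin 2) :
    pd i (fun y => ∑ k ∈ s, f k y) x = ∑ k ∈ s, pd i (f k) x := by
  simp [pd, fderiv_fun_sum hf]

lemma pd_scomp {f : ℝ → ℝ} {f' : ℝ} (hf : HasDerivAt f f' (u x)) (hu : DifferentiableAt ℝ u x)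
    (i : Fin 2) : pd i (fun y => f (u y)) x = f' * pd i u x := by
  have h : HasFDerivAt (fun y => f (u y)) _ x := hf.comp_hasFDerivAt x hu.hasFDerivAt
  simp [pd, h.fderiv]

lemma pd_comm (hu : ContDiffAt ℝ 2 u x) (i j : Fin 2) : pd i (pd j u) x = pd j (pd i u) x := by
  have hd : DifferentiableAt ℝ (fderiv ℝ u) x :=
    (hu.fderiv_right (m := 1) (by norm_num)).differentiableAt (by simp)
  have h : ∀ i j, pd i (pd j u) x = fderiv ℝ (fderiv ℝ u) x (basisVec i) (basisVec j) := by
    intro i j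
    have h1 : HasFDerivAt (fun y => fderiv ℝ u y (basisVec j)) _ x :=
      hd.hasFDerivAt.clm_apply (hasFDerivAt_const (basisVec j) x)
    change fderiv ℝ (fun y => fderiv ℝ u y (basisVec j)) x (basisVec i) = _
    rw [h1.fderiv]
    simp
  rw [h, h]
  exact (hu.isSymmSndFDerivAt (by simp)).eq _ _

lemma contDiffOn_pd (hU : IsOpen U) (hu : ContDiffOn ℝ ∞ u U) (i : Fin 2) :
    ContDiffOn ℝ ∞ (pd i u) U :=
  (hu.fderiv_of_isOpen hU (by simp)).clm_apply contDiffOn_const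

lemma differentiableAt_of_contDiffOn (hU : IsOpen U) (hu : ContDiffOn ℝ ∞ u U) (hx : x ∈ U) :
    DifferentiableAt ℝ u x :=
  (hu.contDiffAt (hU.mem_nhds hx)).differentiableAt (by simp)

lemma contDiffAt_two_of_contDiffOn (hU : IsOpen U) (hu : ContDiffOn ℝ ∞ u U) (hx : x ∈ U) :
    ContDiffAt ℝ 2 u x :=
  (hu.contDiffAt (hU.mem_nhds hx)).of_le (WithTop.coe_le_coe.2 le_top)

lemma pd_congr_of_eqOn (hU : IsOpen U) (h : ∀ y ∈ U, u y = v y) (hx : x ∈ U) (i : Fin 2) :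
    pd i u x = pd i v x :=
  pd_congr (by filter_upwards [hU.mem_nhds hx] with y hy using h y hy) i

end Calculus

/-! ### Pointwise algebra of the metric. -/

section Metric

open Set Filter

variable {G : Comp2} {x : E2}

lemma ginv_eq (G : Comp2) (x : E2) (a b : Fin 2) : ginv G a b x
    = (detG G x)⁻¹ * !![G 1 1 x, -G 0 1 x; -G 1 0 x, G 0 0 x] a b := by
  have : (Matrix.of fun i j => G i j x) = !![G 0 0 x, G 0 1 x; G 1 0 x, G 1 1 x] := by
    ext i j
    fin_cases i <;> fin_cases j <;> rfl
  simp only [ginv, this, Matrix.inv_def, Matrix.adjugate_fin_two_of, Matrix.det_fin_two_of,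
    Ring.inverse_eq_inv', detG, Matrix.smul_apply, smul_eq_mul]

lemma ginv_zero_zero (G : Comp2) (x : E2) : ginv G 0 0 x = G 1 1 x / detG G x := by
  rw [ginv_eq, div_eq_inv_mul]; rfl

lemma ginv_zero_one (G : Comp2) (x : E2) : ginv G 0 1 x = -G 0 1 x / detG G x := by
  rw [ginv_eq, div_eq_inv_mul]; rfl

lemma ginv_one_zero (G : Comp2) (x : E2) : ginv G 1 0 x = -G 1 0 x / detG G x := by
  rw [ginv_eq, div_eq_inv_mul]; rfl

lemma ginv_one_one (G : Comp2) (x : E2) : ginv G 1 1 x = G 0 0 x / detG G x := by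
  rw [ginv_eq, div_eq_inv_mul]; rfl

/-- `½ (∂_a g_{db} + ∂_b g_{da} - ∂_d g_{ab})`. -/
def christoffelLow (G : Comp2) (d a b : Fin 2) : Comp0 := fun x =>
  (1 / 2) * (pd a (G d b) x + pd b (G d a) x - pd d (G a b) x)

/-- Identities between Christoffel symbols are proved after lowering the index, where the inverse
metric no longer appears and they are polynomial in first derivatives of $g$. -/
lemma sum_metric_mul_christoffel (hdet : detG G x ≠ 0) (d a b : Fin 2) :
    ∑ c, G d c x * christoffel G c a b x = christoffelLow G d a b x := by
  have hi : (G 0 0 x * G 1 1 x - G 0 1 x * G 1 0 x) * (detG G x)⁻¹ = 1 := mul_inv_cancel₀ hdet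
  simp only [christoffel, christoffelLow, Fin.sum_univ_two, ginv_zero_zero, ginv_zero_one,
    ginv_one_zero, ginv_one_one, div_eq_mul_inv _ (detG G x)]
  fin_cases d
  · simp only [Fin.zero_eta]
    linear_combination (1 / 2) * (pd a (G 0 b) x + pd b (G 0 a) x - pd 0 (G a b) x) * hi
  · simp only [Fin.mk_one]
    linear_combination (1 / 2) * (pd a (G 1 b) x + pd b (G 1 a) x - pd 1 (G a b) x) * hi

lemma eq_zero_of_two_by_two {a b c d y z : ℝ} (h : a * d - b * c ≠ 0) (h1 : a * y + b * z = 0)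
    (h2 : c * y + d * z = 0) : y = 0 ∧ z = 0 := by
  constructor
  · have : (a * d - b * c) * y = 0 := by linear_combination d * h1 - b * h2
    exact (mul_eq_zero.1 this).resolve_left h
  · have : (a * d - b * c) * z = 0 := by linear_combination a * h2 - c * h1
    exact (mul_eq_zero.1 this).resolve_left h

/-- A vector is determined by its lowered components. -/
lemma eq_of_metric_mul_eq (hdet : detG G x ≠ 0) {X Y : Fin 2 → ℝ}
    (h : ∀ d, ∑ c, G d c x * X c = ∑ c, G d c x * Y c) : X = Y := by
  simp only [Fin.sum_univ_two] at h
  have := eq_zero_of_two_by_two (y := X 0 - Y 0) (z := X 1 - Y 1) hdet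
    (by linear_combination h 0) (by linear_combination h 1)
  funext c
  fin_cases c
  · exact sub_eq_zero.1 this.1
  · exact sub_eq_zero.1 this.2

lemma trace_metric (hdet : detG G x ≠ 0) (hs : G 1 0 x = G 0 1 x) : trace G G x = 2 := by
  have hi : (G 0 0 x * G 1 1 x - G 0 1 x * G 1 0 x) * (detG G x)⁻¹ = 1 := mul_inv_cancel₀ hdet
  simp only [trace, Fin.sum_univ_two, ginv_zero_zero, ginv_zero_one,
    ginv_one_zero, ginv_one_one, div_eq_mul_inv _ (detG G x)]
  rw [hs] at hi ⊢
  linear_combination 2 * hi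

/-- The factor `ψ` replaces the trace, so tensoriality and conformal covariance can be checked
without differentiating or inverting the metric. The same factor becomes the last unknown of the
prolonged system. -/
lemma traceFree_eq_zero_iff (hdet : detG G x ≠ 0) (hs : G 1 0 x = G 0 1 x) {T : Comp2} :
    (∀ a b, traceFree G T a b x = 0) ↔ ∃ ψ : ℝ, ∀ a b, T a b x = ψ * G a b x := by
  constructor
  · intro h
    exact ⟨1 / 2 * trace G T x, fun a b => sub_eq_zero.1 (h a b)⟩
  · rintro ⟨ψ, h⟩ a b
    have : trace G T x = ψ * trace G G x := by
      simp only [trace, h, Finset.mul_sum]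
      exact Finset.sum_congr rfl fun i _ => Finset.sum_congr rfl fun j _ => by ring
    rw [traceFree, this, trace_metric hdet hs, h]
    ring

/-- `u` lies in the kernel of the conformal-to-Einstein operator at `x`. -/
lemma confEinstein_eq_zero_iff (hdet : detG G x ≠ 0) (hs : G 1 0 x = G 0 1 x) {P : Comp2}
    {u : Comp0} : (∀ a b, confEinstein G P u a b x = 0) ↔
      ∃ ψ : ℝ, ∀ a b, hess G u a b x + P a b x * u x = ψ * G a b x :=
  traceFree_eq_zero_iff hdet hs

end Metric

/-! ### Behaviour of the connection and the Hessian under coordinate changes. -/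

section ChartChange

open Set Filter

variable {G G' : Comp2} {φ : E2 → E2} {x : E2}

/-- The transformation law of the Christoffel symbols under a change of coordinates. -/
lemma christoffel_pullback (hφ : ContDiffAt ℝ ∞ φ x)
    (hG : ∀ a b, DifferentiableAt ℝ (G a b) (φ x))
    (hs : ∀ᶠ y in 𝓝 (φ x), G 1 0 y = G 0 1 y) (hdet : detG G (φ x) ≠ 0)
    (hJ : pd 0 (fun y => φ y 0) x * pd 1 (fun y => φ y 1) x
      - pd 1 (fun y => φ y 0) x * pd 0 (fun y => φ y 1) x ≠ 0)
    (hdet' : detG G' x ≠ 0)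
    (hG' : ∀ i j, G' i j =ᶠ[𝓝 x] fun y => ∑ a, ∑ b, pd i (fun z => φ z a) y
      * pd j (fun z => φ z b) y * G a b (φ y)) (i j c : Fin 2) :
    ∑ k, christoffel G' k i j x * pd k (fun y => φ y c) x
      = ∑ a, ∑ b, pd i (fun y => φ y a) x * pd j (fun y => φ y b) x * christoffel G c a b (φ x)
        + pd i (pd j fun y => φ y c) x := by
  have hφ2 : ∀ a, ContDiffAt ℝ 2 (fun y => φ y a) x := fun a =>
    ((contDiffAt_euclidean.1 hφ) a).of_le (WithTop.coe_le_coe.2 le_top)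
  have hφd : DifferentiableAt ℝ φ x := hφ.differentiableAt (by simp)
  have hGd : ∀ a b k, pd k (fun y => G a b (φ y)) x
      = ∑ e, pd k (fun y => φ y e) x * pd e (G a b) (φ x) := fun a b k => by
    have h1 : HasFDerivAt (fun y => G a b (φ y)) _ x :=
      (hG a b).hasFDerivAt.comp x hφd.hasFDerivAt
    rw [pd, h1.fderiv, ContinuousLinearMap.comp_apply, fderiv_apply_eq_sum_pd]
    simp only [pd_comp_apply hφd]
  have hGc : ∀ a b, DifferentiableAt ℝ (fun y => G a b (φ y)) x := fun a b =>
    (hG a b).comp x hφd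
  have hJd : ∀ i a, DifferentiableAt ℝ (pd i fun y => φ y a) x := fun i a =>
    differentiableAt_pd (hφ2 a) i
  have hdG' : ∀ i j k, pd k (G' i j) x = ∑ a, ∑ b,
      ((pd k (pd i fun z => φ z a) x * pd j (fun z => φ z b) x
        + pd i (fun z => φ z a) x * pd k (pd j fun z => φ z b) x) * G a b (φ x)
        + pd i (fun z => φ z a) x * pd j (fun z => φ z b) x
          * ∑ e, pd k (fun y => φ y e) x * pd e (G a b) (φ x)) := by
    intro i j k
    have hJJ : ∀ a b, DifferentiableAt ℝ
        (fun y => pd i (fun z => φ z a) y * pd j (fun z => φ z b) y) x := fun a b =>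
      (hJd i a).mul (hJd j b)
    have hterm : ∀ a b, DifferentiableAt ℝ
        (fun y => pd i (fun z => φ z a) y * pd j (fun z => φ z b) y * G a b (φ y)) x := fun a b =>
      (hJJ a b).mul (hGc a b)
    rw [pd_congr (hG' i j), pd_fun_sum fun a _ => DifferentiableAt.fun_sum fun b _ => hterm a b]
    refine Finset.sum_congr rfl fun a _ => ?_
    rw [pd_fun_sum fun b _ => hterm a b]
    refine Finset.sum_congr rfl fun b _ => ?_
    rw [pd_fun_mul (hJJ a b) (hGc a b), pd_fun_mul (hJd i a) (hJd j b), hGd]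
  have hs0 := hs.self_of_nhds
  have hs1 : ∀ e, pd e (G 1 0) (φ x) = pd e (G 0 1) (φ x) := fun e => pd_congr hs e
  have hc : ∀ i j a, pd i (pd j fun y => φ y a) x = pd j (pd i fun y => φ y a) x := fun i j a =>
    pd_comm (hφ2 a) i j
  have hG0 : ∀ i j, G' i j x = ∑ a, ∑ b, pd i (fun z => φ z a) x
      * pd j (fun z => φ z b) x * G a b (φ x) := fun i j => (hG' i j).self_of_nhds
  have hlow' := fun l => sum_metric_mul_christoffel hdet' l i j
  have hlow := fun d a b => sum_metric_mul_christoffel (G := G) hdet d a b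
  simp only [christoffelLow, hdG', hG0] at hlow'
  simp only [christoffelLow] at hlow
  have key : (fun c => ∑ k, christoffel G' k i j x * pd k (fun y => φ y c) x)
      = fun c => ∑ a, ∑ b, pd i (fun y => φ y a) x * pd j (fun y => φ y b) x
        * christoffel G c a b (φ x) + pd i (pd j fun y => φ y c) x := by
    -- After lowering with $g$, the difference of the two sides is a covector. Contracted with each
    -- row of the Jacobian it vanishes by the lowered formula for $\Gamma'$, and the Jacobian is
    -- invertible.
    refine eq_of_metric_mul_eq hdet ?_
    have h0 := hlow' 0
    have h1 := hlow' 1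
    have l000 := hlow 0 0 0
    have l001 := hlow 0 0 1
    have l010 := hlow 0 1 0
    have l011 := hlow 0 1 1
    have l100 := hlow 1 0 0
    have l101 := hlow 1 0 1
    have l110 := hlow 1 1 0
    have l111 := hlow 1 1 1
    simp only [Fin.sum_univ_two, hs0, hs1, hc i 0, hc i 1, hc j 0, hc j 1, hc j i]
      at h0 h1 l000 l001 l010 l011 l100 l101 l110 l111
    obtain ⟨e0, e1⟩ := eq_zero_of_two_by_two
      (y := ∑ c, G 0 c (φ x) * ((∑ k, christoffel G' k i j x * pd k (fun y => φ y c) x)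
        - (∑ a, ∑ b, pd i (fun y => φ y a) x * pd j (fun y => φ y b) x
        * christoffel G c a b (φ x) + pd i (pd j fun y => φ y c) x)))
      (z := ∑ c, G 1 c (φ x) * ((∑ k, christoffel G' k i j x * pd k (fun y => φ y c) x)
        - (∑ a, ∑ b, pd i (fun y => φ y a) x * pd j (fun y => φ y b) x
        * christoffel G c a b (φ x) + pd i (pd j fun y => φ y c) x)))
      (a := pd 0 (fun y => φ y 0) x) (b := pd 0 (fun y => φ y 1) x)
      (c := pd 1 (fun y => φ y 0) x) (d := pd 1 (fun y => φ y 1) x)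
      (by rw [mul_comm (pd 0 (fun y => φ y 1) x)]; exact hJ)
      (by
        simp only [Fin.sum_univ_two, hs0]
        linear_combination h0 - pd 0 (fun y => φ y 0) x * pd i (fun y => φ y 0) x * pd j (fun y
          => φ y 0) x * l000 - pd 0 (fun y => φ y 0) x * pd i (fun y => φ y 0) x * pd j (fun
          y => φ y 1) x * l001 - pd 0 (fun y => φ y 0) x * pd i (fun y => φ y 1) x * pd j
          (fun y => φ y 0) x * l010 - pd 0 (fun y => φ y 0) x * pd i (fun y => φ y 1) x * pd
          j (fun y => φ y 1) x * l011 - pd 0 (fun y => φ y 1) x * pd i (fun y => φ y 0) x *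
          pd j (fun y => φ y 0) x * l100 - pd 0 (fun y => φ y 1) x * pd i (fun y => φ y 0) x
          * pd j (fun y => φ y 1) x * l101 - pd 0 (fun y => φ y 1) x * pd i (fun y => φ y 1)
          x * pd j (fun y => φ y 0) x * l110 - pd 0 (fun y => φ y 1) x * pd i (fun y => φ y
          1) x * pd j (fun y => φ y 1) x * l111)
      (by
        simp only [Fin.sum_univ_two, hs0]
        linear_combination h1 - pd 1 (fun y => φ y 0) x * pd i (fun y => φ y 0) x * pd j (fun y
          => φ y 0) x * l000 - pd 1 (fun y => φ y 0) x * pd i (fun y => φ y 0) x * pd j (fun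
          y => φ y 1) x * l001 - pd 1 (fun y => φ y 0) x * pd i (fun y => φ y 1) x * pd j
          (fun y => φ y 0) x * l010 - pd 1 (fun y => φ y 0) x * pd i (fun y => φ y 1) x * pd
          j (fun y => φ y 1) x * l011 - pd 1 (fun y => φ y 1) x * pd i (fun y => φ y 0) x *
          pd j (fun y => φ y 0) x * l100 - pd 1 (fun y => φ y 1) x * pd i (fun y => φ y 0) x
          * pd j (fun y => φ y 1) x * l101 - pd 1 (fun y => φ y 1) x * pd i (fun y => φ y 1)
          x * pd j (fun y => φ y 0) x * l110 - pd 1 (fun y => φ y 1) x * pd i (fun y => φ y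
          1) x * pd j (fun y => φ y 1) x * l111)
    simp only [mul_sub, Finset.sum_sub_distrib] at e0 e1
    intro d
    fin_cases d
    · exact sub_eq_zero.1 e0
    · exact sub_eq_zero.1 e1
  exact congrFun key c

/-- Tensoriality of the Hessian. -/
lemma hess_pullback (hφ : ContDiffAt ℝ ∞ φ x)
    (hG : ∀ a b, DifferentiableAt ℝ (G a b) (φ x))
    (hs : ∀ᶠ y in 𝓝 (φ x), G 1 0 y = G 0 1 y) (hdet : detG G (φ x) ≠ 0)
    (hJ : pd 0 (fun y => φ y 0) x * pd 1 (fun y => φ y 1) x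
      - pd 1 (fun y => φ y 0) x * pd 0 (fun y => φ y 1) x ≠ 0)
    (hdet' : detG G' x ≠ 0)
    (hG' : ∀ i j, G' i j =ᶠ[𝓝 x] fun y => ∑ a, ∑ b, pd i (fun z => φ z a) y
      * pd j (fun z => φ z b) y * G a b (φ y)) {u : Comp0} (hu : ContDiffAt ℝ ∞ u (φ x))
    (i j : Fin 2) : hess G' (fun y => u (φ y)) i j x
      = ∑ a, ∑ b, pd i (fun y => φ y a) x * pd j (fun y => φ y b) x * hess G u a b (φ x) := by
  have hφ1 : ∀ᶠ y in 𝓝 x, DifferentiableAt ℝ φ y := by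
    have h1 : ContDiffAt ℝ 1 φ x := hφ.of_le (WithTop.coe_le_coe.2 le_top)
    filter_upwards [h1.eventually (by simp)] with y hy using hy.differentiableAt (by simp)
  have hu1 : ∀ᶠ y in 𝓝 x, DifferentiableAt ℝ u (φ y) := by
    have h1 : ContDiffAt ℝ 1 u (φ x) := hu.of_le (WithTop.coe_le_coe.2 le_top)
    filter_upwards [hφ.continuousAt.eventually (h1.eventually (by simp))] with y hy
    exact hy.differentiableAt (by simp)
  have hcomp : ∀ {w : Comp0} {y : E2}, DifferentiableAt ℝ φ y → DifferentiableAt ℝ w (φ y) →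
      ∀ i, pd i (fun y => w (φ y)) y = ∑ a, pd i (fun y => φ y a) y * pd a w (φ y) := by
    intro w y h1 h2 i
    have h3 : HasFDerivAt (fun y => w (φ y)) _ y := h2.hasFDerivAt.comp y h1.hasFDerivAt
    rw [pd, h3.fderiv, ContinuousLinearMap.comp_apply, fderiv_apply_eq_sum_pd]
    simp only [pd_comp_apply h1]
  have hpd : ∀ k, pd k (fun y => u (φ y)) =ᶠ[𝓝 x]
      fun y => ∑ a, pd k (fun y => φ y a) y * pd a u (φ y) := fun k => by
    filter_upwards [hφ1, hu1] with y h1 h2 using hcomp h1 h2 k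
  have hJd : ∀ i a, DifferentiableAt ℝ (pd i fun y => φ y a) x := fun i a =>
    differentiableAt_pd (((contDiffAt_euclidean.1 hφ) a).of_le (WithTop.coe_le_coe.2 le_top)) i
  have hud : ∀ a, DifferentiableAt ℝ (pd a u) (φ x) := fun a =>
    differentiableAt_pd (hu.of_le (WithTop.coe_le_coe.2 le_top)) a
  have hud' : ∀ a, DifferentiableAt ℝ (fun y => pd a u (φ y)) x := fun a =>
    (hud a).comp x hφ1.self_of_nhds
  have hchr := christoffel_pullback hφ hG hs hdet hJ hdet' hG' i j
  have h2 : pd i (pd j fun y => u (φ y)) x = ∑ a, (pd i (pd j fun y => φ y a) x * pd a u (φ x)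
      + pd j (fun y => φ y a) x * ∑ b, pd i (fun y => φ y b) x * pd b (pd a u) (φ x)) := by
    rw [pd_congr (hpd j), pd_fun_sum fun a _ => (hJd j a).fun_mul (hud' a)]
    refine Finset.sum_congr rfl fun a _ => ?_
    rw [pd_fun_mul (hJd j a) (hud' a), hcomp hφ1.self_of_nhds (hud a)]
  simp only [hess, nabla1, grad, h2, (hpd _).self_of_nhds, Fin.sum_univ_two] at hchr ⊢
  -- The second derivatives of `φ` from the chain rule are exactly those of the Christoffel law
  -- contracted with $du$.
  linear_combination -pd 0 u (φ x) * hchr 0 - pd 1 u (φ x) * hchr 1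

end ChartChange

/-! ### Conformal covariance of the equation. -/

section Conformal

open Set Filter

variable {G G' : Comp2} {Ω : Comp0} {x : E2}

/-- The transformation law of the Christoffel symbols under `ĝ = Ω² g`. -/
lemma christoffel_rescaling (hG : ∀ a b, DifferentiableAt ℝ (G a b) x)
    (hdet : detG G x ≠ 0) (hΩ : DifferentiableAt ℝ Ω x)
    (hΩ0 : Ω x ≠ 0) (hG' : ∀ a b, G' a b =ᶠ[𝓝 x] fun y => Ω y ^ 2 * G a b y)
    {Υ : Fin 2 → ℝ} (hΥ : ∀ a, pd a Ω x = Ω x * Υ a) (a b c : Fin 2) :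
    christoffel G' c a b x = christoffel G c a b x + (if c = a then Υ b else 0)
      + (if c = b then Υ a else 0) - G a b x * ∑ d, ginv G c d x * Υ d := by
  have hG'0 : ∀ a b, G' a b x = Ω x ^ 2 * G a b x := fun a b => (hG' a b).self_of_nhds
  have hdet' : detG G' x ≠ 0 := by
    have : detG G' x = Ω x ^ 4 * detG G x := by simp only [detG, hG'0]; ring
    rw [this]
    positivity
  have hd : ∀ a b e, pd e (G' a b) x
      = Ω x ^ 2 * (2 * Υ e * G a b x + pd e (G a b) x) := fun a b e => by
    have h1 : pd e (fun y => Ω y ^ 2) x = 2 * Ω x * pd e Ω x := by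
      have := pd_scomp (u := Ω) (f := fun t => t ^ 2) (hasDerivAt_pow 2 (Ω x)) hΩ e
      simpa using this
    rw [pd_congr (hG' a b), pd_fun_mul (hΩ.fun_pow 2) (hG a b), h1, hΥ]
    ring
  have hi : ∀ d, ∑ c, G d c x * ∑ e, ginv G c e x * Υ e = Υ d := fun d => by
    have hi : (G 0 0 x * G 1 1 x - G 0 1 x * G 1 0 x) * (detG G x)⁻¹ = 1 := mul_inv_cancel₀ hdet
    simp only [Fin.sum_univ_two, ginv_zero_zero, ginv_zero_one,
      ginv_one_zero, ginv_one_one, div_eq_mul_inv _ (detG G x)]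
    fin_cases d
    · simp only [Fin.zero_eta]
      linear_combination Υ 0 * hi
    · simp only [Fin.mk_one]
      linear_combination Υ 1 * hi
  have key : (fun c => christoffel G' c a b x) = fun c => christoffel G c a b x
      + (if c = a then Υ b else 0) + (if c = b then Υ a else 0)
      - G a b x * ∑ d, ginv G c d x * Υ d := by
    refine eq_of_metric_mul_eq hdet' fun d => ?_
    have h1 := sum_metric_mul_christoffel hdet' d a b
    have h2 := sum_metric_mul_christoffel hdet d a b
    have h3 := hi d
    have h4 : ∑ c, G d c x * (if c = a then Υ b else 0) = G d a x * Υ b := by simp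
    have h5 : ∑ c, G d c x * (if c = b then Υ a else 0) = G d b x * Υ a := by simp
    rw [h1]
    have h6 : ∑ c, G' d c x * (christoffel G c a b x
        + (if c = a then Υ b else 0) + (if c = b then Υ a else 0)
        - G a b x * ∑ d, ginv G c d x * Υ d) = Ω x ^ 2 * (christoffelLow G d a b x
          + G d a x * Υ b + G d b x * Υ a - G a b x * Υ d) := by
      rw [← h2, ← h3, ← h4, ← h5]
      simp only [Fin.sum_univ_two, hG'0]
      ring
    rw [h6]
    simp only [christoffelLow, hd]
    ring
  exact congrFun key c

/-- Conformal covariance of the conformal-to-Einstein equation. -/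
lemma confEinstein_rescaling {P P' : Comp2} {u : Comp0} (hG : ∀ a b, DifferentiableAt ℝ (G a b) x)
    (hs : ∀ a b, G a b x = G b a x) (hdet : detG G x ≠ 0) (hΩ : ContDiffAt ℝ ∞ Ω x)
    (hΩ0 : ∀ᶠ y in 𝓝 x, 0 < Ω y) (hG' : ∀ a b, G' a b =ᶠ[𝓝 x] fun y => Ω y ^ 2 * G a b y)
    (hP' : ∀ a b, P' a b x = P a b x - nabla1 G (grad fun y => Real.log (Ω y)) a b x
      + grad (fun y => Real.log (Ω y)) a x * grad (fun y => Real.log (Ω y)) b x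
      - (1 / 2) * G a b x * pair G (grad fun y => Real.log (Ω y))
        (grad fun y => Real.log (Ω y)) x)
    (hu : ContDiffAt ℝ ∞ u x) (h : ∀ a b, confEinstein G P u a b x = 0) :
    ∀ a b, confEinstein G' P' (fun y => Ω y * u y) a b x = 0 := by
  have hG'0 : ∀ a b, G' a b x = Ω x ^ 2 * G a b x := fun a b => (hG' a b).self_of_nhds
  have hpos := hΩ0.self_of_nhds
  have hdet' : detG G' x ≠ 0 := by
    have : detG G' x = Ω x ^ 4 * detG G x := by simp only [detG, hG'0]; ring
    rw [this]
    positivity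
  rw [confEinstein_eq_zero_iff hdet (hs 1 0)] at h
  rw [confEinstein_eq_zero_iff hdet' (by rw [hG'0, hG'0, hs 1 0])]
  obtain ⟨ψ, hψ⟩ := h
  have le2 : (2 : WithTop ℕ∞) ≤ ∞ := WithTop.coe_le_coe.2 le_top
  have hΩ2 : ContDiffAt ℝ 2 Ω x := hΩ.of_le le2
  have hu2 : ContDiffAt ℝ 2 u x := hu.of_le le2
  have hΩd := eventually_differentiableAt hΩ2
  have hud := eventually_differentiableAt hu2
  set Υ : Comp1 := grad fun y => Real.log (Ω y) with hΥdef
  have hΥ : ∀ a, pd a Ω =ᶠ[𝓝 x] fun y => Ω y * Υ a y := fun a => by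
    filter_upwards [hΩ0, hΩd] with y h1 h2
    have : Υ a y = (Ω y)⁻¹ * pd a Ω y := pd_scomp (Real.hasDerivAt_log h1.ne') h2 a
    rw [this]
    field_simp
  have hlog : ContDiffAt ℝ 2 (fun y => Real.log (Ω y)) x := hΩ2.log hpos.ne'
  have hΥd : ∀ a, DifferentiableAt ℝ (Υ a) x := fun a => differentiableAt_pd hlog a
  have hw : ∀ b, pd b (fun y => Ω y * u y) =ᶠ[𝓝 x]
      fun y => Ω y * (Υ b y * u y + pd b u y) := fun b => by
    filter_upwards [hΩd, hud, hΥ b] with y h1 h2 h3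
    rw [pd_fun_mul h1 h2, h3]
    ring
  have hww : ∀ a b, pd a (pd b fun y => Ω y * u y) x = Ω x * (Υ a x * (Υ b x * u x + pd b u x)
      + (pd a (Υ b) x * u x + Υ b x * pd a u x + pd a (pd b u) x)) := fun a b => by
    have d1 := differentiableAt_pd hu2 b
    have d2 := hud.self_of_nhds
    have d3 : DifferentiableAt ℝ (fun y => Υ b y * u y + pd b u y) x := ((hΥd b).mul d2).add d1
    rw [pd_congr (hw b), pd_fun_mul hΩd.self_of_nhds d3, pd_fun_add ((hΥd b).fun_mul d2) d1,
      pd_fun_mul (hΥd b) d2, (hΥ a).self_of_nhds]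
    ring
  have hchr := christoffel_rescaling hG hdet hΩd.self_of_nhds hpos.ne' hG'
    (Υ := fun a => Υ a x) (fun a => (hΥ a).self_of_nhds)
  -- The terms $\nabla_a\Upsilon_b$ and $\Upsilon_a\Upsilon_b$ in the Hessian of $\Omega u$ cancel
  -- against those of $\widehat{\mathrm P}$. Only multiples of the metric remain; they are collected
  -- here and divided by $\Omega$, since $\widehat g=\Omega^2g$.
  refine ⟨(ψ + (∑ c, ∑ d, ginv G c d x * Υ d x * (Υ c x * u x + pd c u x))
    - (1 / 2) * pair G Υ Υ x * u x) / Ω x, fun a b => ?_⟩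
  have h1 := hψ a b
  have h2 : hess G' (fun y => Ω y * u y) a b x = Ω x * (hess G u a b x + nabla1 G Υ a b x * u x
      - Υ a x * Υ b x * u x
      + G a b x * ∑ c, ∑ d, ginv G c d x * Υ d x * (Υ c x * u x + pd c u x)) := by
    simp only [hess, nabla1, grad, hww, (hw _).self_of_nhds, hchr]
    have s1 : ∀ c d : Fin 2, ∑ e, (if e = c then Υ d x else 0)
        * (Ω x * (Υ e x * u x + pd e u x)) = Υ d x * (Ω x * (Υ c x * u x + pd c u x)) := by
      intro c d; simp
    have s2 := s1 a b
    have s3 := s1 b a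
    simp only [Fin.sum_univ_two] at s2 s3 ⊢
    linear_combination -s2 - s3
  rw [h2, hP', hG'0]
  field_simp
  linear_combination 2 * h1

end Conformal

/-! ### The kernel as a space of functions in a fixed scale. -/

section Kernel

open Set Filter

lemma confEinstein_congr (G P : Comp2) {u v : Comp0} {x : E2} (h : u =ᶠ[𝓝 x] v) (a b : Fin 2) :
    confEinstein G P u a b x = confEinstein G P v a b x := by
  have h1 : ∀ i, pd i u =ᶠ[𝓝 x] pd i v := fun i => by
    filter_upwards [eventually_eventually_nhds.2 h] with y hy using pd_congr hy i
  have h2 : ∀ i j, hess G u i j x + P i j x * u x = hess G v i j x + P i j x * v x := fun i j => by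
    simp only [hess, nabla1, grad, pd_congr (h1 _), (h1 _).self_of_nhds, h.self_of_nhds]
  simp only [confEinstein, traceFree, trace, h2]

variable {M : Type*} [TopologicalSpace M] [ChartedSpace E2 M] [IsManifold (𝓡 2) ∞ M]

lemma contDiffAt_comp_symm {u : M → ℝ} {e : OpenPartialHomeomorph M E2} (he : e ∈ atlas E2 M)
    {x : E2} (hx : x ∈ e.target) (hu : ContMDiffAt (𝓡 2) 𝓘(ℝ, ℝ) ∞ u (e.symm x)) :
    ContDiffAt ℝ ∞ (fun y => u (e.symm y)) x :=
  contMDiffAt_iff_contDiffAt.1 <| ContMDiffAt.comp x hu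
    (contMDiffAt_symm_of_mem_maximalAtlas (IsManifold.subset_maximalAtlas he) hx)

lemma contMDiffAt_of_comp_symm {u : M → ℝ} {e : OpenPartialHomeomorph M E2} (he : e ∈ atlas E2 M)
    {p : M} (hp : p ∈ e.source) (hu : ContDiffAt ℝ ∞ (fun y => u (e.symm y)) (e p)) :
    ContMDiffAt (𝓡 2) 𝓘(ℝ, ℝ) ∞ u p := by
  have h1 : ContMDiffAt (𝓡 2) 𝓘(ℝ, E2) ∞ e p :=
    contMDiffAt_of_mem_maximalAtlas (IsManifold.subset_maximalAtlas he) hp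
  have h2 := (contMDiffAt_iff_contDiffAt.2 hu).comp p h1
  refine h2.congr_of_eventuallyEq ?_
  filter_upwards [e.open_source.mem_nhds hp] with q hq
  simp [Function.comp, e.left_inv hq]

/-- `u` is a smooth solution near `x` of the conformal-to-Einstein equation in a chart. -/
def ChartSolution (G P : Comp2) (u : Comp0) (x : E2) : Prop :=
  ContDiffAt ℝ ∞ u x ∧ ∀ a b, confEinstein G P u a b x = 0

namespace MoebiusSurface

variable (S : MoebiusSurface M) (g : S.metrics)

/-- The conformal-to-Einstein equation in the scale `g`. -/
def equation : GermCondition M where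
  holds u p := ContMDiffAt (𝓡 2) 𝓘(ℝ, ℝ) ∞ u p ∧ ∀ e ∈ atlas E2 M, p ∈ e.source →
    ∀ a b, confEinstein (S.G g e) (S.P g e) (fun y => u (e.symm y)) a b (e p) = 0
  congr := fun {u v p} h hu => ⟨hu.1.congr_of_eventuallyEq h.symm, fun e he hp a b => by
    rw [← hu.2 e he hp a b]
    refine confEinstein_congr _ _ ?_ a b
    have := e.continuousAt_symm (e.map_source hp)
    rw [ContinuousAt, e.left_inv hp] at this
    exact (this.eventually h).mono fun y hy => hy.symm⟩
  add := fun {u v p} hu hv => ⟨hu.1.add hv.1, fun e he hp a b => by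
    have ht := e.map_source hp
    have le2 : (2 : WithTop ℕ∞) ≤ ∞ := WithTop.coe_le_coe.2 le_top
    have h1 := (contDiffAt_comp_symm he ht (u := u) (by rw [e.left_inv hp]; exact hu.1)).of_le le2
    have h2 := (contDiffAt_comp_symm he ht (u := v) (by rw [e.left_inv hp]; exact hv.1)).of_le le2
    have h3 := confEinstein_add (S.G g e) (S.P g e) h1 h2 a b
    rw [hu.2 e he hp, hv.2 e he hp, add_zero] at h3
    exact h3⟩
  smul := fun {u p} c hu => ⟨contMDiffAt_const.mul hu.1, fun e he hp a b => by
    have ht := e.map_source hp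
    have le2 : (2 : WithTop ℕ∞) ≤ ∞ := WithTop.coe_le_coe.2 le_top
    have h1 := (contDiffAt_comp_symm he ht (u := u) (by rw [e.left_inv hp]; exact hu.1)).of_le le2
    have h3 := confEinstein_smul (S.G g e) (S.P g e) h1 c a b
    rw [hu.2 e he hp, mul_zero] at h3
    exact h3⟩
  zero := fun p => ⟨contMDiffAt_const, fun e he hp a b => by
    have h0 : ∀ i, pd i (fun _ : E2 => (0 : ℝ)) = fun _ => 0 := fun i => funext fun x => pd_const 0 i
    simp [confEinstein, traceFree, trace, hess, nabla1, grad, h0]⟩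

variable {S g}

lemma chartSolution_of_holds {u : M → ℝ} {e : OpenPartialHomeomorph M E2} (he : e ∈ atlas E2 M)
    {x : E2} (hx : x ∈ e.target) (h : (S.equation g).holds u (e.symm x)) :
    ChartSolution (S.G g e) (S.P g e) (fun y => u (e.symm y)) x := by
  refine ⟨contDiffAt_comp_symm he hx h.1, fun a b => ?_⟩
  have := h.2 e he (e.map_target hx) a b
  rwa [e.right_inv hx] at this

/-- The conformal-to-Einstein equation may be checked in one chart. -/
lemma holds_of_chartSolution {u : M → ℝ} {e : OpenPartialHomeomorph M E2} (he : e ∈ atlas E2 M)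
    {p : M} (hp : p ∈ e.source)
    (h : ChartSolution (S.G g e) (S.P g e) (fun y => u (e.symm y)) (e p)) :
    (S.equation g).holds u p := by
  refine ⟨contMDiffAt_of_comp_symm he hp h.1, fun e' he' hp' => ?_⟩
  have hC := S.isMoebiusChart g he
  have hC' := S.isMoebiusChart g he'
  set x := e' p with hx
  have hxt : x ∈ e'.target := e'.map_source hp'
  have hxs : e'.symm x ∈ e.source := by rw [hx, e'.left_inv hp']; exact hp
  set φ := transition e e' with hφdef
  have hφx : φ x = e p := by rw [hφdef, transition, hx, e'.left_inv hp']
  have hφt : φ x ∈ e.target := by rw [hφx]; exact e.map_source hp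
  have hφ : ContDiffAt ℝ ∞ φ x := contDiffAt_transition he he' hxt hxs
  have hev := eventually_mem_target hxt hxs
  have hG' : ∀ i j, S.G g e' i j =ᶠ[𝓝 x] fun y => ∑ a, ∑ b, pd i (fun z => φ z a) y
      * pd j (fun z => φ z b) y * S.G g e a b (φ y) := fun i j => by
    filter_upwards [hev] with y hy using comps_transition _ he he' hy.1 hy.2 i j
  have hP' : ∀ i j, S.P g e' i j x = ∑ a, ∑ b, pd i (fun z => φ z a) x
      * pd j (fun z => φ z b) x * S.P g e a b (φ x) := fun i j =>
    comps_transition _ he he' hxt hxs i j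
  have hG0 := fun i j => (hG' i j).self_of_nhds
  have hs0 := hC.symm_G _ hφt 1 0
  have hdet := (hC.det_pos _ hφt).ne'
  have hdet' := (hC'.det_pos _ hxt).ne'
  -- The Jacobian cannot vanish because $\det g'=J^2\det g$ and $\det g'\neq0$.
  have hJ : pd 0 (fun y => φ y 0) x * pd 1 (fun y => φ y 1) x
      - pd 1 (fun y => φ y 0) x * pd 0 (fun y => φ y 1) x ≠ 0 := by
    intro h0
    refine hdet' ?_
    have : detG (S.G g e') x = (pd 0 (fun y => φ y 0) x * pd 1 (fun y => φ y 1) x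
      - pd 1 (fun y => φ y 0) x * pd 0 (fun y => φ y 1) x) ^ 2 * detG (S.G g e) (φ x) := by
      simp only [detG, hG0, Fin.sum_univ_two, hs0]
      ring
    rw [this, h0]
    ring
  have hsol := h.2
  rw [confEinstein_eq_zero_iff (by rwa [← hφx]) (by rw [← hφx]; exact hs0)] at hsol
  obtain ⟨ψ, hψ⟩ := hsol
  let w : Comp0 := fun z => u (e.symm z)
  have hu' : (fun y => u (e'.symm y)) =ᶠ[𝓝 x] fun y => w (φ y) := by
    filter_upwards [hev] with y hy
    simp only [w, hφdef, transition, e.left_inv hy.2]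
  intro a b
  rw [confEinstein_congr _ _ hu']
  revert a b
  rw [confEinstein_eq_zero_iff hdet' (hC'.symm_G _ hxt 1 0)]
  refine ⟨ψ, fun i j => ?_⟩
  rw [hess_pullback (u := w) hφ (fun a b => differentiableAt_of_contDiffOn hC.isOpen
    (hC.contDiffOn_G a b) hφt) (by
      filter_upwards [hC.isOpen.mem_nhds hφt] with y hy using hC.symm_G y hy 1 0) hdet hJ hdet' hG'
    (by rw [hφx]; exact h.1), hP', hG0]
  rw [← hφx] at hψ
  simp only [Fin.sum_univ_two]
  linear_combination pd i (fun z => φ z 0) x * pd j (fun z => φ z 0) x * hψ 0 0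
    + pd i (fun z => φ z 0) x * pd j (fun z => φ z 1) x * hψ 0 1
    + pd i (fun z => φ z 1) x * pd j (fun z => φ z 0) x * hψ 1 0
    + pd i (fun z => φ z 1) x * pd j (fun z => φ z 1) x * hψ 1 1

lemma isRescaling_unique {g h : Metric M} {Ω Ω' : C^∞⟮𝓡 2, M; ℝ⟯} (hΩ : IsRescaling Ω g h)
    (hΩ' : IsRescaling Ω' g h) (p : M) : Ω p = Ω' p := by
  have hne : (basisVec 0 : E2) ≠ 0 := fun h => by
    have := congrArg (fun v : E2 => v 0) h
    simp [basisVec] at this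
  let v : TangentSpace (𝓡 2) p := basisVec 0
  have h1 := (hΩ.2 p v v).symm.trans (hΩ'.2 p v v)
  have h2 := mul_right_cancel₀ (g.pos p v hne).ne' h1
  exact (sq_eq_sq₀ (hΩ.1 p).le (hΩ'.1 p).le).1 h2

lemma isRescaling_trans {g h k : Metric M} {Ω Ω' : C^∞⟮𝓡 2, M; ℝ⟯} (hΩ : IsRescaling Ω g h)
    (hΩ' : IsRescaling Ω' h k) : IsRescaling (Ω' * Ω) g k := by
  refine ⟨fun p => mul_pos (hΩ'.1 p) (hΩ.1 p), fun p v w => ?_⟩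
  rw [hΩ'.2, hΩ.2]
  change _ = (Ω' p * Ω p) ^ 2 * _
  ring

/-- Solutions rescale to solutions. -/
lemma confEinstein_rescaled {h : S.metrics} {Ω : C^∞⟮𝓡 2, M; ℝ⟯} (hΩ : IsRescaling Ω g.1 h.1)
    {u : M → ℝ} {e : OpenPartialHomeomorph M E2} (he : e ∈ atlas E2 M) {x : E2} (hx : x ∈ e.target)
    (hu : (S.equation g).holds u (e.symm x)) (a b : Fin 2) :
    confEinstein (S.G h e) (S.P h e) (fun y => Ω (e.symm y) * u (e.symm y)) a b x = 0 := by
  have hC := S.isMoebiusChart g he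
  have hs := chartSolution_of_holds he hx hu
  exact confEinstein_rescaling
    (fun a b => differentiableAt_of_contDiffOn hC.isOpen (hC.contDiffOn_G a b) hx)
    (hC.symm_G x hx) (hC.det_pos x hx).ne'
    (contDiffAt_comp_symm he hx (Ω.contMDiff (e.symm x)))
    (Eventually.of_forall fun y => hΩ.1 _)
    (fun a b => Eventually.of_forall fun y => hΩ.2 _ _ _)
    (fun a b => S.rho_rescaling g h Ω hΩ e he x hx a b) hs.1 hs.2 a b

variable (S g)

/-- The kernel of the conformal-to-Einstein operator in terms of functions in the scale `g`. -/
def kernelToSolutions : LinearMap.ker S.operator →ₗ[ℝ] (S.equation g).solutions where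
  toFun σ := ⟨σ.1.1 g, fun p => ⟨(σ.1.1 g).contMDiff p, fun e he hp a b => by
    have h := σ.2
    rw [LinearMap.mem_ker] at h
    have h1 := congrFun (congrFun (congrFun h g) ⟨e, he⟩) ⟨e p, e.map_source hp⟩
    exact congrFun (congrFun h1 a) b⟩⟩
  map_add' _ _ := rfl
  map_smul' _ _ := rfl

lemma exists_isRescaling (h : S.metrics) : ∃ Ω : C^∞⟮𝓡 2, M; ℝ⟯, IsRescaling Ω g.1 h.1 :=
  (S.mem_iff g.1 g.2 h.1).1 h.2

lemma kernelToSolutions_injective : Function.Injective (S.kernelToSolutions g) := by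
  rw [injective_iff_map_eq_zero]
  intro σ hσ
  have h0 : ∀ p, σ.1.1 g p = 0 := fun p => congrFun (congrArg Subtype.val hσ) p
  refine Subtype.ext (Subtype.ext (funext fun h => ?_))
  obtain ⟨Ω, hΩ⟩ := S.exists_isRescaling g h
  ext p
  have := σ.1.2 g h Ω hΩ p
  rw [h0, mul_zero] at this
  exact this

/-- A solution $u$ in the scale $g$ extends to the density $h\mapsto\Omega_hu$ with $h=\Omega_h^2g$.
Conformal factors are unique and compose, which gives the weight law; conformal covariance gives the
equation in every scale. -/
lemma kernelToSolutions_surjective : Function.Surjective (S.kernelToSolutions g) := by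
  intro u
  choose Ω hΩ using S.exists_isRescaling g
  have hu : ContMDiff (𝓡 2) 𝓘(ℝ, ℝ) ∞ u.1 := fun p => (u.2 p).1
  let w : C^∞⟮𝓡 2, M; ℝ⟯ := ⟨u.1, hu⟩
  let σ : S.densities := ⟨fun h => Ω h * w, fun h k Ω' hΩ' p => by
    have h1 := isRescaling_unique (hΩ k) (isRescaling_trans (hΩ h) hΩ') p
    change Ω k p * w p = Ω' p * (Ω h p * w p)
    rw [h1]
    change Ω' p * Ω h p * w p = _
    ring⟩
  have hσ : S.operator σ = 0 := by
    funext h e x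
    ext a b
    exact confEinstein_rescaled (hΩ h) e.2 x.2 (u.2 _) a b
  refine ⟨⟨σ, hσ⟩, Subtype.ext (funext fun p => ?_)⟩
  have h1 : IsRescaling (1 : C^∞⟮𝓡 2, M; ℝ⟯) g.1 g.1 :=
    ⟨fun p => one_pos, fun p v w => by
      change _ = (1 : ℝ) ^ 2 * _
      ring⟩
  have h2 := isRescaling_unique (hΩ g) h1 p
  change Ω g p * u.1 p = u.1 p
  rw [h2]
  exact one_mul _

/-- The kernel of the conformal-to-Einstein operator is the space of solutions in any scale. -/
def kernelEquiv : LinearMap.ker S.operator ≃ₗ[ℝ] (S.equation g).solutions :=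
  LinearEquiv.ofBijective (S.kernelToSolutions g)
    ⟨S.kernelToSolutions_injective g, S.kernelToSolutions_surjective g⟩

end MoebiusSurface

end Kernel

/-! ### Levi-Civita calculus in a chart. -/

section TensorCalculus

open Set Filter

namespace IsMoebiusChart

variable {G P : Comp2} {U : Set E2} (hC : IsMoebiusChart G P U)

include hC

lemma det_ne {x : E2} (hx : x ∈ U) : detG G x ≠ 0 := (hC.det_pos x hx).ne'

lemma contDiffOn_detG : ContDiffOn ℝ ∞ (detG G) U :=
  ((hC.contDiffOn_G 0 0).mul (hC.contDiffOn_G 1 1)).sub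
    ((hC.contDiffOn_G 0 1).mul (hC.contDiffOn_G 1 0))

lemma contDiffOn_ginv (a b : Fin 2) : ContDiffOn ℝ ∞ (ginv G a b) U := by
  have h := hC.contDiffOn_detG
  have h0 := fun x hx => hC.det_ne (x := x) hx
  fin_cases a <;> fin_cases b
  · exact ((hC.contDiffOn_G 1 1).div h h0).congr fun x _ => ginv_zero_zero G x
  · exact ((hC.contDiffOn_G 0 1).neg.div h h0).congr fun x _ => ginv_zero_one G x
  · exact ((hC.contDiffOn_G 1 0).neg.div h h0).congr fun x _ => ginv_one_zero G x
  · exact ((hC.contDiffOn_G 0 0).div h h0).congr fun x _ => ginv_one_one G x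

lemma contDiffOn_christoffel (c a b : Fin 2) : ContDiffOn ℝ ∞ (christoffel G c a b) U := by
  have h := fun a b => contDiffOn_pd hC.isOpen (hC.contDiffOn_G a b)
  exact contDiffOn_const.mul <| ContDiffOn.sum fun d _ => (hC.contDiffOn_ginv c d).mul
    (((h d b a).add (h d a b)).sub (h a b d))

lemma contDiffOn_nabla1 {α : Comp1} (hα : ∀ a, ContDiffOn ℝ ∞ (α a) U) (a b : Fin 2) :
    ContDiffOn ℝ ∞ (nabla1 G α a b) U :=
  (contDiffOn_pd hC.isOpen (hα b) a).sub <| ContDiffOn.sum fun c _ =>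
    (hC.contDiffOn_christoffel c a b).mul (hα c)

lemma contDiffOn_raise {α : Comp1} (hα : ∀ a, ContDiffOn ℝ ∞ (α a) U) (a : Fin 2) :
    ContDiffOn ℝ ∞ (raise G α a) U :=
  ContDiffOn.sum fun b _ => (hC.contDiffOn_ginv a b).mul (hα b)

lemma contDiffOn_pair {α β : Comp1} (hα : ∀ a, ContDiffOn ℝ ∞ (α a) U)
    (hβ : ∀ a, ContDiffOn ℝ ∞ (β a) U) : ContDiffOn ℝ ∞ (pair G α β) U :=
  ContDiffOn.sum fun a _ => (hα a).mul (hC.contDiffOn_raise hβ a)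

lemma contDiffOn_grad {u : Comp0} (hu : ContDiffOn ℝ ∞ u U) (a : Fin 2) :
    ContDiffOn ℝ ∞ (grad u a) U :=
  contDiffOn_pd hC.isOpen hu a

lemma contDiffOn_dirDeriv {α : Comp1} {u : Comp0} (hα : ∀ a, ContDiffOn ℝ ∞ (α a) U)
    (hu : ContDiffOn ℝ ∞ u U) : ContDiffOn ℝ ∞ (dirDeriv G α u) U :=
  hC.contDiffOn_pair (hC.contDiffOn_grad hu) hα

lemma contDiffOn_eval2 {T : Comp2} {α β : Comp1} (hT : ∀ a b, ContDiffOn ℝ ∞ (T a b) U)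
    (hα : ∀ a, ContDiffOn ℝ ∞ (α a) U) (hβ : ∀ a, ContDiffOn ℝ ∞ (β a) U) :
    ContDiffOn ℝ ∞ (eval2 G T α β) U :=
  ContDiffOn.sum fun a _ => ContDiffOn.sum fun b _ =>
    ((hT a b).mul (hC.contDiffOn_raise hα a)).mul (hC.contDiffOn_raise hβ b)

lemma contDiffOn_trace {T : Comp2} (hT : ∀ a b, ContDiffOn ℝ ∞ (T a b) U) :
    ContDiffOn ℝ ∞ (trace G T) U :=
  ContDiffOn.sum fun a _ => ContDiffOn.sum fun b _ => (hC.contDiffOn_ginv a b).mul (hT a b)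

lemma contDiffOn_divergence {α : Comp1} (hα : ∀ a, ContDiffOn ℝ ∞ (α a) U) :
    ContDiffOn ℝ ∞ (divergence G α) U :=
  hC.contDiffOn_trace (hC.contDiffOn_nabla1 hα)

lemma contDiffOn_sqrt_det : ContDiffOn ℝ ∞ (fun x => Real.sqrt (detG G x)) U :=
  hC.contDiffOn_detG.sqrt fun _ hx => hC.det_ne hx

lemma contDiffOn_vol (a b : Fin 2) : ContDiffOn ℝ ∞ (vol G a b) U :=
  hC.contDiffOn_sqrt_det.mul contDiffOn_const

lemma contDiffOn_cotton (a b c : Fin 2) : ContDiffOn ℝ ∞ (cotton G P a b c) U := by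
  have h : ∀ a b c, ContDiffOn ℝ ∞ (nabla2 G P a b c) U := fun a b c =>
    ((contDiffOn_pd hC.isOpen (hC.contDiffOn_P b c) a).sub
      (ContDiffOn.sum fun d _ => (hC.contDiffOn_christoffel d a b).mul (hC.contDiffOn_P d c))).sub
      (ContDiffOn.sum fun d _ => (hC.contDiffOn_christoffel d a c).mul (hC.contDiffOn_P b d))
  exact (h a b c).sub (h b a c)

lemma contDiffOn_Y (c : Fin 2) : ContDiffOn ℝ ∞ (Yform G P c) U :=
  ContDiffOn.sum fun a _ => ContDiffOn.sum fun b _ => (ContDiffOn.sum fun c _ =>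
    ContDiffOn.sum fun d _ => ((hC.contDiffOn_ginv a c).mul (hC.contDiffOn_ginv b d)).mul
      (hC.contDiffOn_vol c d)).mul (hC.contDiffOn_cotton a b c)

lemma contDiffOn_U (a : Fin 2) : ContDiffOn ℝ ∞ (Uform G P a) U :=
  ContDiffOn.sum fun c _ => (hC.contDiffOn_vol a c).mul (hC.contDiffOn_raise hC.contDiffOn_Y c)

lemma contDiffOn_mu : ContDiffOn ℝ ∞ (muScalar G P) U :=
  (hC.contDiffOn_divergence hC.contDiffOn_Y).div_const 2

lemma contDiffOn_phi : ContDiffOn ℝ ∞ (phiScalar G P) U :=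
  (hC.contDiffOn_divergence hC.contDiffOn_U).div_const 2

lemma contDiffOn_V (d : Fin 2) : ContDiffOn ℝ ∞ (Vform G P d) U :=
  ((ContDiffOn.sum fun e _ => (hC.contDiffOn_raise hC.contDiffOn_U e).mul
    (hC.contDiffOn_nabla1 hC.contDiffOn_Y e d)).add (hC.contDiffOn_mu.mul (hC.contDiffOn_U d))).sub
    ((contDiffOn_const.mul hC.contDiffOn_phi).mul (hC.contDiffOn_Y d))

lemma contDiffOn_UV : ContDiffOn ℝ ∞ (UV G P) U :=
  hC.contDiffOn_pair hC.contDiffOn_U hC.contDiffOn_V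

lemma contDiffOn_k : ContDiffOn ℝ ∞ (kScalar G P) U :=
  ((hC.contDiffOn_eval2 hC.contDiffOn_P hC.contDiffOn_U hC.contDiffOn_Y).sub
    (hC.contDiffOn_dirDeriv hC.contDiffOn_U hC.contDiffOn_mu)).add
    ((contDiffOn_const.mul hC.contDiffOn_phi).mul hC.contDiffOn_mu)

lemma contDiffOn_K (h : ∀ x ∈ U, UV G P x ≠ 0) (a : Fin 2) : ContDiffOn ℝ ∞ (Kform G P a) U :=
  ((hC.contDiffOn_mu.mul (ContDiffOn.sum fun c _ => (hC.contDiffOn_vol a c).mul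
    (hC.contDiffOn_raise hC.contDiffOn_V c))).add (hC.contDiffOn_k.mul (hC.contDiffOn_U a))).div
    hC.contDiffOn_UV h

lemma contDiffOn_rho : ContDiffOn ℝ ∞ (rhoScalar G P) U :=
  hC.contDiffOn_pair hC.contDiffOn_Y hC.contDiffOn_Y

/-! Pointwise identities. -/

variable {x : E2} (hx : x ∈ U)

include hx

lemma ginv_symm (a b : Fin 2) : ginv G a b x = ginv G b a x := by
  have := hC.symm_G x hx 0 1
  fin_cases a <;> fin_cases b <;> simp [ginv_zero_one, ginv_one_zero, this]

lemma christoffel_symm (c a b : Fin 2) : christoffel G c a b x = christoffel G c b a x := by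
  have h : ∀ d, pd d (G a b) x = pd d (G b a) x := fun d =>
    pd_congr_of_eqOn hC.isOpen (fun y hy => hC.symm_G y hy a b) hx d
  simp only [christoffel, h]
  congr 1
  exact Finset.sum_congr rfl fun d _ => by ring

/-- The Levi-Civita connection is metric. -/
lemma pd_metric (c a b : Fin 2) : pd c (G a b) x
    = ∑ d, christoffel G d c a x * G d b x + ∑ d, christoffel G d c b x * G a d x := by
  have h := fun d a b => sum_metric_mul_christoffel (hC.det_ne hx) d a b
  have hs : ∀ a b d, pd d (G a b) x = pd d (G b a) x := fun a b d =>
    pd_congr_of_eqOn hC.isOpen (fun y hy => hC.symm_G y hy a b) hx d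
  have h1 : ∑ d, christoffel G d c a x * G d b x = christoffelLow G b c a x := by
    rw [← h]
    exact Finset.sum_congr rfl fun d _ => by rw [hC.symm_G x hx d b]; ring
  have h2 : ∑ d, christoffel G d c b x * G a d x = christoffelLow G a c b x := by
    rw [← h]
    exact Finset.sum_congr rfl fun d _ => by ring
  rw [h1, h2]
  simp only [christoffelLow]
  rw [hs b a c, hs c b a, hs c a b]
  ring

lemma sum_metric_mul_raise (α : Comp1) (a : Fin 2) : ∑ c, G a c x * raise G α c x = α a x := by
  have hi : (G 0 0 x * G 1 1 x - G 0 1 x * G 1 0 x) * (detG G x)⁻¹ = 1 :=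
    mul_inv_cancel₀ (hC.det_ne hx)
  simp only [raise, Fin.sum_univ_two, ginv_zero_zero, ginv_zero_one,
    ginv_one_zero, ginv_one_one, div_eq_mul_inv _ (detG G x)]
  fin_cases a
  · simp only [Fin.zero_eta]
    linear_combination α 0 x * hi
  · simp only [Fin.mk_one]
    linear_combination α 1 x * hi

lemma pair_comm (α β : Comp1) : pair G α β x = pair G β α x := by
  have := hC.ginv_symm hx 0 1
  simp only [pair, raise, Fin.sum_univ_two, this]
  ring

/-- Covariant differentiation commutes with raising an index because the metric is parallel.
Differentiating $g_{dc}\alpha^c=\alpha_d$ avoids differentiating the inverse metric. -/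
lemma pd_raise {α : Comp1} (hα : ∀ a, ContDiffOn ℝ ∞ (α a) U) (e c : Fin 2) :
    pd e (raise G α c) x
      = raise G (nabla1 G α e) c x - ∑ m, christoffel G c e m x * raise G α m x := by
  have hd : ∀ a, DifferentiableAt ℝ (raise G α a) x := fun a =>
    differentiableAt_of_contDiffOn hC.isOpen (hC.contDiffOn_raise hα a) hx
  have hG : ∀ a b, DifferentiableAt ℝ (G a b) x := fun a b =>
    differentiableAt_of_contDiffOn hC.isOpen (hC.contDiffOn_G a b) hx
  have key : (fun c => pd e (raise G α c) x)
      = fun c => raise G (nabla1 G α e) c x - ∑ m, christoffel G c e m x * raise G α m x := by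
    refine eq_of_metric_mul_eq (hC.det_ne hx) fun d => ?_
    have h1 : pd e (fun y => ∑ c, G d c y * raise G α c y) x = pd e (α d) x :=
      pd_congr_of_eqOn hC.isOpen (fun y hy => hC.sum_metric_mul_raise hy α d) hx e
    rw [pd_fun_sum fun c _ => (hG d c).fun_mul (hd c)] at h1
    simp only [pd_fun_mul (hG d _) (hd _), Fin.sum_univ_two] at h1
    have h2 := hC.sum_metric_mul_raise hx (nabla1 G α e) d
    have h3 := hC.sum_metric_mul_raise hx α 0
    have h4 := hC.sum_metric_mul_raise hx α 1
    have h5 := hC.pd_metric hx e d 0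
    have h6 := hC.pd_metric hx e d 1
    have e2 : nabla1 G α e d x = pd e (α d) x - (christoffel G 0 e d x * α 0 x
      + christoffel G 1 e d x * α 1 x) := by simp [nabla1]
    simp only [Fin.sum_univ_two] at h2 h3 h4 h5 h6 ⊢
    rw [e2, ← h3, ← h4] at h2
    linear_combination h1 - h2 - raise G α 0 x * h5 - raise G α 1 x * h6
  exact congrFun key c

lemma pd_pair {α β : Comp1} (hα : ∀ a, ContDiffOn ℝ ∞ (α a) U)
    (hβ : ∀ a, ContDiffOn ℝ ∞ (β a) U) (e : Fin 2) :
    pd e (pair G α β) x = pair G (nabla1 G α e) β x + pair G α (nabla1 G β e) x := by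
  have h1 : ∀ a, DifferentiableAt ℝ (raise G β a) x := fun a =>
    differentiableAt_of_contDiffOn hC.isOpen (hC.contDiffOn_raise hβ a) hx
  have h2 : ∀ a, DifferentiableAt ℝ (α a) x := fun a =>
    differentiableAt_of_contDiffOn hC.isOpen (hα a) hx
  have h3 : pd e (pair G α β) x = ∑ a, (pd e (α a) x * raise G β a x
      + α a x * pd e (raise G β a) x) := by
    change pd e (fun y => ∑ a, α a y * raise G β a y) x = _
    rw [pd_fun_sum fun a _ => (h2 a).fun_mul (h1 a)]
    exact Finset.sum_congr rfl fun a _ => pd_fun_mul (h2 a) (h1 a) e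
  rw [h3]
  simp only [hC.pd_raise hx hβ]
  simp only [pair, nabla1, Fin.sum_univ_two]
  ring

lemma divergence_eq {α : Comp1} (hα : ∀ a, ContDiffOn ℝ ∞ (α a) U) : divergence G α x
    = ∑ a, (pd a (raise G α a) x + ∑ m, christoffel G a a m x * raise G α m x) := by
  simp only [hC.pd_raise hx hα, sub_add_cancel]
  rfl

lemma sqrt_det_pos : 0 < Real.sqrt (detG G x) := Real.sqrt_pos.2 (hC.det_pos x hx)

lemma sq_sqrt_det : Real.sqrt (detG G x) ^ 2 = detG G x := Real.sq_sqrt (hC.det_pos x hx).le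

/-- The volume form is parallel: metricity expresses the derivative of $\det g$ through the
contracted Christoffel symbol. -/
lemma pd_sqrt_det (e : Fin 2) : pd e (fun y => Real.sqrt (detG G y)) x
    = Real.sqrt (detG G x) * ∑ c, christoffel G c e c x := by
  have hG : ∀ a b, DifferentiableAt ℝ (G a b) x := fun a b =>
    differentiableAt_of_contDiffOn hC.isOpen (hC.contDiffOn_G a b) hx
  have h1 : pd e (detG G) x = 2 * detG G x * ∑ c, christoffel G c e c x := by
    have h2 : pd e (detG G) x = pd e (G 0 0) x * G 1 1 x + G 0 0 x * pd e (G 1 1) x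
        - (pd e (G 0 1) x * G 1 0 x + G 0 1 x * pd e (G 1 0) x) := by
      change pd e (fun y => G 0 0 y * G 1 1 y - G 0 1 y * G 1 0 y) x = _
      rw [pd_fun_sub ((hG 0 0).fun_mul (hG 1 1)) ((hG 0 1).fun_mul (hG 1 0)),
        pd_fun_mul (hG 0 0) (hG 1 1), pd_fun_mul (hG 0 1) (hG 1 0)]
    rw [h2]
    simp only [hC.pd_metric hx, Fin.sum_univ_two, detG, hC.symm_G x hx 1 0]
    ring
  have hd : DifferentiableAt ℝ (detG G) x :=
    differentiableAt_of_contDiffOn hC.isOpen hC.contDiffOn_detG hx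
  have h3 := pd_scomp (Real.hasDerivAt_sqrt (hC.det_ne hx)) hd e
  rw [h3, h1]
  have h4 := hC.sqrt_det_pos hx
  have h5 := hC.sq_sqrt_det hx
  field_simp
  rw [h5]

/-- Metricity expresses both mixed second derivatives of $g_{dc}$ through $\Gamma$; their equality
is this identity. -/
lemma riem_lower_antisymm (d c : Fin 2) :
    ∑ m, G d m x * riem G m c 0 1 x + ∑ m, G c m x * riem G m d 0 1 x = 0 := by
  have hG : ∀ a b, DifferentiableAt ℝ (G a b) x := fun a b =>
    differentiableAt_of_contDiffOn hC.isOpen (hC.contDiffOn_G a b) hx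
  have hΓ : ∀ c a b, DifferentiableAt ℝ (christoffel G c a b) x := fun c a b =>
    differentiableAt_of_contDiffOn hC.isOpen (hC.contDiffOn_christoffel c a b) hx
  have hcomm := pd_comm (contDiffAt_two_of_contDiffOn hC.isOpen (hC.contDiffOn_G d c) hx) 0 1
  have h2 : ∀ e a, pd e (pd a (G d c)) x
      = ∑ m, (pd e (christoffel G m a d) x * G m c x + christoffel G m a d x * pd e (G m c) x)
      + ∑ m, (pd e (christoffel G m a c) x * G d m x + christoffel G m a c x * pd e (G d m) x) := by
    intro e a
    have h3 : pd e (pd a (G d c)) x = pd e (fun y => ∑ m, christoffel G m a d y * G m c y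
        + ∑ m, christoffel G m a c y * G d m y) x :=
      pd_congr_of_eqOn hC.isOpen (fun y hy => hC.pd_metric hy a d c) hx e
    rw [h3, pd_fun_add (DifferentiableAt.fun_sum fun m _ => (hΓ m a d).fun_mul (hG m c))
      (DifferentiableAt.fun_sum fun m _ => (hΓ m a c).fun_mul (hG d m)),
      pd_fun_sum fun m _ => (hΓ m a d).fun_mul (hG m c),
      pd_fun_sum fun m _ => (hΓ m a c).fun_mul (hG d m)]
    simp only [pd_fun_mul (hΓ _ _ _) (hG _ _)]
  rw [h2, h2] at hcomm
  have s := fun i j => hC.symm_G x hx i j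
  simp only [hC.pd_metric hx, Fin.sum_univ_two] at hcomm
  simp only [riem, Fin.sum_univ_two]
  have s10 := s 1 0
  fin_cases d <;> fin_cases c <;> simp only [Fin.zero_eta, Fin.mk_one, s10] at hcomm ⊢ <;>
    linear_combination hcomm

end IsMoebiusChart

end TensorCalculus

/-! ### The prolonged linear system and its curvature. -/

section Tractor

open Set Filter

/-- The prolongation of the conformal-to-Einstein equation to a linear system for
`(σ, ∇₀σ, ∇₁σ, ψ)`. -/
def tractor (G P : Comp2) (i : Fin 2) : Fin 4 → Fin 4 → Comp0 :=
  ![![fun _ => 0, fun _ => if i = 0 then 1 else 0, fun _ => if i = 1 then 1 else 0, fun _ => 0],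
    ![fun x => -P i 0 x, christoffel G 0 i 0, christoffel G 1 i 0, G i 0],
    ![fun x => -P i 1 x, christoffel G 0 i 1, christoffel G 1 i 1, G i 1],
    ![fun x => (1 / 2) * Uform G P i x, fun x => -raise G (P i) 0 x, fun x => -raise G (P i) 1 x,
      fun _ => 0]]

/-- The curvature of the prolonged system. -/
def tractorCurvature (G P : Comp2) (j k : Fin 4) : Comp0 := fun x =>
  (pd 0 (tractor G P 1 j k) x + ∑ m, tractor G P 1 j m x * tractor G P 0 m k x)
    - (pd 1 (tractor G P 0 j k) x + ∑ m, tractor G P 0 j m x * tractor G P 1 m k x)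

/-- The integrability condition of one equation of a linear system. -/
lemma integrability {d : ℕ} {a : Fin 2 → Fin d → Fin d → Comp0} {W : Fin d → Comp0} {x : E2}
    {j : Fin d} (hW : ∀ k, DifferentiableAt ℝ (W k) x)
    (ha : ∀ i k, DifferentiableAt ℝ (a i j k) x) (hj : ContDiffAt ℝ 2 (W j) x)
    (h : ∀ᶠ y in 𝓝 x, ∀ i, pd i (W j) y = ∑ k, a i j k y * W k y) :
    ∑ k, (pd 0 (a 1 j k) x * W k x + a 1 j k x * pd 0 (W k) x)
      = ∑ k, (pd 1 (a 0 j k) x * W k x + a 0 j k x * pd 1 (W k) x) := by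
  have h1 : ∀ e i, pd e (pd i (W j)) x
      = ∑ k, (pd e (a i j k) x * W k x + a i j k x * pd e (W k) x) := by
    intro e i
    rw [pd_congr (v := fun y => ∑ k, a i j k y * W k y) (h.mono fun y hy => hy i) e,
      pd_fun_sum fun k _ => (ha i k).fun_mul (hW k)]
    exact Finset.sum_congr rfl fun k _ => pd_fun_mul (ha i k) (hW k) e
  rw [← h1, ← h1]
  exact pd_comm hj 0 1

namespace IsMoebiusChart

variable {G P : Comp2} {U : Set E2} (hC : IsMoebiusChart G P U)

include hC

lemma contDiffOn_tractor (i : Fin 2) (j k : Fin 4) : ContDiffOn ℝ ∞ (tractor G P i j k) U := by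
  have hr := fun c => (hC.contDiffOn_raise (hC.contDiffOn_P i) c).neg
  fin_cases j <;> fin_cases k
  · exact contDiffOn_const
  · exact contDiffOn_const
  · exact contDiffOn_const
  · exact contDiffOn_const
  · exact (hC.contDiffOn_P i 0).neg
  · exact hC.contDiffOn_christoffel 0 i 0
  · exact hC.contDiffOn_christoffel 1 i 0
  · exact hC.contDiffOn_G i 0
  · exact (hC.contDiffOn_P i 1).neg
  · exact hC.contDiffOn_christoffel 0 i 1
  · exact hC.contDiffOn_christoffel 1 i 1
  · exact hC.contDiffOn_G i 1
  · exact contDiffOn_const.mul (hC.contDiffOn_U i)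
  · exact hr 0
  · exact hr 1
  · exact contDiffOn_const

variable {x : E2} (hx : x ∈ U)

include hx

lemma sum_raise_rho_eq_gaussCurv : ∑ c, raise G (P c) c x = gaussCurv G x := by
  rw [← hC.trace_P x hx]
  rfl

/-- In dimension two the curvature is determined by the Gauss curvature. -/
lemma riem_eq (d b : Fin 2) : riem G d b 0 1 x
    = gaussCurv G x * ((if d = 0 then G 1 b x else 0) - (if d = 1 then G 0 b x else 0)) := by
  have hi : (G 0 0 x * G 1 1 x - G 0 1 x * G 1 0 x) * (detG G x)⁻¹ = 1 :=
    mul_inv_cancel₀ (hC.det_ne hx)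
  have h00 := hC.riem_lower_antisymm hx 0 0
  have h01 := hC.riem_lower_antisymm hx 0 1
  have h11 := hC.riem_lower_antisymm hx 1 1
  have hs := hC.symm_G x hx 1 0
  have hK : gaussCurv G x = (1 / 2) * (ginv G 1 0 x * riem G 0 0 0 1 x
      + ginv G 1 1 x * riem G 0 1 0 1 x - ginv G 0 0 x * riem G 1 0 0 1 x
      - ginv G 0 1 x * riem G 1 1 0 1 x) := by
    have hr : ∀ a c, riem G a c 0 0 x = 0 := fun a c => by simp [riem]
    have hr' : ∀ a c, riem G a c 1 1 x = 0 := fun a c => by simp [riem]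
    have hr1 : ∀ a c, riem G a c 1 0 x = -riem G a c 0 1 x := fun a c => by
      simp only [riem]
      ring
    simp only [gaussCurv, scalarCurv, Fin.sum_univ_two, hr, hr', hr1]
    ring
  have key : ∀ b, (fun d => riem G d b 0 1 x) = fun d => gaussCurv G x
      * ((if d = 0 then G 1 b x else 0) - (if d = 1 then G 0 b x else 0)) := by
    simp only [Fin.sum_univ_two] at h00 h01 h11
    simp only [ginv_zero_zero, ginv_zero_one, ginv_one_zero, ginv_one_one,
      div_eq_mul_inv _ (detG G x)] at hK
    rw [hs] at hK hi h01 h11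
    set L := G 0 0 x * riem G 0 1 0 1 x + G 0 1 x * riem G 1 1 0 1 x with hL
    have hKL : gaussCurv G x = L * (detG G x)⁻¹ := by
      rw [hK, hL]
      linear_combination (-1 / 2 * (detG G x)⁻¹) * h01
    have hKd : gaussCurv G x * (G 0 0 x * G 1 1 x - G 0 1 x * G 0 1 x) = L := by
      rw [hKL]
      linear_combination L * hi
    intro b
    refine eq_of_metric_mul_eq (hC.det_ne hx) fun d => ?_
    simp only [Fin.sum_univ_two, Fin.isValue, if_true, zero_ne_one, one_ne_zero, if_false]
    fin_cases b <;> fin_cases d <;> simp only [Fin.zero_eta, Fin.mk_one, hs]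
    · linear_combination h00 / 2
    · linear_combination h01 + hKd
    · linear_combination -hKd
    · linear_combination h11 / 2
  exact congrFun (key b) d

/-- A tensor antisymmetric in two indices has one component there in dimension two. The half comes
from the contraction with $\varepsilon^{ab}$, which counts that component twice. -/
lemma cotton_zero_one (c : Fin 2) :
    cotton G P 0 1 c x = (1 / 2) * Real.sqrt (detG G x) * Yform G P c x := by
  have hi : (G 0 0 x * G 1 1 x - G 0 1 x * G 1 0 x) * (detG G x)⁻¹ = 1 :=
    mul_inv_cancel₀ (hC.det_ne hx)
  have hs := hC.sq_sqrt_det hx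
  have hsi : Real.sqrt (detG G x) ^ 2 * (detG G x)⁻¹ = 1 := by
    rw [hs]
    exact mul_inv_cancel₀ (hC.det_ne hx)
  have h1 : cotton G P 1 0 c x = -cotton G P 0 1 c x := by
    simp only [cotton]
    ring
  have h2 : ∀ i, cotton G P i i c x = 0 := fun i => by
    simp only [cotton, sub_self]
  have h3 : volUp G 0 1 x = Real.sqrt (detG G x) * (detG G x)⁻¹ := by
    simp only [volUp, vol, Fin.sum_univ_two, ginv_zero_zero, ginv_zero_one, ginv_one_zero,
      ginv_one_one, div_eq_mul_inv _ (detG G x)]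
    simp
    linear_combination (Real.sqrt (detG G x) * (detG G x)⁻¹) * hi
  have h4 : volUp G 1 0 x = -(Real.sqrt (detG G x) * (detG G x)⁻¹) := by
    simp only [volUp, vol, Fin.sum_univ_two, ginv_zero_zero, ginv_zero_one, ginv_one_zero,
      ginv_one_one, div_eq_mul_inv _ (detG G x)]
    simp
    linear_combination -(Real.sqrt (detG G x) * (detG G x)⁻¹) * hi
  simp only [Yform, Fin.sum_univ_two, h1, h2, h3, h4]
  linear_combination -cotton G P 0 1 c x * hsi

omit hC hx in
lemma U_zero (G P : Comp2) (x : E2) :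
    Uform G P 0 x = Real.sqrt (detG G x) * raise G (Yform G P) 1 x := by
  simp [Uform, vol]

omit hC hx in
lemma U_one (G P : Comp2) (x : E2) :
    Uform G P 1 x = -(Real.sqrt (detG G x) * raise G (Yform G P) 0 x) := by
  simp [Uform, vol]

/-- $U$ is the Hodge dual of $Y$, so its exterior derivative is minus the divergence $2\mu$ of $Y$
times the volume form. -/
lemma pd_U : pd 0 (Uform G P 1) x - pd 1 (Uform G P 0) x
    = -(2 * Real.sqrt (detG G x) * muScalar G P x) := by
  have hs : DifferentiableAt ℝ (fun y => Real.sqrt (detG G y)) x :=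
    differentiableAt_of_contDiffOn hC.isOpen hC.contDiffOn_sqrt_det hx
  have hY : ∀ a, DifferentiableAt ℝ (raise G (Yform G P) a) x := fun a =>
    differentiableAt_of_contDiffOn hC.isOpen (hC.contDiffOn_raise hC.contDiffOn_Y a) hx
  have h0 := pd_fun_mul hs (hY 1) 1
  have h1 := pd_fun_mul hs (hY 0) 0
  have e0 : Uform G P 0 = fun y => Real.sqrt (detG G y) * raise G (Yform G P) 1 y :=
    funext (U_zero G P)
  have e1 : Uform G P 1 = fun y => -(Real.sqrt (detG G y) * raise G (Yform G P) 0 y) :=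
    funext (U_one G P)
  rw [e0, e1, pd_fun_neg, h0, h1, hC.pd_sqrt_det hx, hC.pd_sqrt_det hx, muScalar,
    hC.divergence_eq hx hC.contDiffOn_Y]
  simp only [Fin.sum_univ_two, hC.christoffel_symm hx _ 1 0]
  ring


lemma tractorCurvature_zero (k : Fin 4) : tractorCurvature G P 0 k x = 0 := by
  have hP := hC.symm_P x hx 1 0
  have hG := hC.symm_G x hx 1 0
  have h0 := hC.christoffel_symm hx 0 1 0
  have h1 := hC.christoffel_symm hx 1 1 0
  simp only [tractorCurvature, tractor, Fin.sum_univ_four]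
  fin_cases k <;> simp [pd_const, hP, hG, h0, h1]

/-- In the $\sigma$ column the Cotton tensor cancels against the entry $\tfrac12U_i$ of the last
row, which was chosen for this. In the gradient columns Riemann cancels against $\mathrm P$ because
$\operatorname{tr}\mathrm P=K$, and the $\psi$ column is metricity. -/
lemma tractorCurvature_one (b : Fin 2) (k : Fin 4) :
    tractorCurvature G P (if b = 0 then 1 else 2) k x = 0 := by
  have hc := hC.cotton_zero_one hx
  have hR := fun d b => hC.riem_eq hx d b
  have hK := hC.sum_raise_rho_eq_gaussCurv hx
  have h0 := hC.christoffel_symm hx 0 1 0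
  have h1 := hC.christoffel_symm hx 1 1 0
  have hY := hC.sum_metric_mul_raise hx (Yform G P)
  have hP := fun c => hC.sum_metric_mul_raise hx (P c)
  have hPs := hC.symm_P x hx 1 0
  have hGs := hC.symm_G x hx 1 0
  have hG0 := fun b => hC.pd_metric hx 0 1 b
  have hG1 := fun b => hC.pd_metric hx 1 0 b
  have hn : ∀ i b, pd i (fun y => -P i b y) x = -pd i (P i b) x := fun i b => pd_fun_neg i
  simp only [cotton, nabla2, riem, Fin.sum_univ_two, Fin.forall_fin_two, hGs, hPs, h0, h1,
    Fin.isValue, if_true, zero_ne_one, one_ne_zero, if_false] at hK hY hP hG0 hG1 hc hR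
  simp only [tractorCurvature, tractor, Fin.sum_univ_four]
  fin_cases b <;> fin_cases k <;>
    simp [pd_fun_neg, U_zero, U_one, hGs, hPs, h0, h1]
  · linear_combination -hc.1 + 1 / 2 * Real.sqrt (detG G x) * hY.1
  · linear_combination hR.1.1 + hP.2.1 - G 0 1 x * hK
  · linear_combination hR.2.1 - hP.1.1 + G 0 0 x * hK
  · linear_combination hG0.1 - hG1.1
  · linear_combination -hc.2 + 1 / 2 * Real.sqrt (detG G x) * hY.2
  · linear_combination hR.1.2 + hP.2.2 - G 1 1 x * hK
  · linear_combination hR.2.2 - hP.1.2 + G 0 1 x * hK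
  · linear_combination hG0.2 - hG1.2

/-- The only curvature of the prolongation: $dU$ contributes $\mu$, the Cotton tensor of the raised
$\mathrm P$ contributes $Y^a$, and the $\psi$ column vanishes by symmetry of $\mathrm P$. -/
lemma tractorCurvature_three (k : Fin 4) : tractorCurvature G P 3 k x
    = -(Real.sqrt (detG G x) * ![muScalar G P x, raise G (Yform G P) 0 x,
      raise G (Yform G P) 1 x, 0] k) := by
  have hc := hC.cotton_zero_one hx
  have h0 := hC.christoffel_symm hx 0 1 0
  have h1 := hC.christoffel_symm hx 1 1 0
  have hP := fun c => hC.sum_metric_mul_raise hx (P c)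
  have hPs := hC.symm_P x hx 1 0
  have hGs := hC.symm_G x hx 1 0
  have hgs := hC.ginv_symm hx 1 0
  have hU := hC.pd_U hx
  have hr := fun i e c => hC.pd_raise hx (hC.contDiffOn_P i) e c
  have hd : ∀ i, DifferentiableAt ℝ (Uform G P i) x := fun i =>
    differentiableAt_of_contDiffOn hC.isOpen (hC.contDiffOn_U i) hx
  have hp : ∀ i, pd i (fun y => 1 / 2 * Uform G P (1 - i) y) x = 1 / 2 * pd i (Uform G P (1 - i)) x :=
    fun i => by rw [pd_fun_mul (differentiableAt_const _) (hd _), pd_const]; ring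
  have hp0 := hp 0
  have hp1 := hp 1
  simp only [cotton, nabla2, Fin.sum_univ_two, Fin.forall_fin_two, hGs, hPs, h0, h1, 
    Fin.isValue, sub_zero, sub_self] at hP hc hr hp0 hp1
  simp only [tractorCurvature, tractor, Fin.sum_univ_four]
  fin_cases k
  · simp [-one_div, hp0, hp1, raise, hgs, hPs]
    linear_combination (1 / 2) * hU
  · simp [pd_fun_neg, U_zero, U_one, hGs, hPs, h0, h1, hr]
    simp only [raise, nabla1, hgs, hPs, h0, h1, Fin.sum_univ_two]
    linear_combination -ginv G 0 0 x * hc.1 - ginv G 0 1 x * hc.2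
  · simp [pd_fun_neg, U_zero, U_one, hGs, hPs, h0, h1, hr]
    simp only [raise, nabla1, hgs, hPs, h0, h1, Fin.sum_univ_two]
    linear_combination -ginv G 0 1 x * hc.1 - ginv G 1 1 x * hc.2
  · simp [hGs, pd_const, hPs, h0, h1]
    linear_combination hP.1.2-hP.2.1

end IsMoebiusChart

end Tractor

/-! ### Solutions of the equation and solutions of the prolonged system. -/

section Jet

open Set Filter

/-- The components `(σ, ∇₀σ, ∇₁σ, ψ)` of the prolongation of a solution. -/
def jet (G P : Comp2) (u : Comp0) : Fin 4 → Comp0 :=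
  ![u, pd 0 u, pd 1 u, fun x => 1 / 2 * trace G (fun a b y => hess G u a b y + P a b y * u y) x]

lemma exists_isOpen_chartSolution {G P : Comp2} {U : Set E2} {u : Comp0} {x : E2} (hU : IsOpen U)
    (hx : x ∈ U) (hu : ∀ᶠ y in 𝓝 x, ChartSolution G P u y) :
    ∃ N ⊆ U, IsOpen N ∧ x ∈ N ∧ ContDiffOn ℝ ∞ u N ∧ ∀ y ∈ N, ∀ a b, confEinstein G P u a b y = 0 := by
  obtain ⟨N, hN, hNo, hxN⟩ := eventually_nhds_iff.1 (hu.and (hU.mem_nhds hx))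
  exact ⟨N, fun y hy => (hN y hy).2, hNo, hxN, fun y hy => (hN y hy).1.1.contDiffWithinAt,
    fun y hy => (hN y hy).1.2⟩

namespace IsMoebiusChart

variable {G P : Comp2} {U : Set E2} (hC : IsMoebiusChart G P U)

include hC

lemma mono {N : Set E2} (hN : IsOpen N) (h : N ⊆ U) : IsMoebiusChart G P N where
  isOpen := hN
  contDiffOn_G i j := (hC.contDiffOn_G i j).mono h
  contDiffOn_P i j := (hC.contDiffOn_P i j).mono h
  symm_G x hx := hC.symm_G x (h hx)
  symm_P x hx := hC.symm_P x (h hx)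
  pos_G x hx := hC.pos_G x (h hx)
  det_pos x hx := hC.det_pos x (h hx)
  trace_P x hx := hC.trace_P x (h hx)

lemma contDiffOn_hess {u : Comp0} (hu : ContDiffOn ℝ ∞ u U) (a b : Fin 2) :
    ContDiffOn ℝ ∞ (hess G u a b) U :=
  hC.contDiffOn_nabla1 (hC.contDiffOn_grad hu) a b

lemma contDiffOn_jet {u : Comp0} (hu : ContDiffOn ℝ ∞ u U) (j : Fin 4) :
    ContDiffOn ℝ ∞ (jet G P u j) U := by
  fin_cases j
  · exact hu
  · exact contDiffOn_pd hC.isOpen hu 0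
  · exact contDiffOn_pd hC.isOpen hu 1
  · exact contDiffOn_const.mul <| hC.contDiffOn_trace fun a b =>
      (hC.contDiffOn_hess hu a b).add ((hC.contDiffOn_P a b).mul hu)

/-- A solution of the conformal-to-Einstein equation prolongs to a solution of the linear system. -/
lemma solvesAt_jet_of_forall {u : Comp0} (hu : ContDiffOn ℝ ∞ u U)
    (h : ∀ y ∈ U, ∀ a b, confEinstein G P u a b y = 0) {x : E2} (hx : x ∈ U) :
    SolvesAt (tractor G P) (jet G P u) x := by
  have h0 : ∀ i y, pd i (jet G P u 0) y = ∑ k, tractor G P i 0 k y * jet G P u k y := by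
    intro i y
    rw [Fin.sum_univ_four]
    fin_cases i <;> simp [tractor, jet]
  have hb : ∀ b i, ∀ y ∈ U, pd i (pd b u) y = -P i b y * u y + christoffel G 0 i b y * pd 0 u y
      + christoffel G 1 i b y * pd 1 u y
      + G i b y * (1 / 2 * trace G (fun a b y => hess G u a b y + P a b y * u y) y) := by
    intro b i y hy
    have h2 := h y hy i b
    simp only [confEinstein, traceFree] at h2
    have h3 : hess G u i b y = pd i (pd b u) y - (christoffel G 0 i b y * pd 0 u y
        + christoffel G 1 i b y * pd 1 u y) := by
      simp only [hess, nabla1, grad, Fin.sum_univ_two]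
    linear_combination h2 - h3
  have h1 : ∀ i, ∀ y ∈ U, pd i (jet G P u 1) y = ∑ k, tractor G P i 1 k y * jet G P u k y := by
    intro i y hy
    rw [Fin.sum_univ_four]
    exact hb 0 i y hy
  have h2 : ∀ i, ∀ y ∈ U, pd i (jet G P u 2) y = ∑ k, tractor G P i 2 k y * jet G P u k y := by
    intro i y hy
    rw [Fin.sum_univ_four]
    exact hb 1 i y hy
  have hd : ∀ k, DifferentiableAt ℝ (jet G P u k) x := fun k =>
    differentiableAt_of_contDiffOn hC.isOpen (hC.contDiffOn_jet hu k) hx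
  have ha : ∀ i j k, DifferentiableAt ℝ (tractor G P i j k) x := fun i j k =>
    differentiableAt_of_contDiffOn hC.isOpen (hC.contDiffOn_tractor i j k) hx
  have hint := fun j => integrability (j := j) hd (fun i k => ha i j k)
    (contDiffAt_two_of_contDiffOn hC.isOpen (hC.contDiffOn_jet hu j) hx)
  have hi1 := hint 1 (by filter_upwards [hC.isOpen.mem_nhds hx] with y hy i using h1 i y hy)
  have hi2 := hint 2 (by filter_upwards [hC.isOpen.mem_nhds hx] with y hy i using h2 i y hy)
  have hF1 := fun k => hC.tractorCurvature_one hx 0 k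
  have hF2 := fun k => hC.tractorCurvature_one hx 1 k
  simp only [Fin.isValue, if_true, one_ne_zero, if_false, tractorCurvature, Fin.sum_univ_four]
    at hF1 hF2
  simp only [Fin.sum_univ_four, h0, h1 _ x hx, h2 _ x hx] at hi1 hi2
  have g1 : ∀ i, tractor G P i 1 3 x = G i 0 x := fun _ => rfl
  have g2 : ∀ i, tractor G P i 2 3 x = G i 1 x := fun _ => rfl
  -- The formula for $d\psi$ is forced by integrability of the two gradient rows. Since the
  -- curvature of these rows vanishes, the error in $d\psi$ wedges to zero with $g_{\cdot0}$ and
  -- $g_{\cdot1}$; the determinant of this system is that of the metric.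
  have key := eq_zero_of_two_by_two
    (a := G 1 0 x) (b := -G 0 0 x) (c := G 1 1 x) (d := -G 0 1 x)
    (y := pd 0 (jet G P u 3) x - ∑ k, tractor G P 0 3 k x * jet G P u k x)
    (z := pd 1 (jet G P u 3) x - ∑ k, tractor G P 1 3 k x * jet G P u k x)
    (by
      have := hC.det_ne hx
      intro h
      exact this (by rw [detG]; linear_combination h))
    (by
      rw [← g1, ← g1, Fin.sum_univ_four, Fin.sum_univ_four]
      linear_combination hi1 - jet G P u 0 x * hF1 0 - jet G P u 1 x * hF1 1
        - jet G P u 2 x * hF1 2 - jet G P u 3 x * hF1 3)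
    (by
      rw [← g2, ← g2, Fin.sum_univ_four, Fin.sum_univ_four]
      linear_combination hi2 - jet G P u 0 x * hF2 0 - jet G P u 1 x * hF2 1
        - jet G P u 2 x * hF2 2 - jet G P u 3 x * hF2 3)
  intro j
  refine ⟨hd j, fun i => ?_⟩
  fin_cases j
  · exact h0 i x
  · exact h1 i x hx
  · exact h2 i x hx
  · fin_cases i
    · exact sub_eq_zero.1 key.1
    · exact sub_eq_zero.1 key.2

lemma solvesAt_jet {u : Comp0} {x : E2} (hx : x ∈ U)
    (hu : ∀ᶠ y in 𝓝 x, ChartSolution G P u y) : SolvesAt (tractor G P) (jet G P u) x := by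
  obtain ⟨N, hNU, hN, hxN, h1, h2⟩ := exists_isOpen_chartSolution hC.isOpen hx hu
  exact (hC.mono hN hNU).solvesAt_jet_of_forall h1 h2 hxN

/-- The constraint `Y^a ∇_a σ + μ σ = 0` on solutions. -/
lemma constraint {u : Comp0} {x : E2} (hx : x ∈ U) (hu : ∀ᶠ y in 𝓝 x, ChartSolution G P u y) :
    pair G (grad u) (Yform G P) x + muScalar G P x * u x = 0 := by
  obtain ⟨N, hNU, hN, hxN, h1, h2⟩ := exists_isOpen_chartSolution hC.isOpen hx hu
  have hC' := hC.mono hN hNU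
  have hs := fun y hy => hC'.solvesAt_jet_of_forall h1 h2 (x := y) hy
  -- Integrability of the last row says that the curvature annihilates the jet, and only $\mu$ and
  -- $Y^a$ survive there.
  have hi := integrability (j := 3) (fun k => (hs x hxN k).1)
    (fun i k => differentiableAt_of_contDiffOn hC.isOpen (hC.contDiffOn_tractor i 3 k) hx)
    (contDiffAt_two_of_contDiffOn hN (hC'.contDiffOn_jet h1 3) hxN)
    (by filter_upwards [hN.mem_nhds hxN] with y hy i using (hs y hy 3).2 i)
  have hF := fun k => hC.tractorCurvature_three hx k
  simp only [(hs x hxN _).2] at hi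
  simp only [Fin.sum_univ_four, tractorCurvature] at hi hF
  have hF0 := hF 0
  have hF1 := hF 1
  have hF2 := hF 2
  have hF3 := hF 3
  simp only [Fin.isValue, Matrix.cons_val, mul_zero, neg_zero] at hF0 hF1 hF2 hF3
  have e : Real.sqrt (detG G x) * (pair G (grad u) (Yform G P) x + muScalar G P x * u x) = 0 := by
    have e0 : jet G P u 0 x = u x := rfl
    have e1 : jet G P u 1 x = pd 0 u x := rfl
    have e2 : jet G P u 2 x = pd 1 u x := rfl
    rw [← e0]
    simp only [pair, grad, Fin.sum_univ_two]
    rw [← e1, ← e2]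
    linear_combination -hi + jet G P u 0 x * hF0 + jet G P u 1 x * hF1 + jet G P u 2 x * hF2
      + jet G P u 3 x * hF3
  exact (mul_eq_zero.1 e).resolve_left (hC.sqrt_det_pos hx).ne'

/-- A solution of the linear system yields a solution of the conformal-to-Einstein equation. -/
lemma confEinstein_of_solvesAt {W : Fin 4 → Comp0} {x : E2} (hx : x ∈ U)
    (hW : ∀ᶠ y in 𝓝 x, SolvesAt (tractor G P) W y) (a b : Fin 2) :
    confEinstein G P (W 0) a b x = 0 := by
  have hW0 := hW.self_of_nhds
  have h0 : pd 0 (W 0) =ᶠ[𝓝 x] W 1 := by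
    filter_upwards [hW] with y hy
    simpa [Fin.sum_univ_four, tractor] using (hy 0).2 0
  have h1 : pd 1 (W 0) =ᶠ[𝓝 x] W 2 := by
    filter_upwards [hW] with y hy
    simpa [Fin.sum_univ_four, tractor] using (hy 0).2 1
  refine (confEinstein_eq_zero_iff (hC.det_ne hx) (hC.symm_G x hx 1 0)).2
    ⟨W 3 x, fun i j => ?_⟩ a b
  have h2 := (hW0 1).2 i
  have h3 := (hW0 2).2 i
  simp only [Fin.sum_univ_four, tractor, Matrix.cons_val, Fin.isValue] at h2 h3
  have e0 := pd_congr h0 i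
  have e1 := pd_congr h1 i
  simp only [hess, nabla1, grad, Fin.sum_univ_two, h0.self_of_nhds, h1.self_of_nhds]
  fin_cases j
  · simp only [Fin.zero_eta, e0]
    linear_combination h2
  · simp only [Fin.mk_one, e1]
    linear_combination h3

/-- The first row makes the gradient components vanish near `x`; the next row then reduces to
$g_{00}\psi=0$, and $g_{00}>0$. Hence the whole jet is controlled by the germ of $\sigma$. -/
lemma eq_zero_of_solvesAt {W : Fin 4 → Comp0} {x : E2} (hx : x ∈ U)
    (hW : ∀ᶠ y in 𝓝 x, SolvesAt (tractor G P) W y) (h : ∀ᶠ y in 𝓝 x, W 0 y = 0) (j : Fin 4) :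
    W j x = 0 := by
  have hz : ∀ {w : Comp0} {y : E2}, (∀ᶠ z in 𝓝 y, w z = 0) → ∀ i, pd i w y = 0 := fun {w y} hw i =>
    (pd_congr (v := fun _ => 0) hw i).trans (pd_const 0 i)
  have h1 : ∀ᶠ y in 𝓝 x, W 1 y = 0 := by
    filter_upwards [hW, eventually_eventually_nhds.2 h] with y hy hy'
    simpa [Fin.sum_univ_four, tractor, hz hy'] using ((hy 0).2 0).symm
  have h2 : ∀ᶠ y in 𝓝 x, W 2 y = 0 := by
    filter_upwards [hW, eventually_eventually_nhds.2 h] with y hy hy'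
    simpa [Fin.sum_univ_four, tractor, hz hy'] using ((hy 0).2 1).symm
  have h3 := (hW.self_of_nhds 1).2 0
  rw [hz h1, Fin.sum_univ_four, h.self_of_nhds, h1.self_of_nhds, h2.self_of_nhds] at h3
  simp only [mul_zero, zero_add] at h3
  have h4 : W 3 x = 0 := (mul_eq_zero.1 h3.symm).resolve_left (hC.pos_G x hx).ne'
  fin_cases j
  · exact h.self_of_nhds
  · exact h1.self_of_nhds
  · exact h2.self_of_nhds
  · exact h4

/-- If $Y$ vanishes on an open set then so does its divergence, so the last curvature row is zero as
well. -/
lemma tractor_flat (hY : ∀ y ∈ U, ∀ a, Yform G P a y = 0) {x : E2} (hx : x ∈ U) (j k : Fin 4) :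
    tractorCurvature G P j k x = 0 := by
  have hr : ∀ y ∈ U, ∀ a, raise G (Yform G P) a y = 0 := fun y hy a => by
    simp [raise, hY y hy]
  have hp : ∀ i a, pd i (raise G (Yform G P) a) x = 0 := fun i a =>
    (pd_congr_of_eqOn (v := fun _ => 0) hC.isOpen (fun y hy => hr y hy a) hx i).trans (pd_const 0 i)
  have hmu : muScalar G P x = 0 := by
    simp [muScalar, hC.divergence_eq hx hC.contDiffOn_Y, hp, hr x hx]
  fin_cases j
  · exact hC.tractorCurvature_zero hx k
  · exact hC.tractorCurvature_one hx 0 k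
  · exact hC.tractorCurvature_one hx 1 k
  · refine (hC.tractorCurvature_three hx k).trans ?_
    fin_cases k <;> simp [hmu, hr x hx]

end IsMoebiusChart

end Jet

/-! ### Local bases, unique continuation and the flat case. -/

section LocalBasis

open Set Filter

lemma SolvesAt.linComb {d n : ℕ} {a : Fin 2 → Fin d → Fin d → Comp0} {J : Fin n → Fin d → Comp0}
    {x : E2} (h : ∀ m, SolvesAt a (J m) x) (c : Fin n → ℝ) :
    SolvesAt a (fun j y => ∑ m, c m * J m j y) x := by
  intro j
  have hd : ∀ m, DifferentiableAt ℝ (fun y => c m * J m j y) x := fun m =>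
    (differentiableAt_const _).fun_mul (h m j).1
  refine ⟨DifferentiableAt.fun_sum fun m _ => hd m, fun i => ?_⟩
  rw [pd_fun_sum fun m _ => hd m]
  simp only [pd_fun_mul (differentiableAt_const _) (h _ j).1, pd_const, (h _ j).2 i, zero_mul,
    zero_add, Finset.mul_sum]
  rw [Finset.sum_comm]
  exact Finset.sum_congr rfl fun k _ => Finset.sum_congr rfl fun m _ => by ring

lemma SolvesAt.sub {d : ℕ} {a : Fin 2 → Fin d → Fin d → Comp0} {W W' : Fin d → Comp0}
    {x : E2} (h : SolvesAt a W x) (h' : SolvesAt a W' x) :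
    SolvesAt a (fun j y => W j y - W' j y) x := by
  intro j
  refine ⟨(h j).1.fun_sub (h' j).1, fun i => ?_⟩
  rw [pd_fun_sub (h j).1 (h' j).1, (h j).2, (h' j).2, ← Finset.sum_sub_distrib]
  exact Finset.sum_congr rfl fun k _ => by ring

variable {M : Type*} [TopologicalSpace M] [ChartedSpace E2 M] [IsManifold (𝓡 2) ∞ M]
  (S : MoebiusSurface M) (g : S.metrics)

namespace MoebiusSurface

lemma tendsto_chart {e : OpenPartialHomeomorph M E2} {q : M} (hq : q ∈ e.source) :
    Tendsto e.symm (𝓝 (e q)) (𝓝 q) := by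
  have := e.continuousAt_symm (e.map_source hq)
  rwa [ContinuousAt, e.left_inv hq] at this

lemma eventually_chartSolution {u : M → ℝ} {e : OpenPartialHomeomorph M E2} (he : e ∈ atlas E2 M)
    {q : M} (hq : q ∈ e.source) (h : ∀ᶠ y in 𝓝 q, (S.equation g).holds u y) :
    ∀ᶠ y in 𝓝 (e q), ChartSolution (S.G g e) (S.P g e) (fun y => u (e.symm y)) y := by
  filter_upwards [(tendsto_chart hq).eventually h, e.open_target.mem_nhds (e.map_source hq)]
    with y hy hyt
  exact chartSolution_of_holds he hyt hy

/-- A flat linear system equivalent to the conformal-to-Einstein equation in a chart yields a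
local basis of solutions. -/
theorem exists_isLocalBasis {d : ℕ} [NeZero d] {e : OpenPartialHomeomorph M E2}
    (he : e ∈ atlas E2 M) {p : M} (hp : p ∈ e.source) {a : Fin 2 → Fin d → Fin d → Comp0}
    {m : Comp0} (ha : ∀ i j k, ContDiffOn ℝ ∞ (a i j k) e.target)
    (hm : ContDiffOn ℝ ∞ m e.target) (hm0 : ∀ x ∈ e.target, m x ≠ 0)
    (hflat : ∀ x ∈ e.target, ∀ j k, pd 0 (a 1 j k) x + ∑ l, a 1 j l x * a 0 l k x
      = pd 1 (a 0 j k) x + ∑ l, a 0 j l x * a 1 l k x)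
    (hto : ∀ x ∈ e.target, ∀ W : Fin d → Comp0, (∀ᶠ y in 𝓝 x, SolvesAt a W y) →
      ∀ i j, confEinstein (S.G g e) (S.P g e) (fun y => m y * W 0 y) i j x = 0)
    (hfrom : ∀ x ∈ e.target, ∀ u : Comp0,
      (∀ᶠ y in 𝓝 x, ChartSolution (S.G g e) (S.P g e) u y) →
        ∃ W : Fin d → Comp0, (∀ᶠ y in 𝓝 x, SolvesAt a W y) ∧ ∀ᶠ y in 𝓝 x, u y = m y * W 0 y)
    (hinj : ∀ x ∈ e.target, ∀ W : Fin d → Comp0, (∀ᶠ y in 𝓝 x, SolvesAt a W y) →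
      (∀ᶠ y in 𝓝 x, W 0 y = 0) → ∀ j, W j x = 0) :
    ∃ N, IsOpen N ∧ p ∈ N ∧ ∃ b : Fin d → M → ℝ, (S.equation g).IsLocalBasis N b := by
  obtain ⟨N, hN, hpN, hNU, J, hJ, huniq⟩ :=
    exists_basis_solvesAt e.open_target ha hflat (e.map_source hp)
  refine ⟨e.source ∩ e ⁻¹' N, e.isOpen_inter_preimage hN, ⟨hp, hpN⟩,
    fun k q => m (e q) * J k 0 (e q), fun k q hq => ?_, fun q hq w hw => ?_⟩
  · have hev : (fun y => m (e (e.symm y)) * J k 0 (e (e.symm y)))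
        =ᶠ[𝓝 (e q)] fun y => m y * J k 0 y := by
      filter_upwards [e.open_target.mem_nhds (e.map_source hq.1)] with y hy
      rw [e.right_inv hy]
    refine holds_of_chartSolution he hq.1 ⟨?_, fun i j => ?_⟩
    · refine ContDiffAt.congr_of_eventuallyEq ?_ hev
      have h1 := contDiffOn_of_solvesAt hN (fun i j k => (ha i j k).mono hNU) (hJ k) 0
      exact (hm.contDiffAt (e.open_target.mem_nhds (hNU hq.2))).mul
        (h1.contDiffAt (hN.mem_nhds hq.2))
    · rw [confEinstein_congr _ _ hev]
      exact hto _ (hNU hq.2) _ (by filter_upwards [hN.mem_nhds hq.2] with y hy using hJ k y hy) i j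
  · obtain ⟨W, hW, hWu⟩ := hfrom _ (hNU hq.2) _ (S.eventually_chartSolution g he hq.1 hw)
    -- Expanding the function `w` and expanding the full solution vector `W` are the same problem:
    -- `m` has no zeros, and by `hinj` a solution vector is determined by its zeroth component.
    have hlin : ∀ c : Fin d → ℝ, w =ᶠ[𝓝 q] linComb c (fun k q => m (e q) * J k 0 (e q)) ↔
        ∀ᶠ y in 𝓝 (e q), ∀ j, W j y = ∑ k, c k * J k j y := by
      intro c
      have h1 : (∀ᶠ y in 𝓝 (e q), ∀ j, W j y = ∑ k, c k * J k j y) ↔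
          ∀ᶠ y in 𝓝 (e q), W 0 y = ∑ k, c k * J k 0 y := by
        refine ⟨fun h => h.mono fun y hy => hy 0, fun h => ?_⟩
        have h2 : ∀ᶠ y in 𝓝 (e q), SolvesAt a (fun j y => W j y - ∑ k, c k * J k j y) y := by
          filter_upwards [hW, hN.mem_nhds hq.2] with y hy hyN
          exact hy.sub (SolvesAt.linComb (fun m => hJ m y hyN) c)
        filter_upwards [eventually_eventually_nhds.2 h, eventually_eventually_nhds.2 h2,
          e.open_target.mem_nhds (hNU hq.2)] with y hy hy2 hyt j
        exact sub_eq_zero.1 (hinj y hyt _ hy2 (hy.mono fun z hz => sub_eq_zero.2 hz) j)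
      rw [h1]
      constructor
      · intro h
        filter_upwards [(tendsto_chart hq.1).eventually h, hWu,
          e.open_target.mem_nhds (hNU hq.2)] with y hy hy' hyt
        rw [hy'] at hy
        simp only [linComb, e.right_inv hyt] at hy
        refine mul_left_cancel₀ (hm0 y hyt) (hy.trans ?_)
        rw [Finset.mul_sum]
        exact Finset.sum_congr rfl fun k _ => by ring
      · intro h
        filter_upwards [(e.continuousAt hq.1).eventually (h.and hWu),
          e.open_source.mem_nhds hq.1] with y hy hys
        have h3 := hy.2
        rw [e.left_inv hys, hy.1, Finset.mul_sum] at h3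
        rw [h3]
        exact Finset.sum_congr rfl fun k _ => by ring
    obtain ⟨c, hc, hc'⟩ := huniq _ hq.2 W hW
    exact ⟨c, (hlin c).2 hc, fun c' h => hc' c' ((hlin c').1 h)⟩

/-- Unique continuation for the conformal-to-Einstein equation. -/
theorem eq_zero_of_eventually_eq_zero [PreconnectedSpace M] {w : M → ℝ}
    (hw : ∀ p, (S.equation g).holds w p) {p : M} (h0 : ∀ᶠ y in 𝓝 p, w y = 0) (q : M) :
    w q = 0 := by
  set Z : Set M := {q | ∀ᶠ y in 𝓝 q, w y = 0} with hZ
  have hopen : IsOpen Z := isOpen_iff_mem_nhds.2 fun q hq => eventually_eventually_nhds.2 hq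
  have hclosed : IsClosed Z := by
    refine isClosed_of_closure_subset fun q hq => ?_
    set e := chartAt E2 q with he'
    have he : e ∈ atlas E2 M := chart_mem_atlas E2 q
    have hq' : q ∈ e.source := mem_chart_source E2 q
    have hC := S.isMoebiusChart g he
    -- Flatness is irrelevant here: on a small ball about a limit point of the zero set, a jet
    -- vanishing at one point vanishes throughout, because the prolonged system prescribes all first
    -- derivatives.
    obtain ⟨r, hr, hrU, hball⟩ := exists_ball_eq_zero_of_solvesAt e.open_target
      (fun i j k => (hC.contDiffOn_tractor i j k).continuousOn) (e.map_source hq')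
    have hNo : IsOpen (e.source ∩ e ⁻¹' Metric.ball (e q) r) :=
      e.isOpen_inter_preimage Metric.isOpen_ball
    obtain ⟨q', ⟨hq's, hq'b⟩, hq'Z⟩ := mem_closure_iff.1 hq _ hNo ⟨hq', Metric.mem_ball_self hr⟩
    have hu : ∀ x ∈ e.target, ∀ᶠ y in 𝓝 x,
        ChartSolution (S.G g e) (S.P g e) (fun y => w (e.symm y)) y := fun x hx => by
      filter_upwards [e.open_target.mem_nhds hx] with y hy
      exact chartSolution_of_holds he hy (hw _)
    have hsol := hball _ subset_rfl (convex_ball _ _) (jet (S.G g e) (S.P g e) fun y => w (e.symm y))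
      (fun x hx => hC.solvesAt_jet (hrU hx) (hu x (hrU hx))) (e q') hq'b (fun j =>
        hC.eq_zero_of_solvesAt (hrU hq'b) (by
            filter_upwards [e.open_target.mem_nhds (hrU hq'b)] with y hy
            exact hC.solvesAt_jet hy (hu y hy))
          ((tendsto_chart hq's).eventually hq'Z) j)
    filter_upwards [hNo.mem_nhds ⟨hq', Metric.mem_ball_self hr⟩] with y hy
    have := hsol (e y) hy.2 0
    have h2 : w (e.symm (e y)) = 0 := this
    rwa [e.left_inv hy.1] at h2
  have huniv : Z = univ := IsClopen.eq_univ ⟨hclosed, hopen⟩ ⟨p, h0⟩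
  exact (huniv ▸ mem_univ q : q ∈ Z).self_of_nhds

theorem finrank_kernel_of_isLocalBasis {d : ℕ} [SimplyConnectedSpace M]
    (h : ∀ p : M, ∃ N, IsOpen N ∧ p ∈ N ∧ ∃ b : Fin d → M → ℝ, (S.equation g).IsLocalBasis N b) :
    Module.finrank ℝ (LinearMap.ker S.operator) = d := by
  have : LocallyPathConnectedSpace M := ChartedSpace.locallyPathConnectedSpace E2 M
  rw [(S.kernelEquiv g).finrank_eq]
  exact GermCondition.finrank_solutions h

/-- An obstruction that is nonzero at one point only forces solutions to vanish near it; unique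
continuation spreads this to the whole surface. -/
theorem ker_eq_bot_of_eventually_eq_zero [PreconnectedSpace M]
    (h : ∀ w : M → ℝ, (∀ p, (S.equation g).holds w p) → ∃ p, ∀ᶠ y in 𝓝 p, w y = 0) :
    LinearMap.ker S.operator = ⊥ := by
  rw [Submodule.eq_bot_iff]
  intro σ hσ
  have h1 : S.kernelEquiv g ⟨σ, hσ⟩ = 0 := by
    obtain ⟨w, hw⟩ : ∃ w, w = S.kernelEquiv g ⟨σ, hσ⟩ := ⟨_, rfl⟩
    rw [← hw]
    obtain ⟨p, hp⟩ := h w.1 w.2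
    exact Subtype.ext (funext (S.eq_zero_of_eventually_eq_zero g w.2 hp))
  exact congrArg Subtype.val ((S.kernelEquiv g).map_eq_zero_iff.1 h1)

/-- The flat case. -/
theorem finrank_kernel_of_isFlat [SimplyConnectedSpace M] (hS : S.IsFlat) :
    Module.finrank ℝ (LinearMap.ker S.operator) = 4 := by
  obtain ⟨g₀, hg₀⟩ := S.nonempty
  refine S.finrank_kernel_of_isLocalBasis ⟨g₀, hg₀⟩ fun p => ?_
  have he : chartAt E2 p ∈ atlas E2 M := chart_mem_atlas E2 p
  have hC := S.isMoebiusChart ⟨g₀, hg₀⟩ he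
  refine S.exists_isLocalBasis ⟨g₀, hg₀⟩ he (mem_chart_source E2 p) (m := fun _ => 1)
    hC.contDiffOn_tractor contDiffOn_const (fun _ _ => one_ne_zero)
    (fun x hx j k => sub_eq_zero.1 (hC.tractor_flat (fun y hy => hS ⟨g₀, hg₀⟩ _ he y hy) hx j k))
    (fun x hx W hW i j => ?_) (fun x hx u hu => ⟨jet (S.G ⟨g₀, hg₀⟩ (chartAt E2 p)) (S.P ⟨g₀, hg₀⟩ (chartAt E2 p)) u, ?_, ?_⟩)
    (fun x hx W hW h j => hC.eq_zero_of_solvesAt hx hW h j)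
  · simp only [one_mul]
    exact hC.confEinstein_of_solvesAt hx hW i j
  · filter_upwards [eventually_eventually_nhds.2 hu, hC.isOpen.mem_nhds hx] with y hy hyt
    exact hC.solvesAt_jet hyt hy
  · exact Eventually.of_forall fun y => (one_mul _).symm

end MoebiusSurface

end LocalBasis

/-! ### Surfaces with $U_aV^a\ne0$. -/

section Generic

open Set Filter

namespace IsMoebiusChart

variable {G P : Comp2} {U : Set E2} (hC : IsMoebiusChart G P U) {x : E2} (hx : x ∈ U)

include hC hx

lemma sqrt_det_mul_raise_U_zero :
    Real.sqrt (detG G x) * raise G (Uform G P) 0 x = Yform G P 1 x := by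
  have hs := hC.sq_sqrt_det hx
  have hd : detG G x * (detG G x)⁻¹ = 1 := mul_inv_cancel₀ (hC.det_ne hx)
  have hY := hC.sum_metric_mul_raise hx (Yform G P) 1
  have hGs := hC.symm_G x hx 1 0
  rw [Fin.sum_univ_two] at hY
  rw [raise, Fin.sum_univ_two, U_zero, U_one, ginv_zero_zero, ginv_zero_one,
    div_eq_mul_inv _ (detG G x), div_eq_mul_inv _ (detG G x)]
  rw [hGs] at hY
  linear_combination ((G 1 1 x * raise G (Yform G P) 1 x + G 0 1 x * raise G (Yform G P) 0 x)
    * (detG G x)⁻¹) * hs + (G 1 1 x * raise G (Yform G P) 1 x + G 0 1 x * raise G (Yform G P) 0 x)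
    * hd + hY

lemma sqrt_det_mul_raise_U_one :
    Real.sqrt (detG G x) * raise G (Uform G P) 1 x = -Yform G P 0 x := by
  have hs := hC.sq_sqrt_det hx
  have hd : detG G x * (detG G x)⁻¹ = 1 := mul_inv_cancel₀ (hC.det_ne hx)
  have hY := hC.sum_metric_mul_raise hx (Yform G P) 0
  have hGs := hC.symm_G x hx 1 0
  rw [Fin.sum_univ_two] at hY
  rw [raise, Fin.sum_univ_two, U_zero, U_one, ginv_one_one, ginv_one_zero,
    div_eq_mul_inv _ (detG G x), div_eq_mul_inv _ (detG G x), hGs]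
  linear_combination -((G 0 0 x * raise G (Yform G P) 0 x + G 0 1 x * raise G (Yform G P) 1 x)
    * (detG G x)⁻¹) * hs - (G 0 0 x * raise G (Yform G P) 0 x + G 0 1 x * raise G (Yform G P) 1 x)
    * hd - hY

omit hC hx in
lemma pair_U_Y : pair G (Uform G P) (Yform G P) x = 0 := by
  rw [pair, Fin.sum_univ_two, U_zero, U_one]
  ring

omit hC hx in
lemma pair_U (α : Comp1) : pair G (Uform G P) α x = Real.sqrt (detG G x)
    * (raise G (Yform G P) 1 x * raise G α 0 x - raise G (Yform G P) 0 x * raise G α 1 x) := by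
  rw [pair, Fin.sum_univ_two, U_zero, U_one]
  ring

/-- Rotation by a right angle preserves length. Where $Y\ne0$, $Y$ and $U$ therefore form an
orthogonal frame of equal lengths. -/
lemma pair_U_U : pair G (Uform G P) (Uform G P) x = rhoScalar G P x := by
  rw [pair_U, rhoScalar, pair, Fin.sum_univ_two, ← hC.sqrt_det_mul_raise_U_zero hx]
  have := hC.sqrt_det_mul_raise_U_one hx
  linear_combination -raise G (Yform G P) 0 x * this

/-- A `1`-form orthogonal to `Y` and `V` vanishes if `U_a V^a ≠ 0`. -/
lemma eq_zero_of_pair_Y_V (hUV : UV G P x ≠ 0) {α : Comp1} (h1 : pair G α (Yform G P) x = 0)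
    (h2 : pair G α (Vform G P) x = 0) (a : Fin 2) : α a x = 0 := by
  rw [pair, Fin.sum_univ_two] at h1 h2
  rw [UV, pair_U] at hUV
  have := eq_zero_of_two_by_two (a := raise G (Yform G P) 0 x) (b := raise G (Yform G P) 1 x)
    (c := raise G (Vform G P) 0 x) (d := raise G (Vform G P) 1 x) (y := α 0 x) (z := α 1 x)
    (fun h => hUV (by linear_combination -Real.sqrt (detG G x) * h))
    (by linear_combination h1) (by linear_combination h2)
  fin_cases a
  exacts [this.1, this.2]

/-- The differential consequence of the constraint `Y^a ∇_a σ + μ σ = 0`. -/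
lemma eval2_U_Y {u : Comp0} (hu : ContDiffOn ℝ ∞ u U)
    (h : ∀ᶠ y in 𝓝 x, pair G (grad u) (Yform G P) y + muScalar G P y * u y = 0) :
    eval2 G (fun a b y => hess G u a b y + P a b y * u y) (Uform G P) (Yform G P) x
      = kScalar G P x * u x - pair G (Vform G P) (grad u) x := by
  have hd : DifferentiableAt ℝ u x := differentiableAt_of_contDiffOn hC.isOpen hu hx
  have hmu : DifferentiableAt ℝ (muScalar G P) x :=
    differentiableAt_of_contDiffOn hC.isOpen hC.contDiffOn_mu hx
  have hp : DifferentiableAt ℝ (pair G (grad u) (Yform G P)) x :=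
    differentiableAt_of_contDiffOn hC.isOpen
      (hC.contDiffOn_pair (hC.contDiffOn_grad hu) hC.contDiffOn_Y) hx
  have h1 : ∀ e, pair G (hess G u e) (Yform G P) x + pair G (nabla1 G (Yform G P) e) (grad u) x
      + pd e (muScalar G P) x * u x + muScalar G P x * pd e u x = 0 := by
    intro e
    have h2 : pd e (fun y => pair G (grad u) (Yform G P) y + muScalar G P y * u y) x = 0 :=
      (pd_congr (v := fun _ => 0) h e).trans (pd_const 0 e)
    rw [pd_fun_add hp (hmu.fun_mul hd), pd_fun_mul hmu hd,
      hC.pd_pair hx (hC.contDiffOn_grad hu) hC.contDiffOn_Y,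
      hC.pair_comm hx (grad u) (nabla1 G (Yform G P) e)] at h2
    rw [hess]
    linear_combination h2
  have h3 := h.self_of_nhds
  rw [hC.pair_comm hx] at h3
  have h4 := hC.pair_comm hx (grad u) (Uform G P)
  simp only [pair, eval2, kScalar, dirDeriv, Vform, grad, Fin.sum_univ_two] at h1 h3 h4 ⊢
  -- The derivative of the constraint is contracted with $U$. The $3\phi$ terms in the definitions
  -- of $V$ and $k$ only add a multiple of the constraint itself.
  linear_combination raise G (Uform G P) 0 x * h1 0 + raise G (Uform G P) 1 x * h1 1
    - muScalar G P x * h4 - 3 * phiScalar G P x * h3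

/-- On solutions, `V^a ∇_a σ = k σ`. -/
lemma pair_V_grad {u : Comp0} (hu : ∀ᶠ y in 𝓝 x, ChartSolution G P u y) :
    pair G (Vform G P) (grad u) x = kScalar G P x * u x := by
  obtain ⟨N, hNU, hN, hxN, h1, h2⟩ := exists_isOpen_chartSolution hC.isOpen hx hu
  have hc : ∀ᶠ y in 𝓝 x, pair G (grad u) (Yform G P) y + muScalar G P y * u y = 0 := by
    filter_upwards [hC.isOpen.mem_nhds hx, eventually_eventually_nhds.2 hu] with y hy hy'
    exact hC.constraint hy hy'
  have h3 := (hC.mono hN hNU).eval2_U_Y hxN h1 hc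
  obtain ⟨ψ, hψ⟩ := (confEinstein_eq_zero_iff (hC.det_ne hx) (hC.symm_G x hx 1 0)).1 (h2 x hxN)
  have h4 : eval2 G (fun a b y => hess G u a b y + P a b y * u y) (Uform G P) (Yform G P) x
      = ψ * pair G (Uform G P) (Yform G P) x := by
    have h5 := hC.sum_metric_mul_raise hx (Uform G P)
    simp only [eval2, hψ, pair, Fin.sum_univ_two] at h5 ⊢
    rw [← h5 0, ← h5 1]
    have hGs := hC.symm_G x hx 1 0
    rw [hGs]
    ring
  rw [pair_U_Y, mul_zero] at h4
  linear_combination h3 - h4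

/-- $K$ is built by Cramer's rule to satisfy $K_aY^a=-\mu$ and $K_aV^a=k$: its $U$ part is
orthogonal to $Y$, and its rotated $V$ part is orthogonal to $V$. -/
lemma pair_K_Y (hUV : UV G P x ≠ 0) :
    pair G (Kform G P) (Yform G P) x = -muScalar G P x := by
  have h1 : pair G (Kform G P) (Yform G P) x * UV G P x = -muScalar G P x * UV G P x := by
    have h2 : ∀ a, Kform G P a x * UV G P x
        = muScalar G P x * (∑ c, vol G a c x * raise G (Vform G P) c x)
          + kScalar G P x * Uform G P a x := fun a => div_mul_cancel₀ _ hUV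
    have h3 : ∀ a c, vol G a c x = Real.sqrt (detG G x) * !![0, 1; -1, 0] a c := fun _ _ => rfl
    have h4 := pair_U_Y (G := G) (P := P) (x := x)
    have h5 := pair_U (G := G) (P := P) (x := x) (Vform G P)
    rw [UV] at h2 ⊢
    simp [h3, Fin.sum_univ_two] at h2
    rw [pair, Fin.sum_univ_two] at h4 
    rw [h5] at h2 ⊢
    rw [pair, Fin.sum_univ_two]
    linear_combination raise G (Yform G P) 0 x * h2.1 + raise G (Yform G P) 1 x * h2.2
      + kScalar G P x * h4
  exact mul_right_cancel₀ hUV h1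

lemma pair_K_V (hUV : UV G P x ≠ 0) : pair G (Kform G P) (Vform G P) x = kScalar G P x := by
  have h1 : pair G (Kform G P) (Vform G P) x * UV G P x = kScalar G P x * UV G P x := by
    have h2 : ∀ a, Kform G P a x * UV G P x
        = muScalar G P x * (∑ c, vol G a c x * raise G (Vform G P) c x)
          + kScalar G P x * Uform G P a x := fun a => div_mul_cancel₀ _ hUV
    have h3 : ∀ a c, vol G a c x = Real.sqrt (detG G x) * !![0, 1; -1, 0] a c := fun _ _ => rfl
    simp [h3, Fin.sum_univ_two] at h2
    have h4 : UV G P x = Uform G P 0 x * raise G (Vform G P) 0 x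
        + Uform G P 1 x * raise G (Vform G P) 1 x := by rw [UV, pair, Fin.sum_univ_two]
    rw [pair, Fin.sum_univ_two]
    linear_combination raise G (Vform G P) 0 x * h2.1 + raise G (Vform G P) 1 x * h2.2
      - kScalar G P x * h4
  exact mul_right_cancel₀ hUV h1

/-- On generic surfaces, solutions satisfy `∇_a σ = K_a σ`. -/
lemma grad_eq_K_mul (hUV : UV G P x ≠ 0) {u : Comp0}
    (hu : ∀ᶠ y in 𝓝 x, ChartSolution G P u y) (a : Fin 2) : pd a u x = Kform G P a x * u x := by
  have h1 := hC.constraint hx hu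
  have h2 := hC.pair_V_grad hx hu
  rw [hC.pair_comm hx] at h2
  have h3 := hC.pair_K_Y hx hUV
  have h4 := hC.pair_K_V hx hUV
  refine sub_eq_zero.1 (hC.eq_zero_of_pair_Y_V hx hUV
    (α := fun a y => pd a u y - Kform G P a y * u y) ?_ ?_ a)
  · simp only [pair, grad, Fin.sum_univ_two] at h1 h3 ⊢
    linear_combination h1 - u x * h3
  · simp only [pair, grad, Fin.sum_univ_two] at h2 h4 ⊢
    linear_combination h2 - u x * h4

/-- Differentiating $\nabla u=Ku$ gives $\nabla_a\nabla_bu=(\nabla_aK_b+K_aK_b)u$, and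
$\operatorname{tr}\mathrm P=K$ identifies the trace removed. Since `u` need not solve the equation,
this serves both to construct solutions and to exclude them. -/
lemma confEinstein_eq_E_mul (hUV : ∀ y ∈ U, UV G P y ≠ 0) {u : Comp0}
    (hu : DifferentiableAt ℝ u x) (h : ∀ᶠ y in 𝓝 x, ∀ a, pd a u y = Kform G P a y * u y)
    (a b : Fin 2) : confEinstein G P u a b x = Etensor G P a b x * u x := by
  have hK : ∀ a, DifferentiableAt ℝ (Kform G P a) x := fun a =>
    differentiableAt_of_contDiffOn hC.isOpen (hC.contDiffOn_K hUV a) hx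
  have h1 : ∀ a b, hess G u a b x + P a b x * u x = (nabla1 G (Kform G P) a b x
      + Kform G P a x * Kform G P b x + P a b x) * u x := by
    intro a b
    have h2 : pd a (pd b u) x = pd a (fun y => Kform G P b y * u y) x :=
      pd_congr (h.mono fun y hy => hy b) a
    rw [pd_fun_mul (hK b) hu] at h2
    simp only [hess, nabla1, grad, h2, h.self_of_nhds, Fin.sum_univ_two]
    ring
  have h3 : trace G (fun a b y => hess G u a b y + P a b y * u y) x
      = (divergence G (Kform G P) x + pair G (Kform G P) (Kform G P) x + gaussCurv G x) * u x := by
    rw [← hC.trace_P x hx]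
    simp only [trace, h1, divergence, pair, raise, Fin.sum_univ_two]
    ring
  simp only [confEinstein, traceFree, h3, h1, Etensor]
  ring

omit hx in
lemma continuousOn_E (hUV : ∀ y ∈ U, UV G P y ≠ 0) (a b : Fin 2) :
    ContinuousOn (Etensor G P a b) U := by
  have hK := hC.contDiffOn_K hUV
  have h := ((((hC.contDiffOn_nabla1 hK a b).add ((hK a).mul (hK b))).add
    (hC.contDiffOn_P a b)).sub ((contDiffOn_const (c := (1 / 2 : ℝ))).mul
      (((hC.contDiffOn_divergence hK).add (hC.contDiffOn_pair hK hK)).add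
        (hC.contDiffOn_trace hC.contDiffOn_P)) |>.mul (hC.contDiffOn_G a b))).continuousOn
  refine h.congr fun y hy => ?_
  simp only [Etensor, ← hC.trace_P y hy]

end IsMoebiusChart

variable {M : Type*} [TopologicalSpace M] [ChartedSpace E2 M] [IsManifold (𝓡 2) ∞ M]
  (S : MoebiusSurface M)

namespace MoebiusSurface

/-- The generic case with vanishing obstruction. -/
theorem finrank_kernel_of_obstructionVanishes [SimplyConnectedSpace M] (hg : S.IsGeneric)
    (hE : S.ObstructionVanishes) : Module.finrank ℝ (LinearMap.ker S.operator) = 1 := by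
  obtain ⟨g₀, hg₀⟩ := S.nonempty
  refine S.finrank_kernel_of_isLocalBasis ⟨g₀, hg₀⟩ fun p => ?_
  have he : chartAt E2 p ∈ atlas E2 M := chart_mem_atlas E2 p
  have hC := S.isMoebiusChart ⟨g₀, hg₀⟩ he
  have hUV := hg ⟨g₀, hg₀⟩ _ he
  have hE0 := hE ⟨g₀, hg₀⟩ _ he
  set G := S.G ⟨g₀, hg₀⟩ (chartAt E2 p)
  set P := S.P ⟨g₀, hg₀⟩ (chartAt E2 p)
  refine S.exists_isLocalBasis ⟨g₀, hg₀⟩ he (mem_chart_source E2 p) (m := fun _ => 1)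
    (a := fun i _ _ => Kform G P i)
    (fun i _ _ => hC.contDiffOn_K hUV i) contDiffOn_const (fun _ _ => one_ne_zero)
    (fun x hx _ _ => ?_)
    (fun x hx W hW i j => ?_) (fun x hx u hu => ⟨fun _ => u, ?_, ?_⟩)
    (fun x hx W hW h j => ?_)
  -- Flatness of the rank one system means that $K$ is closed, which is the antisymmetric part of
  -- $E=0$.
  · have h1 := hE0 x hx 0 1
    have h2 := hE0 x hx 1 0
    simp only [Etensor, nabla1, Fin.sum_univ_two, hC.symm_G x hx 1 0, hC.symm_P x hx 1 0,
      hC.christoffel_symm hx _ 1 0] at h1 h2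
    simp only [Fin.sum_univ_one]
    linear_combination h1 - h2
  · simp only [one_mul]
    rw [hC.confEinstein_eq_E_mul hx hUV (hW.self_of_nhds 0).1
      (hW.mono fun y hy a => by simpa using (hy 0).2 a), hE0 x hx, zero_mul]
  · filter_upwards [eventually_eventually_nhds.2 hu, hC.isOpen.mem_nhds hx] with y hy hyt j
    refine ⟨hy.self_of_nhds.1.differentiableAt (by simp), fun i => ?_⟩
    simpa using hC.grad_eq_K_mul hyt (hUV y hyt) hy i
  · exact Eventually.of_forall fun y => (one_mul _).symm
  · rw [Subsingleton.elim j 0]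
    exact h.self_of_nhds

/-- The generic case with non-vanishing obstruction. -/
theorem ker_eq_bot_of_not_obstructionVanishes [PreconnectedSpace M] (hg : S.IsGeneric)
    (hE : ¬ S.ObstructionVanishes) : LinearMap.ker S.operator = ⊥ := by
  simp only [ObstructionVanishes, Everywhere, not_forall] at hE
  obtain ⟨g, e, he, x, hx, a, b, hE⟩ := hE
  have hC := S.isMoebiusChart g he
  have hUV := hg g _ he
  refine S.ker_eq_bot_of_eventually_eq_zero g fun w hw => ⟨e.symm x, ?_⟩
  have hu : ∀ y ∈ e.target, ∀ᶠ z in 𝓝 y,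
      ChartSolution (S.G g e) (S.P g e) (fun z => w (e.symm z)) z := fun y hy => by
    filter_upwards [e.open_target.mem_nhds hy] with z hz
    exact chartSolution_of_holds he hz (hw _)
  have h1 : ∀ᶠ y in 𝓝 x, Etensor (S.G g e) (S.P g e) a b y ≠ 0 :=
    ((hC.continuousOn_E hUV a b).continuousAt (hC.isOpen.mem_nhds hx)).eventually_ne hE
  -- By continuity the component of $E$ is nonzero on a neighbourhood, where $E_{ab}\sigma=0$ leaves
  -- only $\sigma=0$.
  have h2 : ∀ᶠ y in 𝓝 x, w (e.symm y) = 0 := by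
    filter_upwards [h1, hC.isOpen.mem_nhds hx] with y hy hyt
    have h3 := hC.confEinstein_eq_E_mul hyt hUV
      ((hu y hyt).self_of_nhds.1.differentiableAt (by simp)) (by
        filter_upwards [hC.isOpen.mem_nhds hyt] with z hz c
        exact hC.grad_eq_K_mul hz (hUV z hz) (hu z hz) c) a b
    rw [(hu y hyt).self_of_nhds.2] at h3
    exact (mul_eq_zero.1 h3.symm).resolve_left hy
  have h3 := (e.continuousAt (e.map_target hx)).tendsto
  rw [e.right_inv hx] at h3
  filter_upwards [h3.eventually h2, e.open_source.mem_nhds (e.map_target hx)] with q hq hqs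
  rwa [e.left_inv hqs] at hq

end MoebiusSurface

end Generic

/-! ### The rank two system of the non-generic case. -/

section NonGeneric

open Set Filter

/-- The function `ρ^{-1/6}`. -/
def rhoRoot (G P : Comp2) : Comp0 := fun x => rhoScalar G P x ^ (-(1 / 6) : ℝ)

/-- The `1`-form `ρ^{-1/3} U_a`. -/
def odeForm (G P : Comp2) : Comp1 := fun a x => rhoRoot G P x ^ 2 * Uform G P a x

/-- The second order equation of the non-generic case as a linear system for `(ξ, ξ_η)`. -/
def odeSystem (G P : Comp2) (i : Fin 2) : Fin 2 → Fin 2 → Comp0 :=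
  ![![fun _ => 0, odeForm G P i],
    ![fun x => -(odeCoeff0 G P x * odeForm G P i x), fun x => -(odeCoeff1 G P x * odeForm G P i x)]]

namespace IsMoebiusChart

variable {G P : Comp2} {U : Set E2} (hC : IsMoebiusChart G P U)

include hC

lemma hess_mul {p q : Comp0} (hp : ContDiffOn ℝ ∞ p U) (hq : ContDiffOn ℝ ∞ q U) {x : E2}
    (hx : x ∈ U) (a b : Fin 2) : hess G (fun y => p y * q y) a b x
      = hess G p a b x * q x + pd a p x * pd b q x + pd b p x * pd a q x
        + p x * hess G q a b x := by
  have h1 := fun {y} hy => differentiableAt_of_contDiffOn (x := y) hC.isOpen hp hy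
  have h2 := fun {y} hy => differentiableAt_of_contDiffOn (x := y) hC.isOpen hq hy
  have h3 := fun i => differentiableAt_of_contDiffOn hC.isOpen (contDiffOn_pd hC.isOpen hp i) hx
  have h4 := fun i => differentiableAt_of_contDiffOn hC.isOpen (contDiffOn_pd hC.isOpen hq i) hx
  have h5 : pd a (pd b fun y => p y * q y) x = pd a (fun y => pd b p y * q y + p y * pd b q y) x :=
    pd_congr_of_eqOn hC.isOpen (fun y hy => pd_fun_mul (h1 hy) (h2 hy) b) hx a
  rw [pd_fun_add ((h3 b).fun_mul (h2 hx)) ((h1 hx).fun_mul (h4 b)), pd_fun_mul (h3 b) (h2 hx),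
    pd_fun_mul (h1 hx) (h4 b)] at h5
  simp only [hess, nabla1, grad, h5, pd_fun_mul (h1 hx) (h2 hx), Fin.sum_univ_two]
  ring

lemma pair_self_pos {x : E2} (hx : x ∈ U) {α : Comp1} (h : ∃ a, α a x ≠ 0) :
    0 < pair G α α x := by
  have h0 := hC.sum_metric_mul_raise hx α 0
  have h1 := hC.sum_metric_mul_raise hx α 1
  have hs := hC.symm_G x hx 1 0
  rw [Fin.sum_univ_two] at h0 h1
  have hp := hC.pos_G x hx
  have hd := hC.det_pos x hx
  rw [detG, hs] at hd
  rw [hs] at h1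
  -- Completing the square in the raised components; both $g_{00}$ and $\det g$ are positive.
  have e : G 0 0 x * pair G α α x = (G 0 0 x * raise G α 0 x + G 0 1 x * raise G α 1 x) ^ 2
      + (G 0 0 x * G 1 1 x - G 0 1 x * G 0 1 x) * raise G α 1 x ^ 2 := by
    rw [pair, Fin.sum_univ_two, ← h0, ← h1]
    ring
  refine pos_of_mul_pos_right (a := G 0 0 x) (lt_of_le_of_ne ?_ ?_) hp.le
  · rw [e]
    positivity
  · intro hz
    rw [e] at hz
    have e1 : raise G α 1 x = 0 := by
      by_contra hne
      have : 0 < (G 0 0 x * G 1 1 x - G 0 1 x * G 0 1 x) * raise G α 1 x ^ 2 := by positivity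
      nlinarith [sq_nonneg (G 0 0 x * raise G α 0 x + G 0 1 x * raise G α 1 x)]
    have e0 : raise G α 0 x = 0 := by
      rw [e1] at hz
      have : (G 0 0 x * raise G α 0 x) ^ 2 = 0 := by linear_combination -hz
      exact (mul_eq_zero.1 (pow_eq_zero_iff two_ne_zero |>.1 this)).resolve_left hp.ne'
    obtain ⟨a, ha⟩ := h
    rw [e0, e1] at h0 h1
    fin_cases a
    · exact ha (by simpa using h0.symm)
    · exact ha (by simpa using h1.symm)

/-- `Y` and `U` form an orthogonal frame. -/
lemma rho_mul_trace {x : E2} (hx : x ∈ U) (T : Comp2) : rhoScalar G P x * trace G T x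
    = eval2 G T (Uform G P) (Uform G P) x + eval2 G T (Yform G P) (Yform G P) x := by
  have u0 := hC.sqrt_det_mul_raise_U_zero (P := P) hx
  have u1 := hC.sqrt_det_mul_raise_U_one (P := P) hx
  have hd : detG G x * (detG G x)⁻¹ = 1 := mul_inv_cancel₀ (hC.det_ne hx)
  have hs := hC.sq_sqrt_det hx
  have h0 := hC.sum_metric_mul_raise hx (Yform G P) 0
  have h1 := hC.sum_metric_mul_raise hx (Yform G P) 1
  have hGs := hC.symm_G x hx 1 0
  rw [Fin.sum_univ_two] at h0 h1
  rw [hGs] at h1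
  have hsp := hC.sqrt_det_pos hx
  have e0 : raise G (Uform G P) 0 x = (Real.sqrt (detG G x))⁻¹ * Yform G P 1 x := by
    rw [← u0]; field_simp
  have e1 : raise G (Uform G P) 1 x = -((Real.sqrt (detG G x))⁻¹ * Yform G P 0 x) := by
    have : Yform G P 0 x = -(Real.sqrt (detG G x) * raise G (Uform G P) 1 x) := by
      rw [u1, neg_neg]
    rw [this]; field_simp
  have hsi : (Real.sqrt (detG G x))⁻¹ ^ 2 = (detG G x)⁻¹ := by rw [inv_pow, hs]
  simp only [eval2, trace, rhoScalar, pair, Fin.sum_univ_two, e0, e1, ginv_zero_zero, ginv_zero_one,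
    ginv_one_zero, ginv_one_one, div_eq_mul_inv _ (detG G x), hGs]
  set y0 := raise G (Yform G P) 0 x
  set y1 := raise G (Yform G P) 1 x
  set i := (Real.sqrt (detG G x))⁻¹
  have hdet : detG G x = G 0 0 x * G 1 1 x - G 0 1 x * G 0 1 x := by rw [detG, hGs]
  rw [← hsi] at hd ⊢
  rw [hdet] at hd
  rw [← h0, ← h1]
  linear_combination (T 0 0 x * y0 ^ 2 + T 0 1 x * y0 * y1 + T 1 0 x * y0 * y1
    + T 1 1 x * y1 ^ 2) * hd

lemma contDiffOn_f (hY : ∀ y ∈ U, rhoScalar G P y ≠ 0) : ContDiffOn ℝ ∞ (fScalar G P) U :=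
  (hC.contDiffOn_pair hC.contDiffOn_V hC.contDiffOn_Y).div hC.contDiffOn_rho hY

lemma contDiffOn_rho_rpow (hY : ∀ y ∈ U, rhoScalar G P y ≠ 0) (r : ℝ) :
    ContDiffOn ℝ ∞ (fun y => rhoScalar G P y ^ r) U :=
  hC.contDiffOn_rho.rpow_const_of_ne hY

lemma contDiffOn_rhoRoot (hY : ∀ y ∈ U, rhoScalar G P y ≠ 0) : ContDiffOn ℝ ∞ (rhoRoot G P) U :=
  hC.contDiffOn_rho_rpow hY _

lemma contDiffOn_odeForm (hY : ∀ y ∈ U, rhoScalar G P y ≠ 0) (a : Fin 2) :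
    ContDiffOn ℝ ∞ (odeForm G P a) U :=
  ((hC.contDiffOn_rhoRoot hY).pow 2).mul (hC.contDiffOn_U a)

lemma contDiffOn_tildeScalar (hY : ∀ y ∈ U, rhoScalar G P y ≠ 0) {α : Comp1}
    (hα : ∀ a, ContDiffOn ℝ ∞ (α a) U) : ContDiffOn ℝ ∞ (tildeScalar G P α) U :=
  ((hC.contDiffOn_eval2 hC.contDiffOn_P hα hα).sub
    ((hC.contDiffOn_eval2 (hC.contDiffOn_hess hC.contDiffOn_rho) hα hα).div
      (contDiffOn_const.mul hC.contDiffOn_rho) fun y hy => mul_ne_zero (by norm_num) (hY y hy))).add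
    ((contDiffOn_const.mul ((hC.contDiffOn_dirDeriv hα hC.contDiffOn_rho).pow 2)).div
      (contDiffOn_const.mul (hC.contDiffOn_rho.pow 2)) fun y hy =>
        mul_ne_zero (by norm_num) (pow_ne_zero 2 (hY y hy)))

lemma contDiffOn_odeCoeff0 (hY : ∀ y ∈ U, rhoScalar G P y ≠ 0) :
    ContDiffOn ℝ ∞ (odeCoeff0 G P) U :=
  ((hC.contDiffOn_tildeScalar hY hC.contDiffOn_U).sub
    (hC.contDiffOn_tildeScalar hY hC.contDiffOn_Y)).mul (hC.contDiffOn_rho_rpow hY _)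

lemma contDiffOn_odeCoeff1 (hY : ∀ y ∈ U, rhoScalar G P y ≠ 0) :
    ContDiffOn ℝ ∞ (odeCoeff1 G P) U :=
  ((contDiffOn_const.mul (hC.contDiffOn_f hY)).div_const 3).mul (hC.contDiffOn_rho_rpow hY _)

lemma contDiffOn_odeSystem (hY : ∀ y ∈ U, rhoScalar G P y ≠ 0) (i j k : Fin 2) :
    ContDiffOn ℝ ∞ (odeSystem G P i j k) U := by
  fin_cases j <;> fin_cases k
  · exact contDiffOn_const
  · exact hC.contDiffOn_odeForm hY i
  · exact ((hC.contDiffOn_odeCoeff0 hY).mul (hC.contDiffOn_odeForm hY i)).neg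
  · exact ((hC.contDiffOn_odeCoeff1 hY).mul (hC.contDiffOn_odeForm hY i)).neg

end IsMoebiusChart

end NonGeneric

/-! ### Identities in the frame $Y,U$ and powers of $\rho$. -/

section NonGenericFrame

open Set Filter

namespace IsMoebiusChart

variable {G P : Comp2} {U : Set E2} (hC : IsMoebiusChart G P U) {x : E2} (hx : x ∈ U)

include hC hx

/-- A `1`-form orthogonal to `Y` and `U` vanishes where `Y ≠ 0`. -/
lemma eq_zero_of_pair_Y_U (hY : rhoScalar G P x ≠ 0) {α : Comp1}
    (h1 : pair G α (Yform G P) x = 0) (h2 : pair G α (Uform G P) x = 0) (a : Fin 2) :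
    α a x = 0 := by
  have h3 := hC.pair_U_U (P := P) hx
  rw [pair_U] at h3
  rw [pair, Fin.sum_univ_two] at h1 h2
  have := eq_zero_of_two_by_two (a := raise G (Yform G P) 0 x) (b := raise G (Yform G P) 1 x)
    (c := raise G (Uform G P) 0 x) (d := raise G (Uform G P) 1 x) (y := α 0 x) (z := α 1 x)
    (fun h => hY (by rw [← h3]; linear_combination -Real.sqrt (detG G x) * h))
    (by linear_combination h1) (by linear_combination h2)
  fin_cases a
  exacts [this.1, this.2]

/-- `2 α^e Y^d ∇_e Y_d = α^e ∇_e ρ`. -/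
lemma two_mul_eval2_nabla_Y (α : Comp1) : 2 * eval2 G (nabla1 G (Yform G P)) α (Yform G P) x
    = dirDeriv G α (rhoScalar G P) x := by
  have h : ∀ e, pd e (rhoScalar G P) x = 2 * pair G (nabla1 G (Yform G P) e) (Yform G P) x := by
    intro e
    rw [rhoScalar, hC.pd_pair hx hC.contDiffOn_Y hC.contDiffOn_Y, hC.pair_comm hx (Yform G P)]
    ring
  simp only [dirDeriv, pair, grad, Fin.sum_univ_two, h, eval2]
  ring

lemma two_mul_eval2_nabla_U (α : Comp1) : 2 * eval2 G (nabla1 G (Uform G P)) α (Uform G P) x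
    = dirDeriv G α (rhoScalar G P) x := by
  have h : ∀ e, pd e (rhoScalar G P) x = 2 * pair G (nabla1 G (Uform G P) e) (Uform G P) x := by
    intro e
    rw [pd_congr_of_eqOn (v := pair G (Uform G P) (Uform G P)) hC.isOpen
      (fun y hy => (hC.pair_U_U hy).symm) hx e,
      hC.pd_pair hx hC.contDiffOn_U hC.contDiffOn_U, hC.pair_comm hx (Uform G P)]
    ring
  simp only [dirDeriv, pair, grad, Fin.sum_univ_two, h, eval2]
  ring

lemma eval2_nabla_U_Y_Y : eval2 G (nabla1 G (Uform G P)) (Yform G P) (Yform G P) x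
    = 2 * phiScalar G P x * rhoScalar G P x - dirDeriv G (Uform G P) (rhoScalar G P) x / 2 := by
  have h1 := hC.rho_mul_trace (P := P) hx (nabla1 G (Uform G P))
  have h2 := hC.two_mul_eval2_nabla_U (P := P) hx (Uform G P)
  have h3 : phiScalar G P x = trace G (nabla1 G (Uform G P)) x / 2 := rfl
  rw [h3]
  linear_combination -h1 - h2 / 2

/-- `6 μ ρ = Y^a ∇_a ρ` if `U_a V^a = 0`. -/
lemma six_mul_mu_mul_rho (hV : UV G P x = 0) : 6 * muScalar G P x * rhoScalar G P x
    = dirDeriv G (Yform G P) (rhoScalar G P) x := by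
  have h1 := hC.rho_mul_trace (P := P) hx (nabla1 G (Yform G P))
  have h2 := hC.two_mul_eval2_nabla_Y (P := P) hx (Yform G P)
  have h3 : muScalar G P x = trace G (nabla1 G (Yform G P)) x / 2 := rfl
  -- Vanishing of $U_aV^a$ gives $U^aU^b\nabla_aY_b=-\mu\rho$, the trace gives
  -- $U^aU^b\nabla_aY_b+Y^aY^b\nabla_aY_b=2\mu\rho$, and the $YY$ component is
  -- $\tfrac12Y^a\nabla_a\rho$.
  have h4 : UV G P x = eval2 G (nabla1 G (Yform G P)) (Uform G P) (Uform G P) x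
      + muScalar G P x * pair G (Uform G P) (Uform G P) x
      - 3 * phiScalar G P x * pair G (Yform G P) (Uform G P) x := by
    rw [UV, hC.pair_comm hx]
    simp only [pair, eval2, Vform, Fin.sum_univ_two]
    ring
  rw [hV, hC.pair_comm hx (Yform G P), pair_U_Y, hC.pair_U_U hx] at h4
  linear_combination -2 * h4 + 2 * h1 + h2 + 4 * rhoScalar G P x * h3

/-- `f ρ = ½ U^a ∇_a ρ - 3 φ ρ`. -/
lemma f_mul_rho (hY : rhoScalar G P x ≠ 0) : fScalar G P x * rhoScalar G P x
    = dirDeriv G (Uform G P) (rhoScalar G P) x / 2 - 3 * phiScalar G P x * rhoScalar G P x := by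
  have h2 := hC.two_mul_eval2_nabla_Y (P := P) hx (Uform G P)
  have h4 : pair G (Vform G P) (Yform G P) x = eval2 G (nabla1 G (Yform G P)) (Uform G P)
      (Yform G P) x + muScalar G P x * pair G (Uform G P) (Yform G P) x
      - 3 * phiScalar G P x * rhoScalar G P x := by
    simp only [rhoScalar, pair, eval2, Vform, Fin.sum_univ_two]
    ring
  rw [pair_U_Y] at h4
  rw [fScalar, div_mul_cancel₀ _ hY]
  linear_combination h4 + h2 / 2

/-- `V_a = f Y_a` if `U_a V^a = 0`. -/
lemma V_eq_f_mul_Y (hY : rhoScalar G P x ≠ 0) (hV : UV G P x = 0) (a : Fin 2) :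
    Vform G P a x = fScalar G P x * Yform G P a x := by
  refine sub_eq_zero.1 (hC.eq_zero_of_pair_Y_U hx hY
    (α := fun a y => Vform G P a y - fScalar G P y * Yform G P a y) ?_ ?_ a)
  · have h1 : fScalar G P x * rhoScalar G P x = pair G (Vform G P) (Yform G P) x :=
      div_mul_cancel₀ _ hY
    simp only [rhoScalar, pair, Fin.sum_univ_two] at h1 ⊢
    linear_combination -h1
  · have h2 := pair_U_Y (G := G) (P := P) (x := x)
    rw [UV, hC.pair_comm hx] at hV
    rw [hC.pair_comm hx] at h2
    simp only [pair, Fin.sum_univ_two] at hV h2 ⊢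
    linear_combination hV - fScalar G P x * h2

/-! The function `ρ^{-1/6}`. -/

-- All fractional powers of $\rho$ become integer powers of $r=\rho^{-1/6}$, subject to the single
-- relation $\rho r^6=1$. Later identities are then polynomial.
omit hC hx in
lemma rho_mul_rhoRoot_pow (hY : 0 < rhoScalar G P x) :
    rhoScalar G P x * rhoRoot G P x ^ 6 = 1 := by
  rw [rhoRoot, ← Real.rpow_natCast, ← Real.rpow_mul hY.le]
  norm_num
  rw [Real.rpow_neg_one]
  exact mul_inv_cancel₀ hY.ne'

omit hC hx in
lemma rhoRoot_pos (hY : 0 < rhoScalar G P x) : 0 < rhoRoot G P x := Real.rpow_pos_of_pos hY _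

omit hC hx in
lemma rpow_eq_rhoRoot_pow (hY : 0 < rhoScalar G P x) (n : ℕ) (s : ℝ) (hs : s = -(1 / 6) * n) :
    rhoScalar G P x ^ s = rhoRoot G P x ^ n := by
  rw [rhoRoot, ← Real.rpow_natCast, ← Real.rpow_mul hY.le, hs]

omit hC hx in
lemma odeCoeff1_eq (hY : 0 < rhoScalar G P x) :
    odeCoeff1 G P x = 2 * fScalar G P x / 3 * rhoRoot G P x ^ 4 := by
  rw [odeCoeff1, rpow_eq_rhoRoot_pow hY 4 _ (by norm_num)]

omit hC hx in
lemma odeCoeff0_eq (hY : 0 < rhoScalar G P x) :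
    odeCoeff0 G P x = (Rtilde G P x - Qtilde G P x) * rhoRoot G P x ^ 8 := by
  rw [odeCoeff0, rpow_eq_rhoRoot_pow hY 8 _ (by norm_num)]

lemma pd_rhoRoot (hY : 0 < rhoScalar G P x) (a : Fin 2) :
    6 * rhoScalar G P x * pd a (rhoRoot G P) x = -(rhoRoot G P x * pd a (rhoScalar G P) x) := by
  have hd := differentiableAt_of_contDiffOn hC.isOpen (hC.contDiffOn_rho) hx
  have h1 := pd_scomp (Real.hasDerivAt_rpow_const (p := -(1 / 6)) (Or.inl hY.ne')) hd a
  have h2 : rhoScalar G P x * rhoScalar G P x ^ (-(1 / 6) - 1 : ℝ) = rhoRoot G P x := by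
    rw [rhoRoot, Real.rpow_sub_one hY.ne']
    field_simp
  have h3 : pd a (rhoRoot G P) x
      = -(1 / 6) * rhoScalar G P x ^ (-(1 / 6) - 1 : ℝ) * pd a (rhoScalar G P) x := h1
  rw [h3]
  linear_combination -pd a (rhoScalar G P) x * h2

/-- This is the origin of the constants in $\tilde Q$ and $\tilde R$: for the exponent $s=-1/6$ one
has $s(s-1)=7/36$. -/
lemma hess_rhoRoot (hY : ∀ y ∈ U, 0 < rhoScalar G P y) (a b : Fin 2) :
    hess G (rhoRoot G P) a b x = rhoRoot G P x * (-(hess G (rhoScalar G P) a b x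
      / (6 * rhoScalar G P x)) + 7 * (pd a (rhoScalar G P) x * pd b (rhoScalar G P) x)
        / (36 * rhoScalar G P x ^ 2)) := by
  have hr := hC.contDiffOn_rhoRoot fun y hy => (hY y hy).ne'
  have hd := differentiableAt_of_contDiffOn hC.isOpen hC.contDiffOn_rho hx
  have hdr := differentiableAt_of_contDiffOn hC.isOpen hr hx
  have hd' := fun a => differentiableAt_of_contDiffOn hC.isOpen
    (contDiffOn_pd hC.isOpen hC.contDiffOn_rho a) hx
  have hdr' := fun a => differentiableAt_of_contDiffOn hC.isOpen (contDiffOn_pd hC.isOpen hr a) hx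
  have h1 := pd_congr_of_eqOn hC.isOpen (fun y hy => hC.pd_rhoRoot hy (hY y hy) b) hx a
  rw [pd_fun_mul ((differentiableAt_const _).fun_mul hd) (hdr' b),
    pd_fun_mul (differentiableAt_const _) hd, pd_const, pd_fun_neg, pd_fun_mul hdr (hd' b)] at h1
  have e0 := hC.pd_rhoRoot hx (hY x hx) 0
  have e1 := hC.pd_rhoRoot hx (hY x hx) 1
  have ea := hC.pd_rhoRoot hx (hY x hx) a
  have eb := hC.pd_rhoRoot hx (hY x hx) b
  have hne := (hY x hx).ne'
  have key : 36 * rhoScalar G P x ^ 2 * hess G (rhoRoot G P) a b x = rhoRoot G P x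
      * (-(6 * rhoScalar G P x * hess G (rhoScalar G P) a b x)
        + 7 * (pd a (rhoScalar G P) x * pd b (rhoScalar G P) x)) := by
    simp only [hess, nabla1, grad, Fin.sum_univ_two]
    linear_combination 6 * rhoScalar G P x * h1
      - 6 * pd a (rhoScalar G P) x * eb - pd b (rhoScalar G P) x * ea
      - 6 * rhoScalar G P x * christoffel G 0 a b x * e0
      - 6 * rhoScalar G P x * christoffel G 1 a b x * e1
  have h36 : 36 * rhoScalar G P x ^ 2 ≠ 0 := mul_ne_zero (by norm_num) (pow_ne_zero 2 hne)
  refine mul_left_cancel₀ h36 (key.trans ?_)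
  field_simp
  ring

/-- `ρ^{-1/3} U_a` is closed if `U_a V^a = 0`. -/
lemma pd_odeForm (hY : ∀ y ∈ U, 0 < rhoScalar G P y) (hV : UV G P x = 0) :
    pd 0 (odeForm G P 1) x = pd 1 (odeForm G P 0) x := by
  have hr := hC.contDiffOn_rhoRoot fun y hy => (hY y hy).ne'
  have hdr := differentiableAt_of_contDiffOn hC.isOpen hr hx
  have hU := fun a => differentiableAt_of_contDiffOn hC.isOpen (hC.contDiffOn_U a) hx
  have h1 : ∀ i a, pd i (odeForm G P a) x = 2 * rhoRoot G P x * pd i (rhoRoot G P) x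
      * Uform G P a x + rhoRoot G P x ^ 2 * pd i (Uform G P a) x := by
    intro i a
    have h2 : odeForm G P a = fun y => rhoRoot G P y * (rhoRoot G P y * Uform G P a y) := by
      funext y
      simp only [odeForm]
      ring
    rw [h2, pd_fun_mul hdr (hdr.fun_mul (hU a)), pd_fun_mul hdr (hU a)]
    ring
  rw [h1, h1]
  have e0 := hC.pd_rhoRoot hx (hY x hx) 0
  have e1 := hC.pd_rhoRoot hx (hY x hx) 1
  have h2 := hC.pd_U hx
  have h3 := hC.six_mul_mu_mul_rho hx hV
  simp only [dirDeriv, pair, grad, Fin.sum_univ_two] at h3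
  have h6 : (3 * rhoScalar G P x) ≠ 0 := mul_ne_zero (by norm_num) (hY x hx).ne'
  refine mul_left_cancel₀ h6 ?_
  rw [U_zero, U_one]
  linear_combination 3 * rhoScalar G P x * rhoRoot G P x ^ 2 * h2
    - rhoRoot G P x * Real.sqrt (detG G x) * raise G (Yform G P) 0 x * e0
    - rhoRoot G P x * Real.sqrt (detG G x) * raise G (Yform G P) 1 x * e1
    - rhoRoot G P x ^ 2 * Real.sqrt (detG G x) * h3

/-- The connection is a matrix of functions times the closed form $\omega=\rho^{-1/3}U$, so its
quadratic terms commute. What remains is $dc\wedge\omega$ for each coefficient $c$, proportional to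
$Y^a\nabla_ac$ because $U$ is dual to $Y$. -/
lemma odeSystem_flat (hY : ∀ y ∈ U, 0 < rhoScalar G P y) (hV : UV G P x = 0)
    (h1 : dirDeriv G (Yform G P) (odeCoeff1 G P) x = 0)
    (h0 : dirDeriv G (Yform G P) (odeCoeff0 G P) x = 0) (j k : Fin 2) :
    pd 0 (odeSystem G P 1 j k) x + ∑ l, odeSystem G P 1 j l x * odeSystem G P 0 l k x
      = pd 1 (odeSystem G P 0 j k) x + ∑ l, odeSystem G P 0 j l x * odeSystem G P 1 l k x := by
  have hY' := fun y hy => (hY y hy).ne'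
  have hω := hC.pd_odeForm hx hY hV
  have hdω := fun a => differentiableAt_of_contDiffOn hC.isOpen (hC.contDiffOn_odeForm hY' a) hx
  have hd0 := differentiableAt_of_contDiffOn hC.isOpen (hC.contDiffOn_odeCoeff0 hY') hx
  have hd1 := differentiableAt_of_contDiffOn hC.isOpen (hC.contDiffOn_odeCoeff1 hY') hx
  have w0 : odeForm G P 0 x
      = rhoRoot G P x ^ 2 * (Real.sqrt (detG G x) * raise G (Yform G P) 1 x) := by
    rw [odeForm, U_zero]
  have w1 : odeForm G P 1 x
      = -(rhoRoot G P x ^ 2 * (Real.sqrt (detG G x) * raise G (Yform G P) 0 x)) := by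
    rw [odeForm, U_one]
    ring
  simp only [dirDeriv, pair, grad, Fin.sum_univ_two] at h0 h1
  simp only [odeSystem, Fin.sum_univ_two]
  fin_cases j <;> fin_cases k
  · simp [pd_const]
    ring
  · simp
    linear_combination hω
  · simp [pd_fun_neg, pd_fun_mul hd0 (hdω _)]
    linear_combination -odeCoeff0 G P x * hω - pd 0 (odeCoeff0 G P) x * w1
      + pd 1 (odeCoeff0 G P) x * w0 + rhoRoot G P x ^ 2 * Real.sqrt (detG G x) * h0
  · simp [pd_fun_neg, pd_fun_mul hd1 (hdω _)]
    linear_combination -odeCoeff1 G P x * hω - pd 0 (odeCoeff1 G P) x * w1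
      + pd 1 (odeCoeff1 G P) x * w0 + rhoRoot G P x ^ 2 * Real.sqrt (detG G x) * h1

end IsMoebiusChart

end NonGenericFrame

/-! ### Equivalence of the equation with the rank two system. -/

section NonGenericSolutions

open Set Filter

namespace IsMoebiusChart

variable {G P : Comp2} {U : Set E2} (hC : IsMoebiusChart G P U)

include hC

section Pointwise

variable {x : E2} (hx : x ∈ U) (hY : ∀ y ∈ U, 0 < rhoScalar G P y)

include hx hY

/-- $\tilde Q$ and $\tilde R$ are what the operator $\nabla\nabla+\mathrm P$ produces from
$\rho^{-1/6}$ in the directions $Y$ and $U$. This is why they become the zeroth order coefficient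
after substituting $\sigma=\rho^{-1/6}\xi$. -/
lemma rhoRoot_mul_tildeScalar (α : Comp1) : rhoRoot G P x * tildeScalar G P α x
    = eval2 G (fun a b y => hess G (rhoRoot G P) a b y + P a b y * rhoRoot G P y) α α x := by
  simp only [tildeScalar, eval2, dirDeriv, pair, grad, Fin.sum_univ_two, hC.hess_rhoRoot hx hY]
  ring

lemma dirDeriv_rhoRoot (α : Comp1) : 6 * rhoScalar G P x * dirDeriv G α (rhoRoot G P) x
    = -(rhoRoot G P x * dirDeriv G α (rhoScalar G P) x) := by
  have e0 := hC.pd_rhoRoot hx (hY x hx) 0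
  have e1 := hC.pd_rhoRoot hx (hY x hx) 1
  simp only [dirDeriv, pair, grad, Fin.sum_univ_two]
  linear_combination raise G α 0 x * e0 + raise G α 1 x * e1

lemma eval2_rhoRoot_mul {ξ : Comp0} (hξ : ContDiffOn ℝ ∞ ξ U) (α : Comp1) :
    eval2 G (fun a b y => hess G (fun z => rhoRoot G P z * ξ z) a b y
      + P a b y * (rhoRoot G P y * ξ y)) α α x
      = rhoRoot G P x * tildeScalar G P α x * ξ x
        + 2 * dirDeriv G α (rhoRoot G P) x * dirDeriv G α ξ x
        + rhoRoot G P x * eval2 G (hess G ξ) α α x := by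
  have hr := hC.contDiffOn_rhoRoot fun y hy => (hY y hy).ne'
  rw [hC.rhoRoot_mul_tildeScalar hx hY]
  simp only [eval2, hC.hess_mul hr hξ hx, dirDeriv, pair, grad, Fin.sum_univ_two]
  ring

lemma eval2_hess_of_grad {ξ s : Comp0} (hs : DifferentiableAt ℝ s x)
    (h : ∀ᶠ y in 𝓝 x, ∀ a, pd a ξ y = s y * odeForm G P a y) (α : Comp1) :
    eval2 G (hess G ξ) α α x = dirDeriv G α s x * rhoRoot G P x ^ 2 * pair G (Uform G P) α x
      + s x * (2 * rhoRoot G P x * dirDeriv G α (rhoRoot G P) x * pair G (Uform G P) α x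
        + rhoRoot G P x ^ 2 * eval2 G (nabla1 G (Uform G P)) α α x) := by
  have hr := hC.contDiffOn_rhoRoot fun y hy => (hY y hy).ne'
  have hdr := differentiableAt_of_contDiffOn hC.isOpen hr hx
  have hU := fun a => differentiableAt_of_contDiffOn hC.isOpen (hC.contDiffOn_U a) hx
  have h1 : ∀ a b, pd a (pd b ξ) x = pd a s x * (rhoRoot G P x ^ 2 * Uform G P b x)
      + s x * (2 * rhoRoot G P x * pd a (rhoRoot G P) x * Uform G P b x
        + rhoRoot G P x ^ 2 * pd a (Uform G P b) x) := by
    intro a b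
    rw [pd_congr (v := fun y => s y * (rhoRoot G P y * (rhoRoot G P y * Uform G P b y)))
      (h.mono fun y hy => by simp only [hy b, odeForm]; ring) a,
      pd_fun_mul hs (hdr.fun_mul (hdr.fun_mul (hU b))), pd_fun_mul hdr (hdr.fun_mul (hU b)),
      pd_fun_mul hdr (hU b)]
    ring
  simp only [eval2, hess, nabla1, grad, h1, h.self_of_nhds, odeForm, dirDeriv, pair,
    Fin.sum_univ_two]
  ring

/-- The trace-free part of the equation in the frame, `U U - Y Y` component. -/
lemma eval2_sub_eval2 {ξ s : Comp0} (hξ : ContDiffOn ℝ ∞ ξ U) (hs : DifferentiableAt ℝ s x)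
    (h : ∀ᶠ y in 𝓝 x, ∀ a, pd a ξ y = s y * odeForm G P a y) :
    eval2 G (fun a b y => hess G (fun z => rhoRoot G P z * ξ z) a b y
      + P a b y * (rhoRoot G P y * ξ y)) (Uform G P) (Uform G P) x
    - eval2 G (fun a b y => hess G (fun z => rhoRoot G P z * ξ z) a b y
      + P a b y * (rhoRoot G P y * ξ y)) (Yform G P) (Yform G P) x
      = rhoRoot G P x ^ 3 * rhoScalar G P x * (dirDeriv G (Uform G P) s x
        + (odeCoeff1 G P x * s x + odeCoeff0 G P x * ξ x)
          * (rhoRoot G P x ^ 2 * rhoScalar G P x)) := by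
  have hd : ∀ α : Comp1, dirDeriv G α ξ x = s x * rhoRoot G P x ^ 2 * pair G (Uform G P) α x := by
    intro α
    simp only [dirDeriv, pair, grad, h.self_of_nhds, odeForm, Fin.sum_univ_two]
    ring
  rw [hC.eval2_rhoRoot_mul hx hY hξ, hC.eval2_rhoRoot_mul hx hY hξ, hd, hd,
    hC.eval2_hess_of_grad hx hY hs h, hC.eval2_hess_of_grad hx hY hs h, hC.pair_U_U hx,
    pair_U_Y, hC.eval2_nabla_U_Y_Y hx, odeCoeff1_eq (hY x hx), odeCoeff0_eq (hY x hx)]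
  have h1 := hC.two_mul_eval2_nabla_U (P := P) hx (Uform G P)
  have h2 := hC.f_mul_rho hx (hY x hx).ne'
  have h3 := hC.dirDeriv_rhoRoot hx hY (Uform G P)
  have h4 := rho_mul_rhoRoot_pow (hY x hx)
  have h5 : tildeScalar G P (Uform G P) x = Rtilde G P x := rfl
  have h6 : tildeScalar G P (Yform G P) x = Qtilde G P x := rfl
  rw [h5, h6]
  -- The first order terms involve $U^a\nabla_a\rho$ and $\phi$; `f_mul_rho` combines them into the
  -- multiple $2f/3$ of $s$.
  linear_combination (2 / 3) * s x * rhoRoot G P x ^ 2 * h3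
    + s x * rhoRoot G P x ^ 3 / 2 * h1 - (2 / 3) * s x * rhoRoot G P x ^ 3 * h2
    - (2 / 3) * s x * rhoRoot G P x ^ 3 * fScalar G P x * rhoScalar G P x * h4
    - rhoRoot G P x * (Rtilde G P x - Qtilde G P x) * ξ x
      * (rhoScalar G P x * rhoRoot G P x ^ 6 + 1) * h4

/-- A symmetric tensor is a multiple of the metric if its trace-free components in the frame
vanish. -/
lemma traceFree_eq_zero_of_frame {T : Comp2} (hT : T 1 0 x = T 0 1 x)
    (h1 : eval2 G T (Uform G P) (Yform G P) x = 0)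
    (h2 : eval2 G T (Uform G P) (Uform G P) x = eval2 G T (Yform G P) (Yform G P) x)
    (a b : Fin 2) : traceFree G T a b x = 0 := by
  have hne := (hY x hx).ne'
  have hYU : pair G (Yform G P) (Uform G P) x = 0 := by rw [hC.pair_comm hx, pair_U_Y]
  have hlow : ∀ α β : Comp1, eval2 G (traceFree G T) α β x
      = eval2 G T α β x - 1 / 2 * trace G T x * pair G α β x := by
    intro α β
    have h5 := hC.sum_metric_mul_raise hx α
    have hGs := hC.symm_G x hx 1 0
    simp only [eval2, traceFree, pair, Fin.sum_univ_two] at h5 ⊢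
    rw [← h5 0, ← h5 1, hGs]
    ring
  have htr := hC.rho_mul_trace (P := P) hx T
  have e1 : eval2 G (traceFree G T) (Uform G P) (Yform G P) x = 0 := by
    rw [hlow, h1, pair_U_Y]
    ring
  have e2 : eval2 G (traceFree G T) (Uform G P) (Uform G P) x = 0 := by
    rw [hlow, hC.pair_U_U hx]
    linear_combination -htr / 2 + h2 / 2
  have e3 : eval2 G (traceFree G T) (Yform G P) (Yform G P) x = 0 := by
    rw [hlow]
    have : pair G (Yform G P) (Yform G P) x = rhoScalar G P x := rfl
    rw [this]
    linear_combination -htr / 2 - h2 / 2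
  have hsym : ∀ a b, traceFree G T a b x = traceFree G T b a x := by
    have h3 : traceFree G T 1 0 x = traceFree G T 0 1 x := by
      simp only [traceFree, hT, hC.symm_G x hx 1 0]
    intro a b
    fin_cases a <;> fin_cases b
    · rfl
    · exact h3.symm
    · exact h3
    · rfl
  have h4 : ∀ β : Comp1, eval2 G (traceFree G T) (Yform G P) β x = 0 →
      eval2 G (traceFree G T) (Uform G P) β x = 0 →
      ∀ a, pair G (traceFree G T a) β x = 0 := by
    intro β hβ1 hβ2
    refine hC.eq_zero_of_pair_Y_U hx hne (α := fun a y => pair G (traceFree G T a) β y) ?_ ?_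
    · simp only [eval2, pair, Fin.sum_univ_two] at hβ1 ⊢
      linear_combination hβ1
    · simp only [eval2, pair, Fin.sum_univ_two] at hβ2 ⊢
      linear_combination hβ2
  have e1' : eval2 G (traceFree G T) (Yform G P) (Uform G P) x = 0 := by
    have := hsym 0 1
    simp only [eval2, Fin.sum_univ_two] at e1 ⊢
    rw [this] at e1 ⊢
    linear_combination e1
  exact hC.eq_zero_of_pair_Y_U hx hne (h4 _ e3 e1 a) (h4 _ e1' e2 a) b

end Pointwise

/-- A solution of the linear system of the non-generic case yields a solution of the
conformal-to-Einstein equation. -/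
lemma confEinstein_of_solvesAt_odeSystem (hY : ∀ y ∈ U, 0 < rhoScalar G P y)
    (hV : ∀ y ∈ U, UV G P y = 0)
    {W : Fin 2 → Comp0} (hW : ∀ y ∈ U, SolvesAt (odeSystem G P) W y) {x : E2} (hx : x ∈ U)
    (hk : kScalar G P x + fScalar G P x * muScalar G P x = 0) (a b : Fin 2) :
    confEinstein G P (fun y => rhoRoot G P y * W 0 y) a b x = 0 := by
  have hne := fun y hy => (hY y hy).ne'
  have hr := hC.contDiffOn_rhoRoot hne
  have hsm := contDiffOn_of_solvesAt hC.isOpen (hC.contDiffOn_odeSystem hne) hW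
  have hu : ContDiffOn ℝ ∞ (fun y => rhoRoot G P y * W 0 y) U := hr.mul (hsm 0)
  have h0 : ∀ y ∈ U, ∀ a, pd a (W 0) y = W 1 y * odeForm G P a y := by
    intro y hy a
    rw [((hW y hy) 0).2 a, Fin.sum_univ_two]
    simp [odeSystem, mul_comm]
  have h0' : ∀ᶠ y in 𝓝 x, ∀ a, pd a (W 0) y = W 1 y * odeForm G P a y := by
    filter_upwards [hC.isOpen.mem_nhds hx] with y hy using h0 y hy
  have hcon : ∀ y ∈ U, pair G (grad fun y => rhoRoot G P y * W 0 y) (Yform G P) y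
      + muScalar G P y * (rhoRoot G P y * W 0 y) = 0 := by
    intro y hy
    have hd := fun a => pd_fun_mul (differentiableAt_of_contDiffOn hC.isOpen hr hy)
      (differentiableAt_of_contDiffOn hC.isOpen (hsm 0) hy) a
    have h1 := hC.dirDeriv_rhoRoot hy hY (Yform G P)
    have h2 := hC.six_mul_mu_mul_rho hy (hV y hy)
    have h3 := pair_U_Y (G := G) (P := P) (x := y)
    have h6 : 6 * rhoScalar G P y ≠ 0 := mul_ne_zero (by norm_num) (hne y hy)
    refine (mul_eq_zero.1 (?_ : 6 * rhoScalar G P y * _ = 0)).resolve_left h6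
    simp only [pair, grad, dirDeriv, Fin.sum_univ_two, hd, h0 y hy, odeForm] at h1 h2 h3 ⊢
    linear_combination W 0 y * h1 + rhoRoot G P y * W 0 y * h2
      + 6 * rhoScalar G P y * rhoRoot G P y ^ 3 * W 1 y * h3
  have hsymm : hess G (fun y => rhoRoot G P y * W 0 y) 1 0 x
      = hess G (fun y => rhoRoot G P y * W 0 y) 0 1 x := by
    simp only [hess, nabla1, grad, Fin.sum_univ_two, hC.christoffel_symm hx _ 1 0]
    rw [pd_comm (contDiffAt_two_of_contDiffOn hC.isOpen hu hx) 1 0]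
  refine hC.traceFree_eq_zero_of_frame hx hY ?_ ?_ ?_ a b
  · simp only [hsymm, hC.symm_P x hx 1 0]
  -- The $UY$ component is $k\sigma-V^a\nabla_a\sigma=k\sigma-fY^a\nabla_a\sigma=(k+f\mu)\sigma$, so
  -- the scalar obstruction is exactly what it needs. The $UU-YY$ component below is the ODE.
  · rw [hC.eval2_U_Y hx hu (by filter_upwards [hC.isOpen.mem_nhds hx] with y hy using hcon y hy)]
    have h1 : pair G (Vform G P) (grad fun y => rhoRoot G P y * W 0 y) x = fScalar G P x
        * pair G (Yform G P) (grad fun y => rhoRoot G P y * W 0 y) x := by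
      simp only [pair, hC.V_eq_f_mul_Y hx (hne x hx) (hV x hx), Fin.sum_univ_two]
      ring
    have h2 := hcon x hx
    rw [hC.pair_comm hx] at h2
    rw [h1]
    linear_combination rhoRoot G P x * W 0 x * hk - fScalar G P x * h2
  · have h1 := hC.eval2_sub_eval2 hx hY (hsm 0)
      (differentiableAt_of_contDiffOn hC.isOpen (hsm 1) hx) h0'
    have h2 : dirDeriv G (Uform G P) (W 1) x = -((odeCoeff1 G P x * W 1 x
        + odeCoeff0 G P x * W 0 x) * (rhoRoot G P x ^ 2 * rhoScalar G P x)) := by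
      have h3 := fun i => ((hW x hx) 1).2 i
      have h4 := hC.pair_U_U (P := P) hx
      simp only [odeSystem, Fin.sum_univ_two, Matrix.cons_val, odeForm] at h3
      simp only [dirDeriv, pair, grad, Fin.sum_univ_two, h3] at h4 ⊢
      linear_combination -(odeCoeff1 G P x * W 1 x + odeCoeff0 G P x * W 0 x)
        * rhoRoot G P x ^ 2 * h4
    rw [h2] at h1
    linear_combination h1

/-- In the non-generic case a solution `σ` gives a solution `(ξ, ξ_η)`, `σ = ρ^{-1/6} ξ`, of the
linear system. -/
lemma exists_solvesAt_odeSystem (hY : ∀ y ∈ U, 0 < rhoScalar G P y) (hV : ∀ y ∈ U, UV G P y = 0)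
    {u : Comp0} (hu : ContDiffOn ℝ ∞ u U) (h : ∀ y ∈ U, ∀ a b, confEinstein G P u a b y = 0) :
    ∃ W : Fin 2 → Comp0, ∀ x ∈ U, SolvesAt (odeSystem G P) W x ∧ u x = rhoRoot G P x * W 0 x := by
  have hne := fun y hy => (hY y hy).ne'
  have hr := hC.contDiffOn_rhoRoot hne
  have hchart : ∀ y ∈ U, ∀ᶠ z in 𝓝 y, ChartSolution G P u z := fun y hy => by
    filter_upwards [hC.isOpen.mem_nhds hy] with z hz
    exact ⟨hu.contDiffAt (hC.isOpen.mem_nhds hz), h z hz⟩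
  -- By $\rho r^6=1$ the factor $\rho r^5$ is $1/r$. Likewise $\omega_aU^a=r^2\rho=r^{-4}$, so
  -- $s=r^4U^a\nabla_a\xi$ is the derivative of $\xi$ with respect to $\eta$.
  set ξ : Comp0 := fun y => rhoScalar G P y * rhoRoot G P y ^ 5 * u y with hξdef
  set s : Comp0 := fun y => rhoRoot G P y ^ 4 * dirDeriv G (Uform G P) ξ y with hsdef
  have hξ : ContDiffOn ℝ ∞ ξ U := (hC.contDiffOn_rho.mul (hr.pow 5)).mul hu
  have hs : ContDiffOn ℝ ∞ s U := (hr.pow 4).mul (hC.contDiffOn_dirDeriv hC.contDiffOn_U hξ)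
  have huξ : ∀ y ∈ U, u y = rhoRoot G P y * ξ y := by
    intro y hy
    simp only [hξdef]
    linear_combination -u y * rho_mul_rhoRoot_pow (hY y hy)
  have hYξ : ∀ y ∈ U, dirDeriv G (Yform G P) ξ y = 0 := by
    intro y hy
    have hd := fun a => (pd_congr_of_eqOn hC.isOpen huξ hy a).trans
      (pd_fun_mul (differentiableAt_of_contDiffOn hC.isOpen hr hy)
        (differentiableAt_of_contDiffOn hC.isOpen hξ hy) a)
    have h1 := hC.dirDeriv_rhoRoot hy hY (Yform G P)
    have h2 := hC.six_mul_mu_mul_rho hy (hV y hy)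
    have h3 := hC.constraint hy (hchart y hy)
    have h6 : 6 * rhoScalar G P y * rhoRoot G P y ≠ 0 :=
      mul_ne_zero (mul_ne_zero (by norm_num) (hne y hy)) (rhoRoot_pos (hY y hy)).ne'
    refine (mul_eq_zero.1 (?_ : 6 * rhoScalar G P y * rhoRoot G P y * _ = 0)).resolve_left h6
    simp only [pair, grad, dirDeriv, Fin.sum_univ_two, hd, huξ y hy] at h1 h2 h3 ⊢
    linear_combination 6 * rhoScalar G P y * h3 - ξ y * h1 - rhoRoot G P y * ξ y * h2
  have hdξ : ∀ y ∈ U, ∀ a, pd a ξ y = s y * odeForm G P a y := by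
    intro y hy a
    have h1 := hYξ y hy
    have h2 := pair_U_Y (G := G) (P := P) (x := y)
    have h3 := hC.pair_U_U (P := P) hy
    have h4 := rho_mul_rhoRoot_pow (hY y hy)
    refine sub_eq_zero.1 (hC.eq_zero_of_pair_Y_U hy (hne y hy)
      (α := fun a y => pd a ξ y - s y * odeForm G P a y) ?_ ?_ a)
    · simp only [dirDeriv, pair, grad, Fin.sum_univ_two, odeForm] at h1 h2 ⊢
      linear_combination h1 - s y * rhoRoot G P y ^ 2 * h2
    · have h5 : s y = rhoRoot G P y ^ 4 * dirDeriv G (Uform G P) ξ y := rfl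
      simp only [dirDeriv, pair, grad, Fin.sum_univ_two, odeForm] at h3 h5 ⊢
      linear_combination -s y * rhoRoot G P y ^ 2 * h3
        - rhoScalar G P y * rhoRoot G P y ^ 2 * h5
        - (pd 0 ξ y * raise G (Uform G P) 0 y + pd 1 ξ y * raise G (Uform G P) 1 y) * h4
  refine ⟨![ξ, s], fun x hx => ⟨?_, huξ x hx⟩⟩
  have hdx : ∀ᶠ y in 𝓝 x, ∀ a, pd a ξ y = s y * odeForm G P a y := by
    filter_upwards [hC.isOpen.mem_nhds hx] with y hy using hdξ y hy
  have hds := differentiableAt_of_contDiffOn hC.isOpen hs hx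
  have hdω := fun a => differentiableAt_of_contDiffOn hC.isOpen (hC.contDiffOn_odeForm hne a) hx
  -- Since $d\xi=s\omega$ and $\omega$ is closed, $ds\wedge\omega=0$; as $\omega$ is proportional to
  -- the dual of $Y$, $s$ is constant along $Y$.
  have hYs : dirDeriv G (Yform G P) s x = 0 := by
    have h1 := pd_comm (contDiffAt_two_of_contDiffOn hC.isOpen hξ hx) 0 1
    rw [pd_congr (v := fun y => s y * odeForm G P 1 y) (hdx.mono fun y hy => hy 1) 0,
      pd_congr (v := fun y => s y * odeForm G P 0 y) (hdx.mono fun y hy => hy 0) 1,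
      pd_fun_mul hds (hdω 1), pd_fun_mul hds (hdω 0), hC.pd_odeForm hx hY (hV x hx)] at h1
    simp only [odeForm, U_zero, U_one] at h1
    have h2 : Real.sqrt (detG G x) * rhoRoot G P x ^ 2 ≠ 0 :=
      mul_ne_zero (hC.sqrt_det_pos hx).ne' (pow_ne_zero 2 (rhoRoot_pos (hY x hx)).ne')
    refine (mul_eq_zero.1 (?_ : Real.sqrt (detG G x) * rhoRoot G P x ^ 2 * _ = 0)).resolve_left h2
    simp only [dirDeriv, pair, grad, Fin.sum_univ_two]
    linear_combination -h1
  have hUs : dirDeriv G (Uform G P) s x + (odeCoeff1 G P x * s x + odeCoeff0 G P x * ξ x)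
      * (rhoRoot G P x ^ 2 * rhoScalar G P x) = 0 := by
    -- $U$ and $Y$ have equal length, so the pure trace term drops out of the difference and only
    -- the ODE is left.
    have h1 := hC.eval2_sub_eval2 hx hY hξ hds hdx
    obtain ⟨ψ, hψ⟩ := (confEinstein_eq_zero_iff (hC.det_ne hx) (hC.symm_G x hx 1 0)).1 (by
      intro a b
      rw [← confEinstein_congr G P (u := u)]
      · exact h x hx a b
      · filter_upwards [hC.isOpen.mem_nhds hx] with y hy using huξ y hy)
    have h2 : ∀ α : Comp1, eval2 G (fun a b y => hess G (fun z => rhoRoot G P z * ξ z) a b y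
        + P a b y * (rhoRoot G P y * ξ y)) α α x = ψ * pair G α α x := by
      intro α
      have h5 := hC.sum_metric_mul_raise hx α
      simp only [eval2, hψ, pair, Fin.sum_univ_two] at h5 ⊢
      rw [← h5 0, ← h5 1]
      have hGs := hC.symm_G x hx 1 0
      rw [hGs]
      ring
    rw [h2, h2, hC.pair_U_U hx] at h1
    have h3 : pair G (Yform G P) (Yform G P) x = rhoScalar G P x := rfl
    rw [h3, sub_self] at h1
    exact (mul_eq_zero.1 h1.symm).resolve_left
      (mul_ne_zero (pow_ne_zero 3 (rhoRoot_pos (hY x hx)).ne') (hne x hx))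
  have hs' : ∀ a, pd a s x + (odeCoeff1 G P x * s x + odeCoeff0 G P x * ξ x)
      * odeForm G P a x = 0 := by
    refine hC.eq_zero_of_pair_Y_U hx (hne x hx) (α := fun a y => pd a s y
      + (odeCoeff1 G P y * s y + odeCoeff0 G P y * ξ y) * odeForm G P a y) ?_ ?_
    · have h2 := pair_U_Y (G := G) (P := P) (x := x)
      simp only [dirDeriv, pair, grad, Fin.sum_univ_two, odeForm] at hYs h2 ⊢
      linear_combination hYs + (odeCoeff1 G P x * s x + odeCoeff0 G P x * ξ x)
        * rhoRoot G P x ^ 2 * h2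
    · have h3 := hC.pair_U_U (P := P) hx
      simp only [dirDeriv, pair, grad, Fin.sum_univ_two, odeForm] at hUs h3 ⊢
      linear_combination hUs + (odeCoeff1 G P x * s x + odeCoeff0 G P x * ξ x)
        * rhoRoot G P x ^ 2 * h3
  intro j
  fin_cases j
  · refine ⟨differentiableAt_of_contDiffOn hC.isOpen hξ hx, fun i => ?_⟩
    have := hdξ x hx i
    simp only [odeSystem, Fin.sum_univ_two]
    simp [this, mul_comm]
  · refine ⟨hds, fun i => ?_⟩
    have := hs' i
    simp only [odeSystem, Fin.sum_univ_two]
    simp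
    linear_combination this

end IsMoebiusChart

end NonGenericSolutions

/-! ### Surfaces with $U_aV^a=0$. -/

section NonGenericSurfaces

open Set Filter

variable {M : Type*} [TopologicalSpace M] [ChartedSpace E2 M] [IsManifold (𝓡 2) ∞ M]
  (S : MoebiusSurface M)

namespace MoebiusSurface

lemma rho_pos (hY : S.IsNonFlat) (g : S.metrics) {e : OpenPartialHomeomorph M E2}
    (he : e ∈ atlas E2 M) : ∀ x ∈ e.target, 0 < rhoScalar (S.G g e) (S.P g e) x := fun x hx =>
  (S.isMoebiusChart g he).pair_self_pos hx (hY g e he x hx)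

/-- The non-generic case with vanishing obstruction. -/
theorem finrank_kernel_of_scalarObstructionVanishes [SimplyConnectedSpace M] (hY : S.IsNonFlat)
    (hV : S.IsNonGeneric) (h1 : S.OdeCondition1) (h2 : S.OdeCondition2)
    (hk : S.ScalarObstructionVanishes) : Module.finrank ℝ (LinearMap.ker S.operator) = 2 := by
  obtain ⟨g₀, hg₀⟩ := S.nonempty
  refine S.finrank_kernel_of_isLocalBasis ⟨g₀, hg₀⟩ fun p => ?_
  have he : chartAt E2 p ∈ atlas E2 M := chart_mem_atlas E2 p
  have hC := S.isMoebiusChart ⟨g₀, hg₀⟩ he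
  have hρ := S.rho_pos hY ⟨g₀, hg₀⟩ he
  have hV0 := hV ⟨g₀, hg₀⟩ _ he
  have hk0 := hk ⟨g₀, hg₀⟩ _ he
  have hb := h1 ⟨g₀, hg₀⟩ _ he
  have hc := h2 ⟨g₀, hg₀⟩ _ he
  set G := S.G ⟨g₀, hg₀⟩ (chartAt E2 p)
  set P := S.P ⟨g₀, hg₀⟩ (chartAt E2 p)
  have hne := fun y hy => (hρ y hy).ne'
  refine S.exists_isLocalBasis ⟨g₀, hg₀⟩ he (mem_chart_source E2 p) (m := rhoRoot G P)
    (hC.contDiffOn_odeSystem hne) (hC.contDiffOn_rhoRoot hne)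
    (fun x hx => (IsMoebiusChart.rhoRoot_pos (hρ x hx)).ne')
    (fun x hx j k => hC.odeSystem_flat hx hρ (hV0 x hx) (hb x hx) (hc x hx) j k)
    (fun x hx W hW i j => ?_) (fun x hx u hu => ?_) (fun x hx W hW h j => ?_)
  · obtain ⟨N, hN, hNo, hxN⟩ := eventually_nhds_iff.1
      (Filter.Eventually.and hW (hC.isOpen.mem_nhds hx))
    exact (hC.mono hNo fun y hy => (hN y hy).2).confEinstein_of_solvesAt_odeSystem
      (fun y hy => hρ y (hN y hy).2) (fun y hy => hV0 y (hN y hy).2) (fun y hy => (hN y hy).1) hxN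
      (hk0 x hx) i j
  · obtain ⟨N, hNU, hN, hxN, hu1, hu2⟩ := exists_isOpen_chartSolution hC.isOpen hx hu
    obtain ⟨W, hW⟩ := (hC.mono hN hNU).exists_solvesAt_odeSystem (fun y hy => hρ y (hNU hy))
      (fun y hy => hV0 y (hNU hy)) hu1 hu2
    refine ⟨W, ?_, ?_⟩
    · filter_upwards [hN.mem_nhds hxN] with y hy using (hW y hy).1
    · filter_upwards [hN.mem_nhds hxN] with y hy using (hW y hy).2
  · fin_cases j
    · exact h.self_of_nhds
    -- If $\xi$ vanishes near `x`, then $d\xi=s\omega=0$ there, and $\omega\neq0$ because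
    -- $|U|^2=\rho>0$.
    · have h3 : ∀ i, W 1 x * odeForm G P i x = 0 := fun i => by
        have h4 := (hW.self_of_nhds 0).2 i
        rw [pd_congr (v := fun _ => 0) h i, pd_const, Fin.sum_univ_two] at h4
        simp only [odeSystem, Matrix.cons_val, Fin.isValue, zero_mul, zero_add] at h4
        rw [mul_comm]
        exact h4.symm
      by_contra hW1
      have h5 : ∀ i, Uform G P i x = 0 := fun i =>
        (mul_eq_zero.1 ((mul_eq_zero.1 (h3 i)).resolve_left hW1)).resolve_left
          (pow_ne_zero 2 (IsMoebiusChart.rhoRoot_pos (hρ x hx)).ne')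
      refine hne x hx ?_
      rw [← hC.pair_U_U hx, pair, Fin.sum_univ_two, h5, h5]
      ring

/-- The non-generic case with non-vanishing obstruction. -/
theorem ker_eq_bot_of_not_scalarObstructionVanishes [PreconnectedSpace M] (hY : S.IsNonFlat)
    (hV : S.IsNonGeneric) (hk : ¬ S.ScalarObstructionVanishes) :
    LinearMap.ker S.operator = ⊥ := by
  simp only [ScalarObstructionVanishes, Everywhere, not_forall] at hk
  obtain ⟨g, e, he, x, hx, hk⟩ := hk
  have hC := S.isMoebiusChart g he
  have hρ := S.rho_pos hY g he
  have hV0 := hV g _ he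
  refine S.ker_eq_bot_of_eventually_eq_zero g fun w hw => ⟨e.symm x, ?_⟩
  have hu : ∀ y ∈ e.target, ∀ᶠ z in 𝓝 y,
      ChartSolution (S.G g e) (S.P g e) (fun z => w (e.symm z)) z := fun y hy => by
    filter_upwards [e.open_target.mem_nhds hy] with z hz
    exact chartSolution_of_holds he hz (hw _)
  have hcont : ContinuousOn (fun y => kScalar (S.G g e) (S.P g e) y
      + fScalar (S.G g e) (S.P g e) y * muScalar (S.G g e) (S.P g e) y) e.target :=
    (hC.contDiffOn_k.add ((hC.contDiffOn_f fun y hy => (hρ y hy).ne').mul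
      hC.contDiffOn_mu)).continuousOn
  have h1 := (hcont.continuousAt (hC.isOpen.mem_nhds hx)).eventually_ne hk
  have h2 : ∀ᶠ y in 𝓝 x, w (e.symm y) = 0 := by
    filter_upwards [h1, hC.isOpen.mem_nhds hx] with y hy hyt
    have h3 := hC.constraint hyt (hu y hyt)
    have h4 := hC.pair_V_grad hyt (hu y hyt)
    rw [hC.pair_comm hyt] at h3
    have h5 : pair (S.G g e) (Vform (S.G g e) (S.P g e)) (grad fun z => w (e.symm z)) y
        = fScalar (S.G g e) (S.P g e) y
          * pair (S.G g e) (Yform (S.G g e) (S.P g e)) (grad fun z => w (e.symm z)) y := by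
      simp only [pair, hC.V_eq_f_mul_Y hyt (hρ y hyt).ne' (hV0 y hyt), Fin.sum_univ_two]
      ring
    -- Both $V^a\nabla_a\sigma=k\sigma$ and $V^a\nabla_a\sigma=fY^a\nabla_a\sigma=-f\mu\sigma$ hold,
    -- so $(k+f\mu)\sigma=0$.
    refine (mul_eq_zero.1 (?_ : _ * w (e.symm y) = 0)).resolve_left hy
    linear_combination fScalar (S.G g e) (S.P g e) y * h3 - h4 + h5
  have h3 := (e.continuousAt (e.map_target hx)).tendsto
  rw [e.right_inv hx] at h3
  filter_upwards [h3.eventually h2, e.open_source.mem_nhds (e.map_target hx)] with q hq hqs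
  rwa [e.left_inv hqs] at hq

end MoebiusSurface

end NonGenericSurfaces

end Moebius

end

theorem mainTheorem5 (M : Type*) [TopologicalSpace M] [T2Space M] [SecondCountableTopology M]
    [SimplyConnectedSpace M] [ChartedSpace (EuclideanSpace ℝ (Fin 2)) M] [IsManifold (𝓡 2) ∞ M]
    (S : Moebius.MoebiusSurface M) :
    (S.IsFlat → Module.finrank ℝ (LinearMap.ker S.operator) = 4) ∧
    (S.IsNonFlat → S.IsGeneric →
      (S.ObstructionVanishes → Module.finrank ℝ (LinearMap.ker S.operator) = 1) ∧
      (¬ S.ObstructionVanishes → LinearMap.ker S.operator = ⊥)) ∧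
    (S.IsNonFlat → S.IsNonGeneric → S.OdeCondition1 → S.OdeCondition2 →
      (S.ScalarObstructionVanishes → Module.finrank ℝ (LinearMap.ker S.operator) = 2) ∧
      (¬ S.ScalarObstructionVanishes → LinearMap.ker S.operator = ⊥)) :=
  ⟨S.finrank_kernel_of_isFlat,
    fun _ hg => ⟨S.finrank_kernel_of_obstructionVanishes hg,
      S.ker_eq_bot_of_not_obstructionVanishes hg⟩,
    fun hY hV h1 h2 => ⟨S.finrank_kernel_of_scalarObstructionVanishes hY hV h1 h2,
      S.ker_eq_bot_of_not_scalarObstructionVanishes hY hV⟩⟩
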